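/- **Conventions.** An *oval* is a simple closed plane curve, given by an injective regular $C^2$ parametrization $\mathbf S^1\to P$ ($P$ an affine plane, or $\mathbf R^2$), whose curvature never vanishes. A set is *central* if it is invariant under reflection through some point. An embedded surface $S\subset\mathbf R^3$ *meets an affine plane $P$ transversally along an oval $\mathcal O$* if $\mathcal O\subset S\cap P$ is an oval and $T_pS\neq T_pP$ for every $p\in\mathcal O$ (the set $S\cap P$ may have other parts away from $\mathcal O$). The surface $S$ has the *central plane oval property* if it meets at least one affine plane transversally along an oval, and whenever $S$ meets an affine plane transversally along an oval, that oval is central. A *transversely convex tube* is a set $\mathcal T\subset\mathbf R^3$ which some affine isomorphism of $\mathbf R^3$ carries onto the image of an embedding $X:\mathbf S^1\times(-1,1)\to\mathbf R^3$ of the form $$X(\theta,z)=\bigl(\mathbf c(z)+\gamma(z;\theta),\,z\bigr),$$ where $\mathbf c:(-1,1)\to\mathbf R^2$ and $\gamma:(-1,1)\times\mathbf S^1\to\mathbf R^2$ are $C^2$ and, for each $z$, the map $\gamma(z;\cdot)$ parametrizes an oval with centroid at the origin. A *cylinder over a central oval* is the union of all lines of a fixed direction through the points of a central oval lying in a plane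 not parallel to that direction. A *quadric* is a level set $\{q=k\}$ of a polynomial $q$ of degree $2$ on $\mathbf R^3$. **Proposition (Collar Theorem).** Let $\mathcal T\subset\mathbf R^3$ be a transversely convex tube with the central plane oval property. Then $\mathcal T$ is contained in a cylinder over a central oval, or $\mathcal T$ is contained in a quadric. -/

import Mathlib

open scoped Topology ContDiff

noncomputable section

namespace CollarTheorem

/-- The euclidean plane. -/
abbrev E2 : Type := EuclideanSpace ℝ (Fin 2)

/-- Euclidean 3-space. -/
abbrev E3 : Type := EuclideanSpace ℝ (Fin 3)

/-- The point `(p, z)` of `ℝ² × ℝ = ℝ³`. -/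
def atHeight (p : E2) (z : ℝ) : E3 := !₂[p 0, p 1, z]

/-- `γ` is a regular `C²` parametrization of an oval: a `2π`-periodic map (that is, a map from
the circle), injective on the circle, with nowhere vanishing velocity and curvature
(velocity and acceleration are everywhere linearly independent).
Used in `ℝ²`, and for curves that lie in a plane of `ℝ³`. -/
structure IsOvalParam {V : Type*} [NormedAddCommGroup V] [NormedSpace ℝ V] (γ : ℝ → V) :
    Prop where
  contDiff : ContDiff ℝ 2 γ
  periodic : Function.Periodic γ (2 * Real.pi)
  injOn : Set.InjOn γ (Set.Ico 0 (2 * Real.pi))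
  curved : ∀ t : ℝ, LinearIndependent ℝ ![deriv γ t, deriv (deriv γ) t]

/-- `P` is an affine plane in `ℝ³`. -/
def IsPlane (P : AffineSubspace ℝ E3) : Prop := Module.finrank ℝ P.direction = 2

/-- `O` is an oval in the plane `P`. -/
def IsOvalIn (P : AffineSubspace ℝ E3) (O : Set E3) : Prop :=
  O ⊆ P ∧ ∃ γ : ℝ → E3, IsOvalParam γ ∧ O = Set.range γ

/-- `O` is symmetric under reflection through some point, its center. -/
def IsCentral (O : Set E3) : Prop :=
  ∃ c : E3, ∀ p ∈ O, Equiv.pointReflection c p ∈ O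

/-- `v` is a tangent vector at `p` of the embedded surface `S`: the velocity of a curve in `S`
through `p`. -/
def IsTangentVector (S : Set E3) (p v : E3) : Prop :=
  ∃ α : ℝ → E3, α 0 = p ∧ (∀ᶠ t in 𝓝 (0 : ℝ), α t ∈ S) ∧ HasDerivAt α v 0

/-- The embedded surface `S` meets the affine plane `P` transversally along the oval `O`:
`O` is an oval in `P` that lies on `S`, and at no point of `O` is the tangent plane of `S`
contained in (the direction of) `P`. Further parts of `S ∩ P` away from `O` are allowed. -/
def MeetsTransversallyAlong (S : Set E3) (P : AffineSubspace ℝ E3) (O : Set E3) : Prop :=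
  IsPlane P ∧ IsOvalIn P O ∧ O ⊆ S ∧ ∀ p ∈ O, ∃ v : E3, IsTangentVector S p v ∧ v ∉ P.direction

/-- The central plane oval property of an embedded surface `S ⊆ ℝ³`. -/
def HasCPO (S : Set E3) : Prop :=
  (∃ P O, MeetsTransversallyAlong S P O) ∧
    ∀ P O, MeetsTransversallyAlong S P O → IsCentral O

/-- `T` is a transversely convex tube in standard position: the image of
`X(θ, z) = (c(z) + γ(z; θ), z)`, `|z| < 1`, where `c` and `γ` are `C²` and each `γ(z; ·)`
parametrizes an oval with centroid (with respect to arc length) at the origin.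
Such an `X` is automatically an embedding of the annulus: it is injective and immersive because
every `γ(z; ·)` is, and it is a proper map into `ℝ² × (-1, 1)`. -/
def IsStandardTube (T : Set E3) : Prop :=
  ∃ (c : ℝ → E2) (γ : ℝ → ℝ → E2),
    ContDiffOn ℝ 2 c (Set.Ioo (-1) 1) ∧
    ContDiffOn ℝ 2 (fun q : ℝ × ℝ => γ q.1 q.2) (Set.Ioo (-1) 1 ×ˢ Set.univ) ∧
    (∀ z ∈ Set.Ioo (-1 : ℝ) 1, IsOvalParam (γ z) ∧
      ∫ p in Set.range (γ z), p ∂(MeasureTheory.Measure.hausdorffMeasure 1) = 0) ∧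
    T = {x : E3 | ∃ z ∈ Set.Ioo (-1 : ℝ) 1, ∃ θ : ℝ, x = atHeight (c z + γ z θ) z}

/-- `T` is a transversely convex tube: an affine isomorphism puts it in standard position. -/
def IsTransverselyConvexTube (T : Set E3) : Prop :=
  ∃ A : E3 ≃ᵃ[ℝ] E3, IsStandardTube (A '' T)

/-- `C` is a cylinder over a central oval: the union of all lines parallel to a fixed direction
`v` through the points of a central oval in a plane not parallel to `v`. -/
def IsCentralCylinder (C : Set E3) : Prop :=
  ∃ (P : AffineSubspace ℝ E3) (O : Set E3) (v : E3),
    IsPlane P ∧ IsOvalIn P O ∧ IsCentral O ∧ v ∉ P.direction ∧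
    C = {x : E3 | ∃ p ∈ O, ∃ t : ℝ, x = p + t • v}

/-- `Q` is a quadric: a level set of a quadratic polynomial on `ℝ³`. -/
def IsQuadric (Q : Set E3) : Prop :=
  ∃ (q : MvPolynomial (Fin 3) ℝ) (k : ℝ), q.totalDegree = 2 ∧
    Q = {x : E3 | MvPolynomial.eval (fun i => x i) q = k}

end CollarTheorem

end

/-!
Put the tube in standard position and let `h z φ` be the support function of its horizontal section
`γ z`. Horizontal planes meet the tube transversally, so `γ z` has a center, which is its
centroid `0`. By an implicit function theorem that is uniform over the circle, every plane
`z = z₀ + ε λ(x, z) + ε² b` with affine `λ` and small `ε` also meets the tube transversally along an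
oval (`CPOTube.exists_central_section`). So this oval is central. The proof exploits this for
suitable `λ` and `b`, by expansion in `ε` or by exact reflection.

*First order.* Take `λ = ℓ (x - c z₀)`. The center of the section has a linear height in the
direction `φ`, and half the difference of the support function at `φ` and `φ + π` computes it. By
Danskin's theorem its first derivative in `ε` is `ℓ p * ∂h/∂z`, with `p` the point of `γ z₀`
that is extremal in direction `φ`. Hence `ℓ p * ∂h/∂z` is a linear combination of `cos φ` and
`sin φ`, for all `ℓ` (`SymTube.first_order`). Together with `p = h u + h' u'` this forces
`∂h/∂z = κ(z) h`, and `h²` to be a quadratic form in `(cos φ, sin φ)` where `κ ≠ 0`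
(`normal_speed_eq`). So either `h` is independent of `z`, or all sections are homothetic ellipses
(`SymTube.supp_dichotomy`).

*Congruent sections.* To second order in `ε`, the same sections give that
`⟨c'' z₀, u φ⟩ (ℓ p)²` is linear in `u φ = (cos φ, sin φ)`, which is impossible unless `c'' z₀ = 0`:
the line of centers is straight, and the tube lies in a cylinder (`SymTube.subset_cylinder`).

*Elliptic sections.* In suitable linear coordinates `ℓ₁`, `ℓ₂` the sections are circles of squared
radius `R z` about `c z`. A plane `z = z₀ + ε (ℓ₁ x + ...) + ...` meets each of the disks
in a chord parallel to the kernel of `ℓ₁`, and the reflection in the center of the section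
permutes these chords (`RoundTube.exists_reflection`). Their midpoints give
`ℓ₂ (c z) + ℓ₂ (c (2 h - z)) = const`, whence `ℓ₂ ∘ c` is affine as `h → z₀`, and so is `ℓ₁ ∘ c`.
For a plane that is tilted about the line of centers, with `b` such that the center of the
section is at height `z₀` exactly, their lengths give that `R (z₀ + t) - R (z₀ - t)` is linear
in `t` for small `t`. Then `R''` is locally even about every point, therefore constant
(`quadratic_of_forall_eventually_reflect`), and the tube lies in a quadric.
-/

noncomputable section

namespace CollarTheorem

/-! ### Rotation of the tangent of a simple closed curve -/

theorem _root_.ContDiff.deriv_one {V : Type*} [NormedAddCommGroup V] [NormedSpace ℝ V]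
    {f : ℝ → V} (hf : ContDiff ℝ 2 f) : ContDiff ℝ 1 (deriv f) := by
  rw [← one_add_one_eq_two] at hf
  exact (contDiff_succ_iff_deriv.1 hf).2.2

/-- A nowhere vanishing function on the plane has a continuous logarithm. -/
theorem exists_continuous_log {w : ℝ × ℝ → ℂ} (hw : Continuous w) (h0 : ∀ q, w q ≠ 0)
    (q₀ : ℝ × ℝ) :
    ∃ L : ℝ × ℝ → ℂ, Continuous L ∧ (∀ q, Complex.exp (L q) = w q) ∧
      L q₀ = Complex.log (w q₀) := by
  obtain ⟨F, ⟨hF0, hF⟩, -⟩ := Complex.isCoveringMapOn_exp.existsUnique_continuousMap_lifts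
    (A := ℝ × ℝ) ⟨w, hw⟩ (a₀ := q₀) (e₀ := Complex.log (w q₀)) (Complex.exp_log (h0 q₀))
    (fun q => h0 q)
  exact ⟨F, F.continuous, fun q => congrFun hF q, hF0⟩

/-- Continuous logarithms on the line agree if they agree at a point. -/
theorem eq_of_exp_eq {F G : ℝ → ℂ} (hF : Continuous F) (hG : Continuous G)
    (h : ∀ s, Complex.exp (F s) = Complex.exp (G s)) {a : ℝ} (ha : F a = G a) : F = G :=
  Complex.isCoveringMap_exp.eq_of_comp_eq hF hG
    (funext fun s => Subtype.ext (h s)) a ha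

theorem eq_of_exp_eq_const {F : ℝ → ℂ} (hF : Continuous F) {w : ℂ}
    (h : ∀ s, Complex.exp (F s) = w) (a b : ℝ) : F a = F b := by
  have := eq_of_exp_eq hF (continuous_const (y := F b)) (fun s => by rw [h, h]) (a := b) rfl
  exact congrFun this a

/-- A continuous real function on `[0, b]` that starts at `0` and whose sine stays nonnegative
cannot leave `[0, π]`. -/
theorem mem_Icc_of_sin_nonneg {θ : ℝ → ℝ} (hθ : Continuous θ) {b : ℝ} (hb : 0 ≤ b)
    (h0 : θ 0 = 0) (hs : ∀ r ∈ Set.Icc 0 b, 0 ≤ Real.sin (θ r)) :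
    θ b ∈ Set.Icc 0 Real.pi := by
  have hpi := Real.pi_pos
  constructor
  · by_contra! hlt
    obtain ⟨r, hr, hr'⟩ : max (θ b) (-(Real.pi / 2)) ∈ θ '' Set.Icc 0 b := by
      apply intermediate_value_Icc' hb hθ.continuousOn
      rw [h0]
      exact ⟨le_max_left _ _, max_le hlt.le (by linarith)⟩
    have h1 := hs r hr
    rw [hr'] at h1
    have := Real.sin_neg_of_neg_of_neg_pi_lt (x := max (θ b) (-(Real.pi / 2)))
      (max_lt hlt (by linarith)) (lt_max_of_lt_right (by linarith))
    linarith
  · by_contra! hlt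
    obtain ⟨r, hr, hr'⟩ : min (θ b) (Real.pi + Real.pi / 2) ∈ θ '' Set.Icc 0 b := by
      apply intermediate_value_Icc hb hθ.continuousOn
      rw [h0]
      exact ⟨le_min (by linarith) (by linarith), min_le_left _ _⟩
    have h1 := hs r hr
    rw [hr'] at h1
    have := Real.sin_neg_of_neg_of_neg_pi_lt (x := min (θ b) (Real.pi + Real.pi / 2) - 2 * Real.pi)
      (by have := min_le_right (θ b) (Real.pi + Real.pi / 2); linarith)
      (by have := lt_min hlt (show Real.pi < Real.pi + Real.pi / 2 by linarith); linarith)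
    rw [Real.sin_sub_two_pi] at this
    linarith

/-- The difference quotient `(f (s + r) - f s) / r`, extended by `f' s` to `r = 0`. -/
def secant (f : ℝ → ℂ) (q : ℝ × ℝ) : ℂ := ∫ τ in (0 : ℝ)..1, deriv f (q.1 + τ * q.2)

theorem continuous_secant {f : ℝ → ℂ} (hf : ContDiff ℝ 2 f) : Continuous (secant f) := by
  have : Continuous (deriv f) := hf.continuous_deriv (by norm_num)
  unfold secant
  apply intervalIntegral.continuous_parametric_intervalIntegral_of_continuous'
  fun_prop

theorem secant_zero (f : ℝ → ℂ) (s : ℝ) : secant f (s, 0) = deriv f s := by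
  simp [secant]

theorem mul_secant {f : ℝ → ℂ} (hf : ContDiff ℝ 2 f) (s r : ℝ) :
    (r : ℂ) * secant f (s, r) = f (s + r) - f s := by
  have hc : Continuous (deriv f) := hf.continuous_deriv (by norm_num)
  have hd : Differentiable ℝ f := hf.differentiable (by norm_num)
  have h1 : ∀ τ ∈ Set.uIcc (0 : ℝ) 1,
      HasDerivAt (fun τ : ℝ => f (s + τ * r)) ((r : ℂ) * deriv f (s + τ * r)) τ := by
    intro τ _
    have h2 : HasDerivAt (fun τ : ℝ => s + τ * r) r τ := by
      simpa using ((hasDerivAt_id τ).mul_const r).const_add s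
    have := (hd (s + τ * r)).hasDerivAt.scomp τ h2
    simpa [Function.comp_def] using this
  have := intervalIntegral.integral_eq_sub_of_hasDerivAt h1
    (Continuous.intervalIntegrable (by fun_prop) _ _)
  simp only [intervalIntegral.integral_const_mul] at this
  simpa [secant] using this

section Hopf
variable {f : ℝ → ℂ}

theorem secant_ne_zero (hf : ContDiff ℝ 2 f)
    (hinj : ∀ s r, 0 < r → r < 2 * Real.pi → f (s + r) ≠ f s) (hreg : ∀ t, deriv f t ≠ 0)
    {s r : ℝ} (h0 : 0 ≤ r) (h1 : r ≤ Real.pi) : secant f (s, r) ≠ 0 := by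
  rcases h0.eq_or_lt with rfl | h0
  · rw [secant_zero]; exact hreg s
  · intro h
    have := mul_secant hf s r
    rw [h, mul_zero] at this
    exact hinj s r h0 (by linarith [Real.pi_pos]) (sub_eq_zero.1 this.symm)

/-- At the lowest point of a closed curve that turns counterclockwise, the curve
runs to the right. -/
theorem exists_lowest (hf : ContDiff ℝ 2 f) (hper : Function.Periodic f (2 * Real.pi))
    (hpos : ∀ t, 0 < (starRingEnd ℂ (deriv f t) * deriv (deriv f) t).im) :
    ∃ s, (∀ t, (f s).im ≤ (f t).im) ∧ (deriv f s).im = 0 ∧ 0 < (deriv f s).re := by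
  have hd : Differentiable ℝ f := hf.differentiable (by norm_num)
  have hf1 : ContDiff ℝ 1 (deriv f) := hf.deriv_one
  have hd1 : Differentiable ℝ (deriv f) := hf1.differentiable (by norm_num)
  have hgc : Continuous fun t => (f t).im := Complex.continuous_im.comp hf.continuous
  obtain ⟨s, -, hs⟩ := isCompact_Icc.exists_isMinOn
    (Set.nonempty_Icc.2 (by positivity : (0 : ℝ) ≤ 2 * Real.pi)) hgc.continuousOn
  have hmin : ∀ t, (f s).im ≤ (f t).im := by
    intro t
    obtain ⟨y, hy, hy'⟩ := hper.exists_mem_Ico₀ (by positivity) t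
    rw [hy']
    exact hs (Set.Ico_subset_Icc_self hy)
  have hdi : ∀ t, HasDerivAt (fun t => (f t).im) (deriv f t).im t := fun t =>
    Complex.imCLM.hasFDerivAt.comp_hasDerivAt t (hd t).hasDerivAt
  have hdi2 : ∀ t, HasDerivAt (fun t => (deriv f t).im) (deriv (deriv f) t).im t := fun t =>
    Complex.imCLM.hasFDerivAt.comp_hasDerivAt t (hd1 t).hasDerivAt
  have hloc : IsLocalMin (fun t => (f t).im) s := Filter.Eventually.of_forall hmin
  have h0 : (deriv f s).im = 0 := hloc.hasDerivAt_eq_zero (hdi s)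
  have hderiv : deriv (fun t => (f t).im) = fun t => (deriv f t).im := funext fun t => (hdi t).deriv
  have h2 : 0 ≤ (deriv (deriv f) s).im := by
    by_contra! hlt
    have hmax : IsLocalMax (fun t => (f t).im) s :=
      isLocalMax_of_deriv_deriv_neg (by rw [hderiv, (hdi2 s).deriv]; exact hlt)
        (by rw [hderiv]; exact h0) hgc.continuousAt
    have hconst : (fun t => (f t).im) =ᶠ[𝓝 s] fun _ => (f s).im := by
      filter_upwards [hmax] with t ht
      exact le_antisymm ht (hmin t)
    have h3 : (fun t => (deriv f t).im) =ᶠ[𝓝 s] fun _ => 0 := by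
      have := hconst.deriv
      rw [hderiv] at this
      simpa using this
    have h4 := h3.deriv_eq
    rw [(hdi2 s).deriv] at h4
    simp at h4
    linarith
  refine ⟨s, hmin, h0, ?_⟩
  have := hpos s
  simp [Complex.mul_im, h0] at this
  by_contra! hle
  nlinarith

/-- Hopf's theorem of turning tangents: the tangent of a simple closed curve turns exactly once.
The argument follows the direction of the secants from `s` to `s + r` from `r = 0` to half a
period. -/
theorem exists_tangent_angle (hf : ContDiff ℝ 2 f) (hper : Function.Periodic f (2 * Real.pi))
    (hinj : ∀ s r, 0 < r → r < 2 * Real.pi → f (s + r) ≠ f s)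
    (hpos : ∀ t, 0 < (starRingEnd ℂ (deriv f t) * deriv (deriv f) t).im) :
    ∃ L : ℝ → ℂ, (∀ t, Complex.exp (L t) = deriv f t) ∧ Continuous L ∧
      ∀ t, (L (t + 2 * Real.pi)).im = (L t).im + 2 * Real.pi := by
  have hpi := Real.pi_pos
  have hreg : ∀ t, deriv f t ≠ 0 := fun t h => by simpa [h] using hpos t
  obtain ⟨s₀, hlow, him, hre⟩ := exists_lowest hf hper hpos
  set w : ℝ × ℝ → ℂ := fun q => secant f (q.1, max 0 (min q.2 Real.pi)) with hw
  have hwc : Continuous w := (continuous_secant hf).comp (by fun_prop)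
  have hw0 : ∀ q, w q ≠ 0 := fun q => secant_ne_zero hf hinj hreg (le_max_left _ _)
    (max_le hpi.le (min_le_right _ _))
  have hwr : ∀ s r, 0 ≤ r → r ≤ Real.pi → w (s, r) = secant f (s, r) := by
    intro s r h0 h1
    simp [hw, min_eq_left h1, max_eq_right h0]
  obtain ⟨L, hLc, hL, hL0⟩ := exists_continuous_log hwc hw0 (s₀, 0)
  have hL00 : (L (s₀, 0)).im = 0 := by
    rw [hL0, hwr _ _ le_rfl hpi.le, secant_zero, Complex.log_im, Complex.arg_eq_zero_iff]
    exact ⟨hre.le, him⟩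
  -- the sine of the lifted angle has the sign of the imaginary part of the secant
  have hsin : ∀ q, (w q).im = Real.exp (L q).re * Real.sin (L q).im := fun q => by
    rw [← hL q, Complex.exp_im]
  -- half a period turns the chord that spans half a period around
  have hturn : ∀ s, Complex.exp (L (s + Real.pi, Real.pi) - L (s, Real.pi)) = -1 := by
    intro s
    rw [Complex.exp_sub, hL, hL, hwr _ _ hpi.le le_rfl, hwr _ _ hpi.le le_rfl]
    have h1 := mul_secant hf s Real.pi
    have h2 := mul_secant hf (s + Real.pi) Real.pi
    have h3 : f (s + Real.pi + Real.pi) = f s := by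
      rw [show s + Real.pi + Real.pi = s + 2 * Real.pi by ring]; exact hper s
    have hpi' : (Real.pi : ℂ) ≠ 0 := by exact_mod_cast hpi.ne'
    have hne := secant_ne_zero hf hinj hreg (s := s) hpi.le le_rfl
    rw [div_eq_iff hne]
    apply mul_left_cancel₀ hpi'
    rw [h2, h3]
    linear_combination h1
  have hD := eq_of_exp_eq_const (F := fun s => L (s + Real.pi, Real.pi) - L (s, Real.pi))
    (by fun_prop) hturn
  set D₀ := L (s₀, Real.pi) - L (s₀ - Real.pi, Real.pi) with hD₀
  have hDs : ∀ s, L (s + Real.pi, Real.pi) - L (s, Real.pi) = D₀ := by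
    intro s
    have := hD s (s₀ - Real.pi)
    simpa using this
  have hDexp : Complex.exp D₀ = -1 := by rw [← hDs s₀, hturn]
  -- seen from the lowest point, secants point upward, so the angle stays in `[0, π]`
  have hout : (L (s₀, Real.pi)).im ∈ Set.Icc 0 Real.pi := by
    refine mem_Icc_of_sin_nonneg (θ := fun r => (L (s₀, r)).im) (by fun_prop) hpi.le hL00 ?_
    intro r hr
    have h1 := hsin (s₀, r)
    rw [hwr _ _ hr.1 hr.2] at h1
    have h2 : 0 ≤ (secant f (s₀, r)).im := by
      rcases hr.1.eq_or_lt with rfl | h0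
      · rw [secant_zero, him]
      · have := congrArg Complex.im (mul_secant hf s₀ r)
        simp at this
        have := hlow (s₀ + r)
        by_contra! hlt
        nlinarith
    rw [h1] at h2
    exact nonneg_of_mul_nonneg_right h2 (Real.exp_pos _)
  -- secants that end at the lowest point run downward
  have hin : -(L (s₀ - Real.pi, Real.pi)).im ∈ Set.Icc 0 Real.pi := by
    refine mem_Icc_of_sin_nonneg (θ := fun r => -(L (s₀ - r, r)).im) (by fun_prop) hpi.le
      (by simpa using hL00) ?_
    intro r hr
    have h1 := hsin (s₀ - r, r)
    rw [hwr _ _ hr.1 hr.2] at h1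
    have h2 : (secant f (s₀ - r, r)).im ≤ 0 := by
      rcases hr.1.eq_or_lt with rfl | h0
      · rw [secant_zero, sub_zero, him]
      · have := congrArg Complex.im (mul_secant hf (s₀ - r) r)
        simp at this
        have := hlow (s₀ - r)
        by_contra! hlt
        nlinarith
    rw [h1] at h2
    rw [Real.sin_neg]
    have := Real.exp_pos (L (s₀ - r, r)).re
    by_contra! hlt
    nlinarith
  -- an odd multiple of `π` between `0` and `2π`
  have hDim : D₀.im = Real.pi := by
    have h1 : D₀.im = (L (s₀, Real.pi)).im - (L (s₀ - Real.pi, Real.pi)).im := by simp [hD₀]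
    have h2 : Real.exp D₀.re * Real.cos D₀.im = -1 := by
      rw [← Complex.exp_re, hDexp]; simp
    have h3 : Real.exp D₀.re * Real.sin D₀.im = 0 := by
      rw [← Complex.exp_im, hDexp]; simp
    have h4 : Real.sin (D₀.im - Real.pi) = 0 := by
      rw [Real.sin_sub_pi]
      simpa using h3
    have h5 : 0 ≤ D₀.im := by linarith [hout.1, hin.1]
    have h6 : D₀.im ≤ 2 * Real.pi := by linarith [hout.2, hin.2]
    have h7 : D₀.im ≠ 0 := fun h => by
      rw [h, Real.cos_zero] at h2; linarith [Real.exp_pos D₀.re]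
    have h8 : D₀.im ≠ 2 * Real.pi := fun h => by
      rw [h, Real.cos_two_pi] at h2; linarith [Real.exp_pos D₀.re]
    have := (Real.sin_eq_zero_iff_of_lt_of_lt
      (by linarith [lt_of_le_of_ne h5 (Ne.symm h7)])
      (by linarith [lt_of_le_of_ne h6 h8])).1 h4
    linarith
  have hsper : ∀ s r, secant f (s + 2 * Real.pi, r) = secant f (s, r) := by
    intro s r
    unfold secant
    congr 1
    ext τ
    have h1 : Function.Periodic (deriv f) (2 * Real.pi) := fun t => by
      rw [← deriv_comp_add_const]
      congr 1
      exact funext hper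
    have := h1 (s + τ * r)
    simp only
    rw [← this]
    congr 1
    ring
  refine ⟨fun t => L (t, 0), fun t => ?_, by fun_prop, fun t => ?_⟩
  · rw [hL, hwr _ _ le_rfl hpi.le, secant_zero]
  · have h1 := eq_of_exp_eq_const (F := fun r => L (t + 2 * Real.pi, r) - L (t, r)) (w := 1)
      (by fun_prop) (fun r => by
        rw [Complex.exp_sub, hL, hL, div_eq_one_iff_eq (hw0 _)]
        exact hsper _ _) 0 Real.pi
    have h2 := hDs t
    have h3 := hDs (t + Real.pi)
    rw [show t + Real.pi + Real.pi = t + 2 * Real.pi by ring] at h3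
    have h4 : L (t + 2 * Real.pi, 0) = L (t, 0) + 2 * D₀ := by
      linear_combination h1 + h2 + h3
    simp [h4, hDim]

/-- A simple closed curve that turns counterclockwise everywhere lies strictly to the left of
each of its tangent lines. -/
theorem left_of_tangent (hf : ContDiff ℝ 2 f) (hper : Function.Periodic f (2 * Real.pi))
    (hinj : ∀ s r, 0 < r → r < 2 * Real.pi → f (s + r) ≠ f s)
    (hpos : ∀ t, 0 < (starRingEnd ℂ (deriv f t) * deriv (deriv f) t).im)
    {s t : ℝ} (hst : s < t) (hts : t < s + 2 * Real.pi) :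
    0 < (starRingEnd ℂ (deriv f s) * (f t - f s)).im := by
  have hpi := Real.pi_pos
  have hreg : ∀ t, deriv f t ≠ 0 := fun t h => by simpa [h] using hpos t
  obtain ⟨L, hL, hLc, hLper⟩ := exists_tangent_angle hf hper hinj hpos
  have hd : Differentiable ℝ f := hf.differentiable (by norm_num)
  have hf1 : ContDiff ℝ 1 (deriv f) := hf.deriv_one
  have hd1 : Differentiable ℝ (deriv f) := hf1.differentiable (by norm_num)
  have hc2 : Continuous (deriv (deriv f)) := hf1.continuous_deriv (by norm_num)
  -- a continuous logarithm is the integral of the logarithmic derivative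
  have hLd : ∀ t, HasDerivAt L (deriv (deriv f) t / deriv f t) t := by
    have hq : Continuous fun t => deriv (deriv f) t / deriv f t :=
      hc2.div hf1.continuous hreg
    set M : ℝ → ℂ := fun t => L 0 + ∫ x in (0 : ℝ)..t, deriv (deriv f) x / deriv f x with hM
    have hMd : ∀ t, HasDerivAt M (deriv (deriv f) t / deriv f t) t := fun t =>
      (hq.integral_hasStrictDerivAt 0 t).hasDerivAt.const_add _
    have hMc : Continuous M := continuous_iff_continuousAt.2 fun t => (hMd t).continuousAt
    have hconst : ∀ t, deriv f t * Complex.exp (-M t) = 1 := by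
      have hder : ∀ t, HasDerivAt (fun t => deriv f t * Complex.exp (-M t)) 0 t := by
        intro t
        have h1 : HasDerivAt (fun t => Complex.exp (-M t))
            (Complex.exp (-M t) * -(deriv (deriv f) t / deriv f t)) t := (hMd t).neg.cexp
        have := (hd1 t).hasDerivAt.mul h1
        refine this.congr_deriv ?_
        have := hreg t
        field_simp
        ring
      intro t
      have := is_const_of_deriv_eq_zero (fun t => (hder t).differentiableAt)
        (fun t => (hder t).deriv) t 0
      rw [this]
      simp only [hM, intervalIntegral.integral_same, add_zero]
      rw [← hL 0, ← Complex.exp_add]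
      simp
    have hexp : ∀ t, Complex.exp (L t) = Complex.exp (M t) := by
      intro t
      have := hconst t
      rw [hL, ← mul_one (Complex.exp (M t)), ← this, Complex.exp_neg]
      have := Complex.exp_ne_zero (M t)
      field_simp
    have : L = M := eq_of_exp_eq hLc hMc hexp (a := 0) (by simp [hM])
    rw [this]
    exact hMd
  have hαd : ∀ t, HasDerivAt (fun t => (L t).im) (deriv (deriv f) t / deriv f t).im t :=
    fun t => Complex.imCLM.hasFDerivAt.comp_hasDerivAt t (hLd t)
  have hαmono : StrictMono fun t => (L t).im := by
    apply strictMono_of_deriv_pos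
    intro t
    rw [(hαd t).deriv]
    have h1 : deriv (deriv f) t / deriv f t =
        (starRingEnd ℂ (deriv f t) * deriv (deriv f) t) * ((Complex.normSq (deriv f t))⁻¹ : ℝ) := by
      rw [div_eq_mul_inv, Complex.inv_def]
      ring
    rw [h1, Complex.im_mul_ofReal]
    have := hpos t
    have := Complex.normSq_pos.2 (hreg t)
    positivity
  -- the distance from the tangent at `s` grows until the tangent has turned by `π` at `t₁`, and
  -- decreases to zero afterwards
  set g : ℝ → ℝ := fun t => (starRingEnd ℂ (deriv f s) * (f t - f s)).im with hg
  have hgd : ∀ t, HasDerivAt g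
      (Real.exp ((L s).re + (L t).re) * Real.sin ((L t).im - (L s).im)) t := by
    intro t
    have h1 : HasDerivAt (fun t => starRingEnd ℂ (deriv f s) * (f t - f s))
        (starRingEnd ℂ (deriv f s) * deriv f t) t := ((hd t).hasDerivAt.sub_const _).const_mul _
    have h2 := Complex.imCLM.hasFDerivAt.comp_hasDerivAt t h1
    refine h2.congr_deriv ?_
    rw [← hL s, ← hL t, ← Complex.exp_conj, ← Complex.exp_add]
    simp [Complex.exp_im]
    congr 1
    ring
  have hgc : Continuous g := continuous_iff_continuousAt.2 fun t => (hgd t).continuousAt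
  obtain ⟨t₁, ht₁, ht₁'⟩ :
      (L s).im + Real.pi ∈ (fun t => (L t).im) '' Set.Icc s (s + 2 * Real.pi) := by
    apply intermediate_value_Icc (by linarith) (by fun_prop)
    rw [hLper]
    constructor <;> linarith
  simp only at ht₁'
  rcases le_total t t₁ with h | h
  · have hmono : StrictMonoOn g (Set.Icc s t₁) := by
      apply strictMonoOn_of_deriv_pos (convex_Icc _ _) hgc.continuousOn
      intro x hx
      rw [interior_Icc] at hx
      rw [(hgd x).deriv]
      have h1 := hαmono hx.1
      have h2 := hαmono hx.2
      simp only at h1 h2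
      exact mul_pos (Real.exp_pos _) (Real.sin_pos_of_pos_of_lt_pi (by linarith) (by linarith))
    have := hmono ⟨le_rfl, by linarith⟩ ⟨hst.le, h⟩ hst
    simpa [hg] using this
  · have hanti : StrictAntiOn g (Set.Icc t₁ (s + 2 * Real.pi)) := by
      apply strictAntiOn_of_deriv_neg (convex_Icc _ _) hgc.continuousOn
      intro x hx
      rw [interior_Icc] at hx
      rw [(hgd x).deriv]
      have h1 := hαmono hx.1
      have h2 := hαmono hx.2
      simp only [hLper] at h1 h2
      have h3 : Real.sin ((L x).im - (L s).im) < 0 := by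
        have h4 := Real.sin_neg_of_neg_of_neg_pi_lt (x := (L x).im - (L s).im - 2 * Real.pi)
          (by linarith) (by linarith)
        rwa [Real.sin_sub_two_pi] at h4
      exact mul_neg_of_pos_of_neg (Real.exp_pos _) h3
    have := hanti ⟨h, hts.le⟩ ⟨by linarith, le_rfl⟩ hts
    have h5 : g (s + 2 * Real.pi) = 0 := by simp [hg, hper s]
    rw [h5] at this
    exact this

end Hopf

/-! ### Convexity of ovals -/

/-- The cross product (oriented area) of two plane vectors. -/
def cross (x y : E2) : ℝ := x 0 * y 1 - x 1 * y 0

/-- The linear functional `⟨·, (cos φ, sin φ)⟩` on the plane: the height in direction `φ`. -/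
def heightIn (φ : ℝ) : E2 →L[ℝ] ℝ :=
  Real.cos φ • EuclideanSpace.proj 0 + Real.sin φ • EuclideanSpace.proj 1

theorem heightIn_apply (φ : ℝ) (x : E2) :
    heightIn φ x = Real.cos φ * x 0 + Real.sin φ * x 1 := by
  simp [heightIn]

theorem cross_ne_zero_of_linearIndependent {x y : E2} (h : LinearIndependent ℝ ![x, y]) :
    cross x y ≠ 0 := by
  intro h0
  unfold cross at h0
  rw [LinearIndependent.pair_iff] at h
  have h1 := h (y 1) (-x 1) (by
    ext i; fin_cases i
    · simp; linarith
    · simp; ring)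
  have h2 := h (y 0) (-x 0) (by
    ext i; fin_cases i
    · simp; ring
    · simp; linarith)
  have hx : x = 0 := by
    ext i; fin_cases i
    · simpa using h2.2
    · simpa using h1.2
  have := h 1 0 (by simp [hx])
  simp at this

/-- The plane, identified with `ℂ`, or with its mirror image if `σ = -1`. -/
def toComplex (σ : ℝ) : E2 →L[ℝ] ℂ :=
  Complex.ofRealCLM.comp (EuclideanSpace.proj 0) +
    (σ * Complex.I) • Complex.ofRealCLM.comp (EuclideanSpace.proj 1)

theorem toComplex_re (σ : ℝ) (x : E2) : (toComplex σ x).re = x 0 := by simp [toComplex]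

theorem toComplex_im (σ : ℝ) (x : E2) : (toComplex σ x).im = σ * x 1 := by simp [toComplex]

namespace IsOvalParam
section
variable {V : Type*} [NormedAddCommGroup V] [NormedSpace ℝ V] {γ : ℝ → V}

theorem add_ne (h : IsOvalParam γ) (s r : ℝ) (h0 : 0 < r) (h1 : r < 2 * Real.pi) :
    γ (s + r) ≠ γ s := by
  intro heq
  have hp : 0 < 2 * Real.pi := by positivity
  obtain ⟨n, hn, -⟩ := existsUnique_add_zsmul_mem_Ico hp s 0
  rw [zero_add] at hn
  set s' := s + n • (2 * Real.pi) with hs'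
  have e1 : γ s' = γ s := h.periodic.zsmul n s
  have e2 : γ (s' + r) = γ (s + r) := by
    rw [hs', add_right_comm]; exact h.periodic.zsmul n (s + r)
  rcases lt_or_ge (s' + r) (2 * Real.pi) with hlt | hge
  · have := h.injOn ⟨by linarith [hn.1], hlt⟩ hn (by rw [e2, e1, heq])
    linarith
  · have e3 : γ (s' + r - 2 * Real.pi) = γ (s' + r) := h.periodic.sub_eq _
    have : s' + r - 2 * Real.pi = s' :=
      h.injOn ⟨by linarith [hn.1], by linarith [hn.2]⟩ hn (by rw [e3, e2, e1, heq])
    linarith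

theorem exists_int (h : IsOvalParam γ) {a b : ℝ} (hab : γ a = γ b) :
    ∃ n : ℤ, b = a + n * (2 * Real.pi) := by
  have hp : 0 < 2 * Real.pi := by positivity
  obtain ⟨n, hn, -⟩ := existsUnique_add_zsmul_mem_Ico hp b a
  have e1 : γ (b + n • (2 * Real.pi)) = γ b := h.periodic.zsmul n b
  rcases hn.1.eq_or_lt with heq | hlt
  · refine ⟨-n, ?_⟩
    simp at heq ⊢
    linarith
  · exfalso
    apply h.add_ne a (b + n • (2 * Real.pi) - a) (by linarith) (by linarith [hn.2])
    rw [add_sub_cancel, e1, hab]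

theorem exists_mem_Icc (h : IsOvalParam γ) (t : ℝ) :
    ∃ s ∈ Set.Icc 0 (2 * Real.pi), γ s = γ t := by
  obtain ⟨y, hy, hy'⟩ := h.periodic.exists_mem_Ico₀ (by positivity) t
  exact ⟨y, Set.Ico_subset_Icc_self hy, hy'.symm⟩

theorem hasDerivAt (h : IsOvalParam γ) (t : ℝ) : HasDerivAt γ (deriv γ t) t :=
  (h.contDiff.differentiable (by norm_num) t).hasDerivAt

theorem hasDerivAt_deriv (h : IsOvalParam γ) (t : ℝ) :
    HasDerivAt (deriv γ) (deriv (deriv γ) t) t :=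
  (h.contDiff.deriv_one.differentiable (by norm_num) t).hasDerivAt

theorem range_eq_image (h : IsOvalParam γ) : Set.range γ = γ '' Set.Icc 0 (2 * Real.pi) := by
  refine Set.Subset.antisymm ?_ (Set.image_subset_range _ _)
  rintro _ ⟨t, rfl⟩
  exact h.exists_mem_Icc t

theorem isCompact_range (h : IsOvalParam γ) : IsCompact (Set.range γ) := by
  rw [h.range_eq_image]
  exact isCompact_Icc.image h.contDiff.continuous

end

variable {γ : ℝ → E2}

/-- Convexity of ovals: an oval lies strictly on one side of each of its tangents,
and always on the same side with respect to its orientation. -/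
theorem cross_pos (h : IsOvalParam γ) : ∃ σ : ℝ, ∀ s t, γ t ≠ γ s →
    0 < σ * cross (deriv γ s) (γ t - γ s) := by
  have hne : ∀ t, cross (deriv γ t) (deriv (deriv γ) t) ≠ 0 := fun t =>
    cross_ne_zero_of_linearIndependent (h.curved t)
  have hc1 : Continuous (deriv γ) := h.contDiff.deriv_one.continuous
  have hc2 : Continuous (deriv (deriv γ)) := h.contDiff.deriv_one.continuous_deriv (by norm_num)
  have hcont : Continuous fun t => cross (deriv γ t) (deriv (deriv γ) t) := by
    unfold cross; fun_prop
  -- the curvature has constant sign; mirror the curve if this is negative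
  obtain ⟨σ, hσ⟩ : ∃ σ : ℝ, ∀ t, 0 < σ * cross (deriv γ t) (deriv (deriv γ) t) := by
    by_cases h0 : 0 < cross (deriv γ 0) (deriv (deriv γ) 0)
    · refine ⟨1, fun t => ?_⟩
      by_contra! hle
      obtain ⟨x, hx⟩ := mem_range_of_exists_le_of_exists_ge hcont
        ⟨t, by simpa using hle⟩ ⟨0, h0.le⟩
      exact hne x hx
    · refine ⟨-1, fun t => ?_⟩
      by_contra! hle
      obtain ⟨x, hx⟩ := mem_range_of_exists_le_of_exists_ge hcont
        ⟨0, not_lt.1 h0⟩ ⟨t, by simpa using hle⟩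
      exact hne x hx
  have hσ0 : σ ≠ 0 := fun h0 => by simpa [h0] using hσ 0
  set f : ℝ → ℂ := fun t => toComplex σ (γ t) with hf
  have hd1 : deriv f = fun t => toComplex σ (deriv γ t) := funext fun t =>
    ((toComplex σ).hasFDerivAt.comp_hasDerivAt t (h.hasDerivAt t)).deriv
  have hd2 : deriv (deriv f) = fun t => toComplex σ (deriv (deriv γ) t) := by
    rw [hd1]
    exact funext fun t =>
      ((toComplex σ).hasFDerivAt.comp_hasDerivAt t (h.hasDerivAt_deriv t)).deriv
  have him : ∀ x y : E2, (starRingEnd ℂ (toComplex σ x) * toComplex σ y).im = σ * cross x y := by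
    intro x y
    simp [Complex.mul_im, toComplex_re, toComplex_im, cross]
    ring
  refine ⟨σ, fun s t hst => ?_⟩
  have hp : 0 < 2 * Real.pi := by positivity
  obtain ⟨n, hn, -⟩ := existsUnique_add_zsmul_mem_Ico hp t s
  have e1 : γ (t + n • (2 * Real.pi)) = γ t := h.periodic.zsmul n t
  have hlt : s < t + n • (2 * Real.pi) := by
    refine lt_of_le_of_ne hn.1 fun heq => hst ?_
    rw [← e1, ← heq]
  have := left_of_tangent (f := f) ((toComplex σ).contDiff.comp h.contDiff)
    (fun t => by simp only [hf, h.periodic t]) (fun s r h0 h1 heq => h.add_ne s r h0 h1 (by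
      have hre := congrArg Complex.re heq
      have him := congrArg Complex.im heq
      simp only [hf, toComplex_re, toComplex_im] at hre him
      ext i; fin_cases i
      · exact hre
      · exact mul_left_cancel₀ hσ0 him))
    (fun t => by rw [hd2, hd1]; simp only [him]; exact hσ t) hlt hn.2
  rw [hd1] at this
  simp only [hf, ← map_sub, him] at this
  rwa [e1] at this

/-- Every point of an oval is the unique highest point in some direction. -/
theorem exists_heightIn_lt (h : IsOvalParam γ) (s : ℝ) :
    ∃ φ, ∀ t, γ t ≠ γ s → heightIn φ (γ t) < heightIn φ (γ s) := by
  obtain ⟨σ, hσ⟩ := h.cross_pos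
  set v := deriv γ s with hv
  set z : ℂ := ⟨σ * v 1, -(σ * v 0)⟩ with hz
  refine ⟨z.arg, fun t ht => ?_⟩
  have h1 := hσ s t ht
  rw [← sub_neg, ← map_sub, heightIn_apply]
  have h2 : z.re = ‖z‖ * Real.cos z.arg := (Complex.norm_mul_cos_arg z).symm
  have h3 : z.im = ‖z‖ * Real.sin z.arg := (Complex.norm_mul_sin_arg z).symm
  have h4 : ‖z‖ * (Real.cos z.arg * (γ t - γ s) 0 + Real.sin z.arg * (γ t - γ s) 1) < 0 := by
    rw [mul_add, ← mul_assoc, ← mul_assoc, ← h2, ← h3]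
    simp only [hz]
    unfold cross at h1
    linarith
  by_contra! hge
  have := mul_nonneg (norm_nonneg z) hge
  linarith

/-- The highest point of an oval in any given direction is unique. -/
theorem heightIn_lt_of_forall_le (h : IsOvalParam γ) {φ s : ℝ}
    (hs : ∀ t, heightIn φ (γ t) ≤ heightIn φ (γ s)) (t : ℝ) (ht : γ t ≠ γ s) :
    heightIn φ (γ t) < heightIn φ (γ s) := by
  obtain ⟨σ, hσ⟩ := h.cross_pos
  have h1 := hσ s t ht
  have hd : HasDerivAt (fun t => heightIn φ (γ t)) (heightIn φ (deriv γ s)) s :=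
    (heightIn φ).hasFDerivAt.comp_hasDerivAt s (h.hasDerivAt s)
  have h0 := IsLocalMax.hasDerivAt_eq_zero (Filter.Eventually.of_forall hs) hd
  refine lt_of_le_of_ne (hs t) fun heq => ?_
  have h2 : heightIn φ (γ t - γ s) = 0 := by rw [map_sub, heq, sub_self]
  rw [heightIn_apply] at h0 h2
  have h3 : cross (deriv γ s) (γ t - γ s) = 0 := by
    unfold cross
    have := Real.sin_sq_add_cos_sq φ
    set a := deriv γ s 0
    set b := deriv γ s 1
    set x := (γ t - γ s) 0
    set y := (γ t - γ s) 1
    have hc : Real.cos φ * (a * y - b * x) = 0 := by linear_combination y * h0 - b * h2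
    have hs : Real.sin φ * (a * y - b * x) = 0 := by linear_combination a * h2 - x * h0
    linear_combination Real.cos φ * hc + Real.sin φ * hs - (a * y - b * x) * this
  rw [h3, mul_zero] at h1
  exact lt_irrefl _ h1

end IsOvalParam

/-! ### Affine invariance -/

theorem IsOvalParam.comp_affine {V W : Type*} [NormedAddCommGroup V] [NormedSpace ℝ V]
    [NormedAddCommGroup W] [NormedSpace ℝ W] {γ : ℝ → V} (h : IsOvalParam γ) (L : V →L[ℝ] W)
    (hL : Function.Injective L) (w : W) : IsOvalParam fun t => L (γ t) + w := by
  have hd1 : deriv (fun t => L (γ t) + w) = fun t => L (deriv γ t) := funext fun t =>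
    ((L.hasFDerivAt.comp_hasDerivAt t (h.hasDerivAt t)).add_const w).deriv
  have hd2 : deriv (deriv fun t => L (γ t) + w) = fun t => L (deriv (deriv γ) t) := by
    rw [hd1]
    exact funext fun t => (L.hasFDerivAt.comp_hasDerivAt t (h.hasDerivAt_deriv t)).deriv
  refine ⟨(L.contDiff.comp h.contDiff).add contDiff_const, fun t => ?_, fun a ha b hb hab => ?_,
    fun t => ?_⟩
  · simp only [h.periodic t]
  · exact h.injOn ha hb (hL (add_right_cancel hab))
  · rw [hd2, hd1]
    rw [LinearIndependent.pair_iff]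
    intro a b hab
    refine LinearIndependent.pair_iff.1 (h.curved t) a b (hL ?_)
    simpa using hab

/-- The linear part of an affine automorphism of space. -/
def linearPart (A : E3 ≃ᵃ[ℝ] E3) : E3 ≃L[ℝ] E3 := A.linear.toContinuousLinearEquiv

theorem apply_eq_linearPart (A : E3 ≃ᵃ[ℝ] E3) (x : E3) : A x = linearPart A x + A 0 := by
  have := A.map_vadd 0 x
  simpa [linearPart] using this

theorem IsPlane.map {P : AffineSubspace ℝ E3} (hP : IsPlane P) (A : E3 ≃ᵃ[ℝ] E3) :
    IsPlane (P.map A.toAffineMap) := by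
  unfold IsPlane at *
  rw [AffineSubspace.map_direction, ← hP]
  exact LinearEquiv.finrank_map_eq A.linear P.direction

theorem mem_direction_map {P : AffineSubspace ℝ E3} {A : E3 ≃ᵃ[ℝ] E3} {v : E3} :
    linearPart A v ∈ (P.map A.toAffineMap).direction ↔ v ∈ P.direction := by
  rw [AffineSubspace.map_direction, Submodule.mem_map]
  constructor
  · rintro ⟨w, hw, hwv⟩
    have : w = v := A.linear.injective hwv
    rwa [← this]
  · exact fun hv => ⟨v, hv, rfl⟩

theorem IsOvalIn.map {P : AffineSubspace ℝ E3} {O : Set E3} (h : IsOvalIn P O)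
    (A : E3 ≃ᵃ[ℝ] E3) : IsOvalIn (P.map A.toAffineMap) (A '' O) := by
  obtain ⟨hOP, γ, hγ, rfl⟩ := h
  refine ⟨?_, fun t => linearPart A (γ t) + A 0,
    hγ.comp_affine (linearPart A : E3 →L[ℝ] E3) (linearPart A).injective _, ?_⟩
  · rintro _ ⟨x, hx, rfl⟩
    exact AffineSubspace.mem_map_of_mem A.toAffineMap (hOP hx)
  · rw [← Set.range_comp]
    exact congrArg Set.range (funext fun t => apply_eq_linearPart A (γ t))

theorem IsCentral.map {O : Set E3} (h : IsCentral O) (A : E3 ≃ᵃ[ℝ] E3) :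
    IsCentral (A '' O) := by
  obtain ⟨c, hc⟩ := h
  refine ⟨A c, ?_⟩
  rintro _ ⟨x, hx, rfl⟩
  refine ⟨_, hc x hx, ?_⟩
  rw [Equiv.pointReflection_apply, Equiv.pointReflection_apply, A.map_vadd]
  congr 1
  exact A.toAffineMap.linearMap_vsub c x

theorem MeetsTransversallyAlong.map {S : Set E3} {P : AffineSubspace ℝ E3} {O : Set E3}
    (h : MeetsTransversallyAlong S P O) (A : E3 ≃ᵃ[ℝ] E3) :
    MeetsTransversallyAlong (A '' S) (P.map A.toAffineMap) (A '' O) := by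
  obtain ⟨hP, hO, hOS, htr⟩ := h
  refine ⟨hP.map A, hO.map A, Set.image_mono hOS, ?_⟩
  rintro _ ⟨p, hp, rfl⟩
  obtain ⟨v, ⟨α, hα0, hαS, hα⟩, hv⟩ := htr p hp
  refine ⟨linearPart A v, ⟨fun t => A (α t), by simp only [hα0], ?_, ?_⟩,
    fun hmem => hv (mem_direction_map.1 hmem)⟩
  · filter_upwards [hαS] with t ht using Set.mem_image_of_mem A ht
  · have := ((linearPart A : E3 →L[ℝ] E3).hasFDerivAt.comp_hasDerivAt 0 hα).add_const (A 0)
    refine this.congr_of_eventuallyEq (Filter.Eventually.of_forall fun t => ?_)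
    exact apply_eq_linearPart A (α t)

/-- The central plane oval property passes to affine images. -/
theorem HasCPO.isCentral_of_image {S : Set E3} (h : HasCPO S) (A : E3 ≃ᵃ[ℝ] E3)
    {P : AffineSubspace ℝ E3} {O : Set E3} (hPO : MeetsTransversallyAlong (A '' S) P O) :
    IsCentral O := by
  have h1 := hPO.map A.symm
  rw [← Set.image_comp] at h1
  have e1 : (A.symm ∘ A : E3 → E3) = id := funext fun x => A.symm_apply_apply x
  rw [e1, Set.image_id] at h1
  have h2 := (h.2 _ _ h1).map A
  rw [← Set.image_comp] at h2
  have e2 : (A ∘ A.symm : E3 → E3) = id := funext fun x => A.apply_symm_apply x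
  rwa [e2, Set.image_id] at h2

theorem IsCentralCylinder.map {C : Set E3} (h : IsCentralCylinder C) (A : E3 ≃ᵃ[ℝ] E3) :
    IsCentralCylinder (A '' C) := by
  obtain ⟨P, O, v, hP, hO, hc, hv, rfl⟩ := h
  refine ⟨P.map A.toAffineMap, A '' O, linearPart A v, hP.map A, hO.map A, hc.map A,
    fun hmem => hv (mem_direction_map.1 hmem), ?_⟩
  have key : ∀ (p : E3) (t : ℝ), A (p + t • v) = A p + t • linearPart A v := by
    intro p t
    rw [apply_eq_linearPart A (p + t • v), apply_eq_linearPart A p, map_add, map_smul]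
    abel
  ext x
  constructor
  · rintro ⟨_, ⟨p, hp, t, rfl⟩, rfl⟩
    exact ⟨A p, ⟨p, hp, rfl⟩, t, key p t⟩
  · rintro ⟨_, ⟨p, hp, rfl⟩, t, rfl⟩
    exact ⟨p + t • v, ⟨p, hp, t, rfl⟩, key p t⟩

/-! ### The centroid of a central oval -/

section Centroid
open MeasureTheory Measure

theorem IsOvalParam.hausdorffMeasure_range_lt_top {γ : ℝ → E2} (h : IsOvalParam γ) :
    μH[1] (Set.range γ) < ⊤ := by
  obtain ⟨K, hK⟩ := (h.contDiff.of_le (by norm_num : (1 : ℕ∞ω) ≤ 2)).locallyLipschitz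
    |>.locallyLipschitzOn (s := Set.Icc 0 (2 * Real.pi))
    |>.exists_lipschitzOnWith_of_compact isCompact_Icc
  rw [h.range_eq_image]
  refine (hK.hausdorffMeasure_image_le zero_le_one).trans_lt ?_
  rw [hausdorffMeasure_real, Real.volume_Icc]
  exact ENNReal.mul_lt_top (by simp) ENNReal.ofReal_lt_top

theorem IsOvalParam.hausdorffMeasure_range_ne_zero {γ : ℝ → E2} (h : IsOvalParam γ) :
    μH[1] (Set.range γ) ≠ 0 := by
  intro h0
  have hpi := Real.pi_pos
  have hne : γ Real.pi ≠ γ 0 := by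
    simpa using h.add_ne 0 Real.pi hpi (by linarith)
  have hcoord : ∃ i, γ Real.pi i ≠ γ 0 i := by
    by_contra! hall
    exact hne (PiLp.ext hall)
  obtain ⟨i, hi⟩ := hcoord
  have hlip : LipschitzWith 1 (fun x : E2 => x i) :=
    LipschitzWith.of_dist_le_mul fun x y => by
      simpa [EuclideanSpace.dist_eq, Real.dist_eq] using PiLp.dist_apply_le x y i
  have h1 := hlip.hausdorffMeasure_image_le zero_le_one (Set.range γ)
  rw [h0, mul_zero, hausdorffMeasure_real, nonpos_iff_eq_zero] at h1
  have hsub : Set.uIcc (γ 0 i) (γ Real.pi i) ⊆ (fun x : E2 => x i) '' Set.range γ := by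
    rw [← Set.range_comp]
    have hc : Continuous ((fun x : E2 => x i) ∘ γ) := hlip.continuous.comp h.contDiff.continuous
    exact (intermediate_value_uIcc hc.continuousOn).trans
      (Set.image_subset_range _ (Set.uIcc 0 Real.pi))
  have h2 := measure_mono_null hsub h1
  rw [Set.uIcc, Real.volume_Icc, ENNReal.ofReal_eq_zero] at h2
  have := max_sub_min_eq_abs (γ 0 i) (γ Real.pi i)
  rw [this] at h2
  exact hi (sub_eq_zero.1 (abs_nonpos_iff.1 h2))

/-- The center of a central oval is its centroid: reflection through the center preserves arc
length. -/
theorem IsOvalParam.center_eq_zero {γ : ℝ → E2} (h : IsOvalParam γ)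
    (h0 : ∫ p in Set.range γ, p ∂(hausdorffMeasure 1) = 0) {m : E2}
    (hm : ∀ s, ∃ t, γ t = 2 • m - γ s) : m = 0 := by
  have hfin := h.hausdorffMeasure_range_lt_top
  have hne := h.hausdorffMeasure_range_ne_zero
  let e : E2 ≃ᵢ E2 := IsometryEquiv.subLeft (2 • m)
  have he : ∀ x, e x = 2 • m - x := fun x => rfl
  have hpre : e ⁻¹' Set.range γ = Set.range γ := by
    ext x
    constructor
    · rintro ⟨s, hs⟩
      obtain ⟨t, ht⟩ := hm s
      refine ⟨t, ?_⟩
      rw [ht, hs, he, sub_sub_cancel]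
    · rintro ⟨s, rfl⟩
      obtain ⟨t, ht⟩ := hm s
      exact ⟨t, ht⟩
  have h1 := (e.measurePreserving_hausdorffMeasure 1).setIntegral_preimage_emb
    e.toHomeomorph.measurableEmbedding (fun x : E2 => x) (Set.range γ)
  rw [hpre, h0] at h1
  have hint : IntegrableOn (fun x : E2 => x) (Set.range γ) (hausdorffMeasure 1) := by
    obtain ⟨C, hC⟩ := h.isCompact_range.isBounded.exists_norm_le
    exact Measure.integrableOn_of_bounded hfin.ne aestronglyMeasurable_id
      ((ae_restrict_iff' h.isCompact_range.measurableSet).2 (Filter.Eventually.of_forall hC))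
  simp only [he] at h1
  have hconst : IntegrableOn (fun _ : E2 => 2 • m) (Set.range γ) (hausdorffMeasure 1) :=
    integrableOn_const hfin.ne
  rw [integral_sub hconst hint, h0, sub_zero, setIntegral_const] at h1
  have h2 : (hausdorffMeasure 1 : Measure E2).real (Set.range γ) ≠ 0 :=
    (ENNReal.toReal_ne_zero).2 ⟨hne, hfin.ne⟩
  rcases smul_eq_zero.1 h1 with h3 | h3
  · exact absurd h3 h2
  · rw [two_smul, ← two_smul ℝ] at h3
    exact (smul_eq_zero.1 h3).resolve_left two_ne_zero

end Centroid

/-! ### Functions of two variables and an implicit function theorem -/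

open Set Filter

theorem contDiffOn_deriv_snd {V : Type*} [NormedAddCommGroup V] [NormedSpace ℝ V] {m n : ℕ∞ω}
    (hmn : m + 1 ≤ n) {F : ℝ → ℝ → V} {I : Set ℝ} (hI : IsOpen I)
    (hF : ContDiffOn ℝ n (fun q : ℝ × ℝ => F q.1 q.2) (I ×ˢ univ)) :
    ContDiffOn ℝ m (fun q : ℝ × ℝ => deriv (F q.1) q.2) (I ×ˢ univ) := by
  have hS : IsOpen (I ×ˢ (univ : Set ℝ)) := hI.prod isOpen_univ
  have h1 := hF.fderiv_of_isOpen hS hmn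
  refine (h1.clm_apply (contDiffOn_const (c := ((0 : ℝ), (1 : ℝ))))).congr fun q hq => ?_
  have hn : n ≠ 0 := by
    rintro rfl
    exact absurd (le_trans le_add_self hmn) (by simp)
  have hd : HasFDerivAt (fun q : ℝ × ℝ => F q.1 q.2) _ q :=
    ((hF.contDiffAt (hS.mem_nhds hq)).differentiableAt hn).hasFDerivAt
  have h2 : HasDerivAt (fun t : ℝ => (q.1, t)) ((0 : ℝ), (1 : ℝ)) q.2 :=
    (hasDerivAt_const _ _).prodMk (hasDerivAt_id _)
  exact (hd.comp_hasDerivAt (f := fun t : ℝ => (q.1, t)) q.2 h2).deriv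

theorem contDiffOn_deriv_fst {V : Type*} [NormedAddCommGroup V] [NormedSpace ℝ V] {m n : ℕ∞ω}
    (hmn : m + 1 ≤ n) {F : ℝ → ℝ → V} {I : Set ℝ} (hI : IsOpen I)
    (hF : ContDiffOn ℝ n (fun q : ℝ × ℝ => F q.1 q.2) (I ×ˢ univ)) :
    ContDiffOn ℝ m (fun q : ℝ × ℝ => deriv (fun z => F z q.2) q.1) (I ×ˢ univ) := by
  have hS : IsOpen (I ×ˢ (univ : Set ℝ)) := hI.prod isOpen_univ
  have h1 := hF.fderiv_of_isOpen hS hmn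
  refine (h1.clm_apply (contDiffOn_const (c := ((1 : ℝ), (0 : ℝ))))).congr fun q hq => ?_
  have hn : n ≠ 0 := by
    rintro rfl
    exact absurd (le_trans le_add_self hmn) (by simp)
  have hd : HasFDerivAt (fun q : ℝ × ℝ => F q.1 q.2) _ q :=
    ((hF.contDiffAt (hS.mem_nhds hq)).differentiableAt hn).hasFDerivAt
  have h2 : HasDerivAt (fun t : ℝ => (t, q.2)) ((1 : ℝ), (0 : ℝ)) q.1 :=
    (hasDerivAt_id _).prodMk (hasDerivAt_const _ _)
  exact (hd.comp_hasDerivAt (f := fun t : ℝ => (t, q.2)) q.1 h2).deriv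

theorem hasDerivAt_fst {V : Type*} [NormedAddCommGroup V] [NormedSpace ℝ V] {n : ℕ∞ω}
    (hn : n ≠ 0) {F : ℝ → ℝ → V} {I : Set ℝ} (hI : IsOpen I)
    (hF : ContDiffOn ℝ n (fun q : ℝ × ℝ => F q.1 q.2) (I ×ˢ univ)) {z : ℝ} (hz : z ∈ I) (θ : ℝ) :
    HasDerivAt (fun z => F z θ) (deriv (fun z => F z θ) z) z := by
  have hq : (z, θ) ∈ I ×ˢ (univ : Set ℝ) := ⟨hz, mem_univ _⟩
  have hd := (hF.contDiffAt ((hI.prod isOpen_univ).mem_nhds hq)).differentiableAt hn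
  have : DifferentiableAt ℝ (fun z : ℝ => (z, θ)) z := by fun_prop
  exact (DifferentiableAt.comp (f := fun z : ℝ => (z, θ)) z hd this).hasDerivAt

theorem contDiff_snd_of_contDiffOn {V : Type*} [NormedAddCommGroup V] [NormedSpace ℝ V] {n : ℕ∞ω}
    {F : ℝ → ℝ → V} {I : Set ℝ}
    (hF : ContDiffOn ℝ n (fun q : ℝ × ℝ => F q.1 q.2) (I ×ˢ univ)) {z : ℝ} (hz : z ∈ I) :
    ContDiff ℝ n (F z) := by
  rw [← contDiffOn_univ]
  exact hF.comp (f := fun t : ℝ => (z, t)) (s := univ) (by fun_prop) fun t _ => ⟨hz, mem_univ _⟩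

/-- A `C²` function that is periodic in its second variable is bounded, and Lipschitz in its
first variable, over a compact interval. -/
theorem exists_bound_lipschitz {Λ : ℝ → ℝ → ℝ} {I : Set ℝ} (hI : IsOpen I)
    (hΛ : ContDiffOn ℝ 2 (fun q : ℝ × ℝ => Λ q.1 q.2) (I ×ˢ univ))
    (hper : ∀ z ∈ I, Function.Periodic (Λ z) (2 * Real.pi)) {a b : ℝ} (hab : Icc a b ⊆ I) :
    ∃ C, 0 ≤ C ∧ (∀ z ∈ Icc a b, ∀ θ, |Λ z θ| ≤ C) ∧
      ∀ z ∈ Icc a b, ∀ z' ∈ Icc a b, ∀ θ, |Λ z' θ - Λ z θ| ≤ C * |z' - z| := by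
  have hK : IsCompact (Icc a b ×ˢ Icc (0 : ℝ) (2 * Real.pi)) := isCompact_Icc.prod isCompact_Icc
  have hsub : Icc a b ×ˢ Icc (0 : ℝ) (2 * Real.pi) ⊆ I ×ˢ univ :=
    prod_mono hab (subset_univ _)
  obtain ⟨C₁, hC₁⟩ := hK.exists_bound_of_continuousOn (hΛ.continuousOn.mono hsub)
  obtain ⟨C₂, hC₂⟩ := hK.exists_bound_of_continuousOn
    (((contDiffOn_deriv_fst (m := 1) (by norm_num [one_add_one_eq_two]) hI hΛ).continuousOn).mono
      hsub)
  have hred : ∀ θ, ∃ θ' ∈ Icc (0 : ℝ) (2 * Real.pi), ∀ z ∈ I, Λ z θ = Λ z θ' := by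
    intro θ
    obtain ⟨n, hn, -⟩ := existsUnique_add_zsmul_mem_Ico (by positivity : 0 < 2 * Real.pi) θ 0
    rw [zero_add] at hn
    exact ⟨_, Ico_subset_Icc_self hn, fun z hz => ((hper z hz).zsmul n θ).symm⟩
  refine ⟨max 0 (max C₁ C₂), le_max_left _ _, fun z hz θ => ?_, fun z hz z' hz' θ => ?_⟩
  · obtain ⟨θ', hθ', he⟩ := hred θ
    rw [he z (hab hz)]
    exact (hC₁ (z, θ') ⟨hz, hθ'⟩).trans (le_max_of_le_right (le_max_left _ _))
  · obtain ⟨θ', hθ', he⟩ := hred θ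
    rw [he z (hab hz), he z' (hab hz')]
    refine (convex_Icc a b).norm_image_sub_le_of_norm_hasDerivWithin_le
      (f := fun z => Λ z θ') (f' := fun z => deriv (fun z => Λ z θ') z) (fun x hx =>
      (hasDerivAt_fst two_ne_zero hI hΛ (hab hx) θ').hasDerivWithinAt)
      (fun x hx => (hC₂ (x, θ') ⟨hx, hθ'⟩).trans (le_max_of_le_right (le_max_right _ _))) hz hz'

/-- Implicit function theorem, uniformly over a circle of parameters: the equation
`z = z₀ + ε Λ(z, θ) + ε² b` has for small `ε` a unique solution near `z₀`, which is of
class `C²` in `ε` and `θ`. The last clause says that the equation remains nondegenerate. -/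
theorem exists_implicit {Λ : ℝ → ℝ → ℝ} {I : Set ℝ} (hI : IsOpen I)
    (hΛ : ContDiffOn ℝ 2 (fun q : ℝ × ℝ => Λ q.1 q.2) (I ×ˢ univ))
    (hper : ∀ z ∈ I, Function.Periodic (Λ z) (2 * Real.pi)) {z₀ : ℝ} (hz₀ : z₀ ∈ I) (b : ℝ) :
    ∃ δ > 0, ∃ ρ > 0, ∃ ζ : ℝ → ℝ → ℝ, Ioo (z₀ - ρ) (z₀ + ρ) ⊆ I ∧
      ContDiffOn ℝ 2 (fun q : ℝ × ℝ => ζ q.1 q.2) (Ioo (-δ) δ ×ˢ univ) ∧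
      ∀ ε ∈ Ioo (-δ) δ, ∀ θ, ζ ε θ ∈ Ioo (z₀ - ρ) (z₀ + ρ) ∧
        ζ ε θ = z₀ + ε * Λ (ζ ε θ) θ + ε ^ 2 * b ∧
        (∀ z ∈ Ioo (z₀ - ρ) (z₀ + ρ), z = z₀ + ε * Λ z θ + ε ^ 2 * b → z = ζ ε θ) ∧
        ∀ z ∈ Ioo (z₀ - ρ) (z₀ + ρ), ε * deriv (fun z => Λ z θ) z ≠ 1 := by
  obtain ⟨ρ, hρ, hρI⟩ := Metric.nhds_basis_closedBall.mem_iff.1 (hI.mem_nhds hz₀)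
  rw [Real.closedBall_eq_Icc] at hρI
  obtain ⟨C, hC0, hC, hLip⟩ := exists_bound_lipschitz hI hΛ hper hρI
  -- for `|ε| < δ` the right hand side is a contraction of the interval of radius `ρ`
  set δ := min 1 (min (1 / (2 * (C + 1))) (ρ / (C + |b| + 1))) with hδ
  have hb := abs_nonneg b
  have hδ0 : 0 < δ := lt_min one_pos (lt_min (by positivity) (by positivity))
  have hsub : Ioo (z₀ - ρ) (z₀ + ρ) ⊆ Icc (z₀ - ρ) (z₀ + ρ) := Ioo_subset_Icc_self
  have hcontr : ∀ ε ∈ Ioo (-δ) δ, |ε| * C < 1 := by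
    intro ε hε
    have h1 : |ε| < δ := abs_lt.2 hε
    have h2 : |ε| < 1 / (2 * (C + 1)) :=
      h1.trans_le ((min_le_right _ _).trans (min_le_left _ _))
    rw [lt_div_iff₀ (by positivity)] at h2
    nlinarith [abs_nonneg ε]
  have hsmall : ∀ ε ∈ Ioo (-δ) δ, ∀ l, |l| ≤ C → |ε * l + ε ^ 2 * b| < ρ := by
    intro ε hε l hl
    have h1 : |ε| < δ := abs_lt.2 hε
    have h2 : |ε| < ρ / (C + |b| + 1) :=
      h1.trans_le ((min_le_right _ _).trans (min_le_right _ _))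
    have h3 : |ε| < 1 := h1.trans_le (min_le_left _ _)
    rw [lt_div_iff₀ (by positivity)] at h2
    calc |ε * l + ε ^ 2 * b| ≤ |ε * l| + |ε ^ 2 * b| := abs_add_le _ _
      _ = |ε| * |l| + |ε| * (|ε| * |b|) := by rw [abs_mul, abs_mul, abs_pow]; ring
      _ ≤ |ε| * C + |ε| * (1 * |b|) := by gcongr
      _ ≤ |ε| * (C + |b| + 1) := by nlinarith [abs_nonneg ε]
      _ < ρ := h2
  have hcont : ∀ θ, ContinuousOn (fun z => Λ z θ) (Icc (z₀ - ρ) (z₀ + ρ)) := fun θ =>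
    hΛ.continuousOn.comp (f := fun z : ℝ => (z, θ)) (by fun_prop)
      fun z hz => ⟨hρI hz, mem_univ _⟩
  have hex : ∀ ε θ, ∃ z, ε ∈ Ioo (-δ) δ →
      z ∈ Ioo (z₀ - ρ) (z₀ + ρ) ∧ z = z₀ + ε * Λ z θ + ε ^ 2 * b := by
    intro ε θ
    by_cases hε : ε ∈ Ioo (-δ) δ
    swap
    · exact ⟨0, fun h => absurd h hε⟩
    have hc : ContinuousOn (fun z => z - (ε * Λ z θ + ε ^ 2 * b)) (Icc (z₀ - ρ) (z₀ + ρ)) := by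
      have := hcont θ
      fun_prop
    have hl := abs_lt.1 (hsmall ε hε _ (hC (z₀ - ρ) (left_mem_Icc.2 (by linarith)) θ))
    have hr := abs_lt.1 (hsmall ε hε _ (hC (z₀ + ρ) (right_mem_Icc.2 (by linarith)) θ))
    obtain ⟨z, hz, hz'⟩ := intermediate_value_Ioo (by linarith) hc
      (show z₀ ∈ Ioo _ _ from ⟨by linarith [hl.1], by linarith [hr.2]⟩)
    exact ⟨z, fun _ => ⟨hz, by simp only at hz'; linarith⟩⟩
  choose ζ hζ using hex
  have huniq : ∀ ε ∈ Ioo (-δ) δ, ∀ θ, ∀ z ∈ Ioo (z₀ - ρ) (z₀ + ρ),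
      z = z₀ + ε * Λ z θ + ε ^ 2 * b → z = ζ ε θ := by
    intro ε hε θ z hz hz'
    obtain ⟨h1, h2⟩ := hζ ε θ hε
    by_contra hne
    have h3 : z - ζ ε θ = ε * (Λ z θ - Λ (ζ ε θ) θ) := by linear_combination hz' - h2
    have h4 := hLip _ (hsub h1) _ (hsub hz) θ
    have h5 : |z - ζ ε θ| ≤ |ε| * (C * |z - ζ ε θ|) := by
      conv_lhs => rw [h3, abs_mul]
      gcongr
    have h6 : 0 < |z - ζ ε θ| := abs_pos.2 (sub_ne_zero.2 hne)
    nlinarith [hcontr ε hε]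
  have hder : ∀ ε ∈ Ioo (-δ) δ, ∀ θ, ∀ z ∈ Ioo (z₀ - ρ) (z₀ + ρ),
      ε * deriv (fun z => Λ z θ) z ≠ 1 := by
    intro ε hε θ z hz h1
    have h2 := hasDerivAt_fst two_ne_zero hI hΛ (hρI (hsub hz)) θ
    have h3 : ‖deriv (fun z => Λ z θ) z‖ ≤ C := by
      refine h2.le_of_lip' hC0 ?_
      filter_upwards [isOpen_Ioo.mem_nhds hz] with x hx
      exact hLip z (hsub hz) x (hsub hx) θ
    rw [Real.norm_eq_abs] at h3
    have h4 : |ε| * |deriv (fun z => Λ z θ) z| = 1 := by rw [← abs_mul, h1, abs_one]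
    nlinarith [hcontr ε hε, abs_nonneg ε]
  refine ⟨δ, hδ0, ρ, hρ, ζ, hsub.trans hρI, ?_, fun ε hε θ =>
    ⟨(hζ ε θ hε).1, (hζ ε θ hε).2, huniq ε hε θ, hder ε hε θ⟩⟩
  rintro ⟨ε, θ⟩ ⟨hε, -⟩
  refine ContDiffAt.contDiffWithinAt ?_
  simp only at hε
  obtain ⟨h1, h2⟩ := hζ ε θ hε
  set G : (ℝ × ℝ) × ℝ → ℝ := fun q => q.2 - (q.1.1 * Λ q.2 q.1.2 + q.1.1 ^ 2 * b) with hG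
  have hIn : (ζ ε θ, θ) ∈ I ×ˢ (univ : Set ℝ) := ⟨hρI (hsub h1), mem_univ _⟩
  have hΛat : ContDiffAt ℝ 2 (fun q : (ℝ × ℝ) × ℝ => Λ q.2 q.1.2) ((ε, θ), ζ ε θ) :=
    ContDiffAt.comp (f := fun q : (ℝ × ℝ) × ℝ => (q.2, q.1.2)) ((ε, θ), ζ ε θ)
      (hΛ.contDiffAt ((hI.prod isOpen_univ).mem_nhds hIn)) (by fun_prop)
  have hGat : ContDiffAt ℝ 2 G ((ε, θ), ζ ε θ) := by
    have h3 : ContDiffAt ℝ 2 (fun q : (ℝ × ℝ) × ℝ => q.1.1) ((ε, θ), ζ ε θ) := by fun_prop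
    exact contDiffAt_snd.sub ((h3.mul hΛat).add ((h3.pow 2).mul contDiffAt_const))
  have hinv : (fderiv ℝ G ((ε, θ), ζ ε θ) ∘L .inr ℝ (ℝ × ℝ) ℝ).IsInvertible := by
    have h3 : HasDerivAt (fun z : ℝ => ((ε, θ), z)) ((0 : ℝ × ℝ), (1 : ℝ)) (ζ ε θ) :=
      (hasDerivAt_const _ _).prodMk (hasDerivAt_id _)
    have h4 := (hGat.differentiableAt two_ne_zero).hasFDerivAt.comp_hasDerivAt
      (f := fun z : ℝ => ((ε, θ), z)) (ζ ε θ) h3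
    have h5 : HasDerivAt (fun z => z - (ε * Λ z θ + ε ^ 2 * b))
        (1 - ε * deriv (fun z => Λ z θ) (ζ ε θ)) (ζ ε θ) :=
      (hasDerivAt_id _).sub (((hasDerivAt_fst two_ne_zero hI hΛ (hρI (hsub h1)) θ).const_mul
        ε).add_const _)
    have h6 := h4.unique h5
    have hne : 1 - ε * deriv (fun z => Λ z θ) (ζ ε θ) ≠ 0 :=
      fun h => hder ε hε θ _ h1 (sub_eq_zero.1 h).symm
    refine ⟨ContinuousLinearEquiv.unitsEquivAut ℝ (Units.mk0 _ hne), ?_⟩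
    ext
    simp [← h6]
  have himp := hGat.contDiffAt_implicitFunction two_ne_zero hinv
  set ψ := hGat.implicitFunction two_ne_zero hinv with hψ
  have hψ0 : ψ (ε, θ) = ζ ε θ := hGat.implicitFunction_apply_self two_ne_zero hinv
  refine himp.congr_of_eventuallyEq ?_
  have e1 : ∀ᶠ q : ℝ × ℝ in 𝓝 (ε, θ), ψ q ∈ Ioo (z₀ - ρ) (z₀ + ρ) :=
    himp.continuousAt.eventually_mem (by simpa [hψ0] using isOpen_Ioo.mem_nhds h1)
  have e2 : ∀ᶠ q : ℝ × ℝ in 𝓝 (ε, θ), q.1 ∈ Ioo (-δ) δ :=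
    continuousAt_fst.eventually_mem (isOpen_Ioo.mem_nhds hε)
  filter_upwards [e1, e2, hGat.eventually_apply_implicitFunction two_ne_zero hinv]
    with q hq1 hq2 hq3
  refine (huniq q.1 hq2 q.2 (ψ q) hq1 ?_).symm
  simp only [hG] at hq3
  linarith

/-! ### Sections of a tube by nearly horizontal planes -/

/-- `atHeight` as a linear map. -/
def liftL : E2 × ℝ →L[ℝ] E3 :=
  LinearMap.toContinuousLinearMap
    { toFun := fun q => atHeight q.1 q.2
      map_add' := fun x y => by ext i; fin_cases i <;> simp [atHeight]
      map_smul' := fun a x => by ext i; fin_cases i <;> simp [atHeight] }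

/-- The projection of space onto the horizontal plane. -/
def projL : E3 →L[ℝ] E2 :=
  LinearMap.toContinuousLinearMap
    { toFun := fun x => !₂[x 0, x 1]
      map_add' := fun x y => by ext i; fin_cases i <;> simp
      map_smul' := fun a x => by ext i; fin_cases i <;> simp }

theorem projL_atHeight (p : E2) (z : ℝ) : projL (atHeight p z) = p := by
  ext i; fin_cases i <;> simp [projL, atHeight]

theorem atHeight_two (p : E2) (z : ℝ) : atHeight p z 2 = z := by simp [atHeight]

theorem atHeight_injective {p q : E2} {z w : ℝ} (h : atHeight p z = atHeight q w) :
    p = q ∧ z = w := by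
  constructor
  · rw [← projL_atHeight p z, h, projL_atHeight]
  · rw [← atHeight_two p z, h, atHeight_two]

theorem linearIndependent_of_cross_ne_zero {x y : E2} (h : cross x y ≠ 0) {a b : ℝ}
    (hab : a • x + b • y = 0) : a = 0 ∧ b = 0 := by
  have h0 : a * x 0 + b * y 0 = 0 := by simpa using congrArg (fun v : E2 => v 0) hab
  have h1 : a * x 1 + b * y 1 = 0 := by simpa using congrArg (fun v : E2 => v 1) hab
  unfold cross at h
  constructor
  · apply (mul_eq_zero.1 (_ : a * (x 0 * y 1 - x 1 * y 0) = 0)).resolve_right h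
    linear_combination y 1 * h0 - y 0 * h1
  · apply (mul_eq_zero.1 (_ : b * (x 0 * y 1 - x 1 * y 0) = 0)).resolve_right h
    linear_combination x 0 * h1 - x 1 * h0

theorem finrank_ker_eq_two {N : E3 →ₗ[ℝ] ℝ} {v : E3} (hv : N v ≠ 0) :
    Module.finrank ℝ (LinearMap.ker N) = 2 := by
  have hsurj : LinearMap.range N = ⊤ := by
    refine LinearMap.range_eq_top.2 fun y => ⟨(y / N v) • v, ?_⟩
    rw [map_smul, smul_eq_mul, div_mul_cancel₀ _ hv]
  have := LinearMap.finrank_range_add_finrank_ker N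
  rw [hsurj, finrank_top, Module.finrank_self, finrank_euclideanSpace_fin] at this
  omega

/-- The surface swept out by the ovals `c z + γ z`. -/
def tubeSet (c : ℝ → E2) (γ : ℝ → ℝ → E2) : Set E3 :=
  {x | ∃ z ∈ Ioo (-1 : ℝ) 1, ∃ θ, x = atHeight (c z + γ z θ) z}

/-- The data `c`, `γ` of a transversely convex tube in standard position all of whose transverse
plane ovals are central. The condition on the centroid is not part of this structure. -/
structure CPOTube (c : ℝ → E2) (γ : ℝ → ℝ → E2) : Prop where
  contDiffOn_center : ContDiffOn ℝ 2 c (Ioo (-1) 1)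
  contDiffOn : ContDiffOn ℝ 2 (fun q : ℝ × ℝ => γ q.1 q.2) (Ioo (-1) 1 ×ˢ univ)
  oval : ∀ z ∈ Ioo (-1 : ℝ) 1, IsOvalParam (γ z)
  central : ∀ P O, MeetsTransversallyAlong (tubeSet c γ) P O → IsCentral O

namespace CPOTube
variable {c : ℝ → E2} {γ : ℝ → ℝ → E2}

theorem contDiffOn_point (ht : CPOTube c γ) :
    ContDiffOn ℝ 2 (fun q : ℝ × ℝ => c q.1 + γ q.1 q.2) (Ioo (-1) 1 ×ˢ univ) :=
  (ht.contDiffOn_center.comp contDiffOn_fst fun _ hq => hq.1).add ht.contDiffOn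

/-- Planes close to the plane at height `z₀` intersect the tube in central ovals. The planes are
`z = z₀ + ε λ(x, z) + ε² b` with the affine function `λ(x, z) = ℓ x + κ z + d`, and
`ζ ε θ` is the height of the point of the section that lies on the `θ`-curve of the tube. -/
theorem exists_central_section (ht : CPOTube c γ) {z₀ : ℝ} (hz₀ : z₀ ∈ Ioo (-1 : ℝ) 1)
    (ℓ : E2 →L[ℝ] ℝ) (κ d b : ℝ) :
    ∃ δ > 0, ∃ ρ > 0, ∃ ζ : ℝ → ℝ → ℝ, Ioo (z₀ - ρ) (z₀ + ρ) ⊆ Ioo (-1) 1 ∧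
      ContDiffOn ℝ 2 (fun q : ℝ × ℝ => ζ q.1 q.2) (Ioo (-δ) δ ×ˢ univ) ∧
      (∀ ε ∈ Ioo (-δ) δ, ∀ θ, ζ ε θ ∈ Ioo (z₀ - ρ) (z₀ + ρ) ∧
        ζ ε θ = z₀ + ε * (ℓ (c (ζ ε θ) + γ (ζ ε θ) θ) + κ * ζ ε θ + d) + ε ^ 2 * b ∧
        (∀ z ∈ Ioo (z₀ - ρ) (z₀ + ρ),
          z = z₀ + ε * (ℓ (c z + γ z θ) + κ * z + d) + ε ^ 2 * b → z = ζ ε θ)) ∧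
      ∀ ε ∈ Ioo (-δ) δ, ∃ (m : E2) (h : ℝ), ∀ θ, ∃ θ',
        c (ζ ε θ') + γ (ζ ε θ') θ' = (2 : ℝ) • m - (c (ζ ε θ) + γ (ζ ε θ) θ) ∧
        ζ ε θ' = 2 * h - ζ ε θ := by
  set I : Set ℝ := Ioo (-1) 1 with hI
  have hIo : IsOpen I := isOpen_Ioo
  have hX := ht.contDiffOn_point
  set Λ : ℝ → ℝ → ℝ := fun z θ => ℓ (c z + γ z θ) + κ * z + d with hΛ
  have hΛc : ContDiffOn ℝ 2 (fun q : ℝ × ℝ => Λ q.1 q.2) (I ×ˢ univ) := by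
    have := ℓ.contDiff.comp_contDiffOn hX
    exact (this.add (by fun_prop : ContDiffOn ℝ 2 (fun q : ℝ × ℝ => κ * q.1) _)).add
      contDiffOn_const
  have hΛper : ∀ z ∈ I, Function.Periodic (Λ z) (2 * Real.pi) := fun z hz θ => by
    simp only [hΛ, (ht.oval z hz).periodic θ]
  obtain ⟨δ₀, hδ₀, ρ, hρ, ζ, hsub, hζc, hζ⟩ := exists_implicit hIo hΛc hΛper hz₀ b
  set J : Set ℝ := Ioo (-δ₀) δ₀ with hJ
  have hJo : IsOpen J := isOpen_Ioo
  have h0J : (0 : ℝ) ∈ J := ⟨by linarith, hδ₀⟩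
  have hmaps : MapsTo (fun q : ℝ × ℝ => (ζ q.1 q.2, q.2)) (J ×ˢ univ) (I ×ˢ univ) :=
    fun q hq => ⟨hsub (hζ q.1 hq.1 q.2).1, mem_univ _⟩
  set Y : ℝ → ℝ → E2 := fun ε θ => c (ζ ε θ) + γ (ζ ε θ) θ with hY
  have hYc : ContDiffOn ℝ 2 (fun q : ℝ × ℝ => Y q.1 q.2) (J ×ˢ univ) :=
    hX.comp (hζc.prodMk contDiffOn_snd) hmaps
  have hζper : ∀ ε ∈ J, Function.Periodic (ζ ε) (2 * Real.pi) := by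
    intro ε hε θ
    obtain ⟨h1, h2, -⟩ := hζ ε hε (θ + 2 * Real.pi)
    refine (hζ ε hε θ).2.2.1 _ h1 ?_
    rw [hΛper _ (hsub h1)] at h2
    exact h2
  have hYper : ∀ ε ∈ J, Function.Periodic (Y ε) (2 * Real.pi) := by
    intro ε hε θ
    simp only [hY, hζper ε hε θ]
    rw [(ht.oval _ (hsub (hζ ε hε θ).1)).periodic θ]
  have hζ0 : ∀ θ, ζ 0 θ = z₀ := fun θ => by simpa using (hζ 0 h0J θ).2.1
  -- the curvature of the projected sections depends continuously on the plane
  have hD1 : ContDiffOn ℝ 1 (fun q : ℝ × ℝ => deriv (Y q.1) q.2) (J ×ˢ univ) :=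
    contDiffOn_deriv_snd (by norm_num [one_add_one_eq_two]) hJo hYc
  have hD2 : ContDiffOn ℝ 0 (fun q : ℝ × ℝ => deriv (deriv (Y q.1)) q.2) (J ×ˢ univ) :=
    contDiffOn_deriv_snd (F := fun ε θ => deriv (Y ε) θ) (by norm_num) hJo hD1
  have hcross : ContinuousOn (fun q : ℝ × ℝ => cross (deriv (Y q.1) q.2)
      (deriv (deriv (Y q.1)) q.2)) (J ×ˢ univ) := by
    have h1 := hD1.continuousOn
    have h2 := hD2.continuousOn
    unfold cross
    fun_prop
  have hY0 : Y 0 = fun θ => c z₀ + γ z₀ θ := funext fun θ => by simp only [hY, hζ0]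
  have hev : ∀ᶠ ε in 𝓝 (0 : ℝ), ∀ θ ∈ Icc (0 : ℝ) (2 * Real.pi),
      cross (deriv (Y ε) θ) (deriv (deriv (Y ε)) θ) ≠ 0 := by
    refine isCompact_Icc.eventually_forall_of_forall_eventually fun θ _ => ?_
    refine (hcross.continuousAt
      ((hJo.prod isOpen_univ).mem_nhds ⟨h0J, mem_univ θ⟩)).eventually_ne ?_
    have hov := ht.oval z₀ hz₀
    have e1 : deriv (Y 0) = deriv (γ z₀) := by
      rw [hY0]
      exact funext fun θ => deriv_const_add _
    simp only [e1]
    exact cross_ne_zero_of_linearIndependent (hov.curved θ)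
  obtain ⟨δ₁, hδ₁, hev⟩ := Metric.eventually_nhds_iff.1 hev
  set δ := min δ₀ δ₁ with hδ
  have hδJ : Ioo (-δ) δ ⊆ J := Ioo_subset_Ioo (neg_le_neg (min_le_left _ _)) (min_le_left _ _)
  refine ⟨δ, lt_min hδ₀ hδ₁, ρ, hρ, ζ, hsub, hζc.mono (prod_mono hδJ subset_rfl),
    fun ε hε θ => ⟨(hζ ε (hδJ hε) θ).1, (hζ ε (hδJ hε) θ).2.1, (hζ ε (hδJ hε) θ).2.2.1⟩,
    fun ε hε => ?_⟩
  have hεJ := hδJ hε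
  have hcr : ∀ θ, cross (deriv (Y ε) θ) (deriv (deriv (Y ε)) θ) ≠ 0 := by
    intro θ
    have hp : 0 < 2 * Real.pi := by positivity
    have hper1 : Function.Periodic (deriv (Y ε)) (2 * Real.pi) := fun t => by
      rw [← deriv_comp_add_const]
      congr 1
      exact funext (hYper ε hεJ)
    have hper2 : Function.Periodic (deriv (deriv (Y ε))) (2 * Real.pi) := fun t => by
      rw [← deriv_comp_add_const]
      congr 1
      exact funext hper1
    obtain ⟨n, hn, -⟩ := existsUnique_add_zsmul_mem_Ico hp θ 0
    rw [zero_add] at hn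
    have := hev (y := ε) (by
      rw [Real.dist_eq, sub_zero]
      exact (abs_lt.2 hε).trans_le (min_le_right _ _)) _ (Ico_subset_Icc_self hn)
    rwa [hper1.zsmul n θ, hper2.zsmul n θ] at this
  have hYε : ContDiff ℝ 2 (Y ε) := contDiff_snd_of_contDiffOn hYc hεJ
  have hζε : ContDiff ℝ 2 (ζ ε) := contDiff_snd_of_contDiffOn hζc hεJ
  set Γ : ℝ → E3 := fun θ => atHeight (Y ε θ) (ζ ε θ) with hΓ
  have hΓ2 : ContDiff ℝ 2 Γ := liftL.contDiff.comp (hYε.prodMk hζε)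
  have hproj1 : ∀ θ, projL (deriv Γ θ) = deriv (Y ε) θ := by
    intro θ
    have h1 : HasDerivAt Γ (deriv Γ θ) θ := (hΓ2.differentiable two_ne_zero θ).hasDerivAt
    have h2 := projL.hasFDerivAt.comp_hasDerivAt θ h1
    have h3 : (projL ∘ Γ) = Y ε := funext fun θ => projL_atHeight _ _
    rw [h3] at h2
    exact h2.deriv.symm
  have hproj2 : ∀ θ, projL (deriv (deriv Γ) θ) = deriv (deriv (Y ε)) θ := by
    intro θ
    have h1 : HasDerivAt (deriv Γ) (deriv (deriv Γ) θ) θ :=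
      (hΓ2.deriv_one.differentiable one_ne_zero θ).hasDerivAt
    have h2 := projL.hasFDerivAt.comp_hasDerivAt θ h1
    have h3 : (projL ∘ deriv Γ) = deriv (Y ε) := funext hproj1
    rw [h3] at h2
    exact h2.deriv.symm
  have hoval : IsOvalParam Γ := by
    refine ⟨hΓ2, fun θ => ?_, fun s hs t ht' hst => ?_, fun θ => ?_⟩
    · simp only [hΓ, hYper ε hεJ θ, hζper ε hεJ θ]
    · obtain ⟨h1, h2⟩ := atHeight_injective hst
      simp only [hY] at h1
      rw [h2] at h1
      exact (ht.oval _ (hsub (hζ ε hεJ t).1)).injOn hs ht' (add_left_cancel h1)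
    · rw [LinearIndependent.pair_iff]
      intro a b' hab
      refine linearIndependent_of_cross_ne_zero (hcr θ) ?_
      have := congrArg projL hab
      rwa [map_add, map_smul, map_smul, map_zero, hproj1, hproj2] at this
  -- the plane
  let N : E3 →ₗ[ℝ] ℝ :=
    (EuclideanSpace.proj (2 : Fin 3) : E3 →L[ℝ] ℝ).toLinearMap -
      ε • (ℓ.toLinearMap ∘ₗ projL.toLinearMap +
        κ • (EuclideanSpace.proj (2 : Fin 3) : E3 →L[ℝ] ℝ).toLinearMap)
  have hN : ∀ p z, N (atHeight p z) = z - ε * (ℓ p + κ * z) := by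
    intro p z
    simp [N, projL_atHeight, atHeight_two]
    ring
  set P : AffineSubspace ℝ E3 := AffineSubspace.mk' (Γ 0) (LinearMap.ker N) with hP
  -- the velocity of the curve `θ = const` of the tube is transversal to the plane
  have htang : ∀ θ, ∃ v, IsTangentVector (tubeSet c γ) (Γ θ) v ∧ N v ≠ 0 := by
    intro θ
    have hz := (hζ ε hεJ θ).1
    set X' := deriv (fun z => c z + γ z θ) (ζ ε θ) with hX'
    have h1 : HasDerivAt (fun z => c z + γ z θ) X' (ζ ε θ) :=
      hasDerivAt_fst (F := fun z θ => c z + γ z θ) two_ne_zero hIo hX (hsub hz) θ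
    have h2 : HasDerivAt (fun z => atHeight (c z + γ z θ) z) (atHeight X' 1) (ζ ε θ) :=
      liftL.hasFDerivAt.comp_hasDerivAt (ζ ε θ) (h1.prodMk (hasDerivAt_id _))
    refine ⟨atHeight X' 1, ⟨fun t => atHeight (c (ζ ε θ + t) + γ (ζ ε θ + t) θ) (ζ ε θ + t),
      by simp only [add_zero]; rfl, ?_, ?_⟩, ?_⟩
    · have : ∀ᶠ t in 𝓝 (0 : ℝ), ζ ε θ + t ∈ I := by
        have hc : ContinuousAt (fun t : ℝ => ζ ε θ + t) 0 := by fun_prop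
        exact hc.eventually_mem (hIo.mem_nhds (by simpa using hsub hz))
      filter_upwards [this] with t ht' using ⟨_, ht', θ, rfl⟩
    · have h3 : HasDerivAt (fun t : ℝ => ζ ε θ + t) 1 0 := (hasDerivAt_id _).const_add _
      have h4 : HasDerivAt (fun z => atHeight (c z + γ z θ) z) (atHeight X' 1) (ζ ε θ + 0) := by
        rwa [add_zero]
      have := HasDerivAt.scomp (0 : ℝ) h4 h3
      rwa [one_smul] at this
    · rw [hN]
      have h5 : HasDerivAt (fun z => Λ z θ) (ℓ X' + κ) (ζ ε θ) := by
        have := ((ℓ.hasFDerivAt.comp_hasDerivAt (ζ ε θ) h1).add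
          ((hasDerivAt_id (ζ ε θ)).const_mul κ)).add_const d
        rw [mul_one] at this
        exact this
      have h6 := (hζ ε hεJ θ).2.2.2 _ hz
      rw [h5.deriv] at h6
      intro h7
      apply h6
      linarith
  have hPdir : P.direction = LinearMap.ker N := AffineSubspace.direction_mk' _ _
  have hmeet : MeetsTransversallyAlong (tubeSet c γ) P (range Γ) := by
    refine ⟨?_, ⟨?_, Γ, hoval, rfl⟩, ?_, ?_⟩
    · unfold IsPlane
      obtain ⟨v, -, hv⟩ := htang 0
      rw [hPdir]
      exact finrank_ker_eq_two hv
    · rintro _ ⟨θ, rfl⟩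
      rw [hP, SetLike.mem_coe, AffineSubspace.mem_mk', LinearMap.mem_ker, vsub_eq_sub, map_sub]
      simp only [hΓ, hN]
      have h1 := (hζ ε hεJ θ).2.1
      have h2 := (hζ ε hεJ 0).2.1
      simp only [hΛ] at h1 h2
      simp only [hY]
      linear_combination h1 - h2
    · rintro _ ⟨θ, rfl⟩
      exact ⟨ζ ε θ, hsub (hζ ε hεJ θ).1, θ, rfl⟩
    · rintro _ ⟨θ, rfl⟩
      obtain ⟨v, hv, hNv⟩ := htang θ
      exact ⟨v, hv, by rwa [hPdir, LinearMap.mem_ker]⟩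
  obtain ⟨w, hw⟩ := ht.central _ _ hmeet
  refine ⟨projL w, w 2, fun θ => ?_⟩
  obtain ⟨θ', hθ'⟩ := hw (Γ θ) ⟨θ, rfl⟩
  have hrefl : Γ θ' = (2 : ℝ) • w - Γ θ := by
    rw [hθ', Equiv.pointReflection_apply, two_smul, vsub_eq_sub, vadd_eq_add]
    abel
  refine ⟨θ', ?_, ?_⟩
  · have := congrArg projL hrefl
    rwa [map_sub, map_smul, projL_atHeight, projL_atHeight] at this
  · have := congrArg (fun x : E3 => x 2) hrefl
    simpa [hΓ, atHeight_two] using this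

end CPOTube

/-! ### Support functions -/

/-- Danskin's theorem for a family of functions `F i = f + δ i • D + o(δ i)` on a compact set:
if `D` takes the same value at all maximizers of `f`, then the maximum of `F i` has the first order
expansion with this value. -/
theorem max_expansion {ι : Type*} {l : Filter ι} {K : Set ℝ} (hK : IsCompact K) {f D : ℝ → ℝ}
    (hf : ContinuousOn f K) (hDc : ContinuousOn D K) {F : ι → ℝ → ℝ} {M δ : ι → ℝ}
    (hδ : Tendsto δ l (𝓝 0))
    (hF : ∀ η > 0, ∀ᶠ i in l, ∀ θ ∈ K, |F i θ - f θ - δ i * D θ| ≤ η * |δ i|)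
    (hM : ∀ᶠ i in l, (∀ θ ∈ K, F i θ ≤ M i) ∧ ∃ θ ∈ K, F i θ = M i)
    {θ₀ : ℝ} (hθ₀ : θ₀ ∈ K) (hmax : ∀ θ ∈ K, f θ ≤ f θ₀)
    (hD : ∀ θ ∈ K, f θ = f θ₀ → D θ = D θ₀) {η : ℝ} (hη : 0 < η) :
    ∀ᶠ i in l, |M i - f θ₀ - δ i * D θ₀| ≤ η * |δ i| := by
  set K' := {θ ∈ K | η / 2 ≤ |D θ - D θ₀|} with hK'
  have hK'c : IsCompact K' := by
    have hc : ContinuousOn (fun θ => |D θ - D θ₀|) K := (hDc.sub continuousOn_const).abs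
    exact hK.of_isClosed_subset (hc.preimage_isClosed_of_isClosed hK.isClosed isClosed_Ici)
      (sep_subset _ _)
  obtain ⟨B, hB⟩ := hK.exists_bound_of_continuousOn hDc
  -- away from the maximizers there is a gap
  obtain ⟨g, hg, hgap⟩ : ∃ g > 0, ∀ θ ∈ K', f θ + g ≤ f θ₀ := by
    rcases K'.eq_empty_or_nonempty with he | hne
    · exact ⟨1, one_pos, by simp [he]⟩
    · obtain ⟨θ₁, hθ₁, hθ₁max⟩ := hK'c.exists_isMaxOn hne (hf.mono (sep_subset _ _))
      have hlt : f θ₁ < f θ₀ := by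
        refine lt_of_le_of_ne (hmax θ₁ hθ₁.1) fun heq => ?_
        have := hθ₁.2
        rw [hD θ₁ hθ₁.1 heq, sub_self, abs_zero] at this
        linarith
      refine ⟨f θ₀ - f θ₁, sub_pos.2 hlt, fun θ hθ => ?_⟩
      have : f θ ≤ f θ₁ := hθ₁max hθ
      linarith
  have hB0 : 0 ≤ B := (norm_nonneg _).trans (hB θ₀ hθ₀)
  have hsmall : ∀ᶠ i in l, |δ i| < g / (2 * B + 1) := by
    have := hδ.abs
    rw [abs_zero] at this
    exact this.eventually_lt_const (by positivity)
  filter_upwards [hF (η / 2) (half_pos hη), hM, hsmall] with i hFi hMi hi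
  obtain ⟨hMle, θ, hθ, hθM⟩ := hMi
  rw [abs_le]
  constructor
  · have h1 := (abs_le.1 (hFi θ₀ hθ₀)).1
    have h2 := hMle θ₀ hθ₀
    nlinarith [abs_nonneg (δ i)]
  · have h1 := (abs_le.1 (hFi θ hθ)).2
    rw [hθM] at h1
    have h3 : δ i * (D θ - D θ₀) ≤ |δ i| * |D θ - D θ₀| := by
      rw [← abs_mul]; exact le_abs_self _
    by_cases hcase : θ ∈ K'
    · have h4 := hgap θ hcase
      rw [lt_div_iff₀ (by positivity)] at hi
      have h5 : |D θ - D θ₀| ≤ 2 * B := by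
        have := hB θ hθ
        have := hB θ₀ hθ₀
        rw [Real.norm_eq_abs] at *
        linarith [abs_sub (D θ) (D θ₀)]
      nlinarith [abs_nonneg (δ i), mul_le_mul_of_nonneg_left h5 (abs_nonneg (δ i))]
    · have h4 : |D θ - D θ₀| < η / 2 := by
        by_contra! hge
        exact hcase ⟨hθ, hge⟩
      have h5 := hmax θ hθ
      nlinarith [abs_nonneg (δ i), mul_le_mul_of_nonneg_left h4.le (abs_nonneg (δ i))]

/-- First order Taylor expansion in the first variable, uniform over a compact set of values
of the second variable. -/
theorem eventually_uniform_expansion {F : ℝ → ℝ → ℝ} {I : Set ℝ} (hI : IsOpen I)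
    (hF : ContDiffOn ℝ 1 (fun q : ℝ × ℝ => F q.1 q.2) (I ×ˢ univ)) {s₀ : ℝ} (hs₀ : s₀ ∈ I)
    {K : Set ℝ} (hK : IsCompact K) {η : ℝ} (hη : 0 < η) :
    ∀ᶠ s in 𝓝 s₀, ∀ θ ∈ K,
      |F s θ - F s₀ θ - (s - s₀) * deriv (fun s => F s θ) s₀| ≤ η * |s - s₀| := by
  have hc : ContinuousOn (fun q : ℝ × ℝ => deriv (fun z => F z q.2) q.1) (I ×ˢ univ) :=
    (contDiffOn_deriv_fst (m := 0) (by norm_num) hI hF).continuousOn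
  have hev : ∀ᶠ s in 𝓝 s₀, ∀ θ ∈ K,
      |deriv (fun z => F z θ) s - deriv (fun z => F z θ) s₀| < η := by
    refine hK.eventually_forall_of_forall_eventually fun θ _ => ?_
    have h1 : ContinuousAt (fun q : ℝ × ℝ => deriv (fun z => F z q.2) q.1) (s₀, θ) :=
      hc.continuousAt ((hI.prod isOpen_univ).mem_nhds ⟨hs₀, mem_univ θ⟩)
    have h2 : ContinuousAt (fun q : ℝ × ℝ => deriv (fun z => F z q.2) s₀) (s₀, θ) :=
      ContinuousAt.comp (g := fun q : ℝ × ℝ => deriv (fun z => F z q.2) q.1)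
        (f := fun q : ℝ × ℝ => (s₀, q.2)) (x := (s₀, θ)) h1 (by fun_prop)
    have h3 := (h1.sub h2).abs
    refine h3.eventually_lt_const ?_
    simpa using hη
  obtain ⟨r, hr, hball⟩ := Metric.eventually_nhds_iff_ball.1 (hev.and (hI.mem_nhds hs₀))
  filter_upwards [Metric.ball_mem_nhds s₀ hr] with s hs θ hθ
  have hd : ∀ x ∈ Metric.ball s₀ r, HasDerivWithinAt
      (fun x => F x θ - x * deriv (fun s => F s θ) s₀)
      (deriv (fun s => F s θ) x - deriv (fun s => F s θ) s₀) (Metric.ball s₀ r) x := by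
    intro x hx
    have h1 := hasDerivAt_fst one_ne_zero hI hF (hball x hx).2 θ
    have h2 := (hasDerivAt_id x).mul_const (deriv (fun s => F s θ) s₀)
    rw [one_mul] at h2
    exact (h1.sub h2).hasDerivWithinAt
  have := (convex_ball s₀ r).norm_image_sub_le_of_norm_hasDerivWithin_le hd
    (fun x hx => ((hball x hx).1 θ hθ).le) (Metric.mem_ball_self hr) hs
  rw [Real.norm_eq_abs, Real.norm_eq_abs] at this
  convert this using 2
  ring

theorem hasDerivAt_of_forall_eventually {M : ℝ → ℝ} {s₀ d : ℝ}
    (h : ∀ η > 0, ∀ᶠ s in 𝓝 s₀, |M s - M s₀ - (s - s₀) * d| ≤ η * |s - s₀|) :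
    HasDerivAt M d s₀ := by
  rw [hasDerivAt_iff_isLittleO, Asymptotics.isLittleO_iff]
  exact fun η hη => h η hη

/-- Danskin's theorem: the derivative of a maximum is the derivative at the maximizer. -/
theorem hasDerivAt_max {F : ℝ → ℝ → ℝ} {I : Set ℝ} (hI : IsOpen I)
    (hF : ContDiffOn ℝ 1 (fun q : ℝ × ℝ => F q.1 q.2) (I ×ˢ univ)) {s₀ : ℝ} (hs₀ : s₀ ∈ I)
    {K : Set ℝ} (hK : IsCompact K) {M : ℝ → ℝ}
    (hM : ∀ s ∈ I, (∀ θ ∈ K, F s θ ≤ M s) ∧ ∃ θ ∈ K, F s θ = M s)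
    {θ₀ : ℝ} (hθ₀ : θ₀ ∈ K) (hmax : ∀ θ ∈ K, F s₀ θ ≤ F s₀ θ₀)
    (hD : ∀ θ ∈ K, F s₀ θ = F s₀ θ₀ →
      deriv (fun s => F s θ) s₀ = deriv (fun s => F s θ₀) s₀) :
    HasDerivAt M (deriv (fun s => F s θ₀) s₀) s₀ := by
  have hMs : M s₀ = F s₀ θ₀ := by
    obtain ⟨h1, θ, hθ, h2⟩ := hM s₀ hs₀
    exact le_antisymm (h2 ▸ hmax θ hθ) (h1 θ₀ hθ₀)
  refine hasDerivAt_of_forall_eventually fun η hη => ?_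
  rw [hMs]
  refine max_expansion hK (l := 𝓝 s₀) (f := F s₀) (D := fun θ => deriv (fun s => F s θ) s₀)
    (δ := fun s => s - s₀) ?_ ?_ ?_ (fun η hη => eventually_uniform_expansion hI hF hs₀ hK hη)
    ?_ hθ₀ hmax hD hη
  · exact (contDiff_snd_of_contDiffOn hF hs₀).continuous.continuousOn
  · exact (contDiffOn_deriv_fst (m := 0) (by norm_num) hI hF).continuousOn.comp
      (f := fun θ => (s₀, θ)) (by fun_prop) fun θ _ => ⟨hs₀, mem_univ _⟩
  · have : Tendsto (fun s : ℝ => s - s₀) (𝓝 s₀) (𝓝 (s₀ - s₀)) := by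
      apply Continuous.tendsto; fun_prop
    simpa using this
  · filter_upwards [hI.mem_nhds hs₀] with s hs using hM s hs

/-- The fundamental domain of the parameter circle. -/
abbrev circleDomain : Set ℝ := Icc 0 (2 * Real.pi)

theorem isCompact_circleDomain : IsCompact circleDomain := isCompact_Icc

/-- The support function of a closed curve: its greatest height in direction `φ`. -/
def supp (γ : ℝ → E2) (φ : ℝ) : ℝ := sSup ((fun θ => heightIn φ (γ θ)) '' circleDomain)

/-- `γ θ` is a highest point of the curve in direction `φ`. -/
def IsTop (γ : ℝ → E2) (φ θ : ℝ) : Prop := ∀ t, heightIn φ (γ t) ≤ heightIn φ (γ θ)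

theorem heightIn_add_pi (φ : ℝ) (x : E2) : heightIn (φ + Real.pi) x = -heightIn φ x := by
  simp [heightIn_apply]; ring

section Supp
variable {γ : ℝ → E2}

theorem exists_isTop (hc : Continuous γ) (hper : Function.Periodic γ (2 * Real.pi)) (φ : ℝ) :
    ∃ θ ∈ circleDomain, IsTop γ φ θ := by
  obtain ⟨θ, hθ, hmax⟩ := isCompact_circleDomain.exists_isMaxOn
    (nonempty_Icc.2 (by positivity)) ((heightIn φ).continuous.comp hc).continuousOn
  refine ⟨θ, hθ, fun t => ?_⟩
  obtain ⟨y, hy, hy'⟩ := hper.exists_mem_Ico₀ (by positivity) t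
  rw [hy']
  exact hmax (Ico_subset_Icc_self hy)

theorem IsTop.exists_mem {φ θ : ℝ} (h : IsTop γ φ θ)
    (hper : Function.Periodic γ (2 * Real.pi)) :
    ∃ θ' ∈ circleDomain, γ θ' = γ θ ∧ IsTop γ φ θ' := by
  obtain ⟨y, hy, hy'⟩ := hper.exists_mem_Ico₀ (by positivity) θ
  exact ⟨y, Ico_subset_Icc_self hy, hy'.symm, fun t => hy' ▸ h t⟩

theorem IsTop.supp_eq {φ θ : ℝ} (h : IsTop γ φ θ) (hper : Function.Periodic γ (2 * Real.pi)) :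
    supp γ φ = heightIn φ (γ θ) := by
  obtain ⟨θ', hθ', he, h'⟩ := h.exists_mem hper
  refine IsGreatest.csSup_eq ⟨⟨θ', hθ', by simp only [he]⟩, ?_⟩
  rintro _ ⟨t, -, rfl⟩
  exact h t

theorem heightIn_le_supp (hc : Continuous γ) (hper : Function.Periodic γ (2 * Real.pi))
    (φ t : ℝ) : heightIn φ (γ t) ≤ supp γ φ := by
  obtain ⟨θ, -, hθ⟩ := exists_isTop hc hper φ
  rw [hθ.supp_eq hper]
  exact hθ t

theorem supp_isMax (hc : Continuous γ) (hper : Function.Periodic γ (2 * Real.pi)) (φ : ℝ) :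
    (∀ θ ∈ circleDomain, heightIn φ (γ θ) ≤ supp γ φ) ∧
      ∃ θ ∈ circleDomain, heightIn φ (γ θ) = supp γ φ := by
  obtain ⟨θ, hθ, htop⟩ := exists_isTop hc hper φ
  exact ⟨fun t _ => heightIn_le_supp hc hper φ t, θ, hθ, (htop.supp_eq hper).symm⟩

/-- The support function of a curve that is symmetric about `m`. -/
theorem supp_sub_supp_of_symm (hc : Continuous γ) (hper : Function.Periodic γ (2 * Real.pi))
    {m : E2} (hm : ∀ θ, ∃ θ', γ θ' = (2 : ℝ) • m - γ θ) (φ : ℝ) :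
    supp γ φ - supp γ (φ + Real.pi) = 2 * heightIn φ m := by
  obtain ⟨θ, -, htop⟩ := exists_isTop hc hper φ
  obtain ⟨θ', hθ'⟩ := hm θ
  have htop' : IsTop γ (φ + Real.pi) θ' := by
    intro t
    obtain ⟨t', ht'⟩ := hm t
    have h1 := htop t'
    rw [ht', map_sub, map_smul, smul_eq_mul] at h1
    rw [heightIn_add_pi, heightIn_add_pi, hθ', map_sub, map_smul, smul_eq_mul]
    linarith
  rw [htop.supp_eq hper, htop'.supp_eq hper, heightIn_add_pi, hθ', map_sub, map_smul,
    smul_eq_mul]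
  ring

theorem IsOvalParam.eq_of_isTop (h : IsOvalParam γ) {φ θ θ' : ℝ} (hθ : IsTop γ φ θ)
    (heq : heightIn φ (γ θ') = heightIn φ (γ θ)) : γ θ' = γ θ := by
  by_contra hne
  exact (h.heightIn_lt_of_forall_le hθ θ' hne).ne heq

/-- The derivative of the support function is the component of the contact point along the
tangent. -/
theorem IsOvalParam.hasDerivAt_supp (h : IsOvalParam γ) {φ θ : ℝ} (hθ : IsTop γ φ θ) :
    HasDerivAt (supp γ) (heightIn (φ + Real.pi / 2) (γ θ)) φ := by
  obtain ⟨θ₀, hθ₀, he, htop⟩ := hθ.exists_mem h.periodic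
  rw [← he]
  have hd : ∀ x : E2, HasDerivAt (fun φ => heightIn φ x) (heightIn (φ + Real.pi / 2) x) φ := by
    intro x
    simp only [heightIn_apply, Real.cos_add_pi_div_two, Real.sin_add_pi_div_two]
    exact ((Real.hasDerivAt_cos φ).mul_const _).add ((Real.hasDerivAt_sin φ).mul_const _)
  have hF : ContDiffOn ℝ 1 (fun q : ℝ × ℝ => heightIn q.1 (γ q.2)) (univ ×ˢ univ) := by
    have h1 : ContDiff ℝ 1 γ := h.contDiff.of_le (by norm_num)
    have h2 : ∀ i, ContDiff ℝ 1 (fun q : ℝ × ℝ => γ q.2 i) := fun i =>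
      (contDiff_euclidean.1 h1 i).comp contDiff_snd
    have h3 := h2 0
    have h4 := h2 1
    simp only [heightIn_apply]
    exact ContDiff.contDiffOn (((Real.contDiff_cos.comp contDiff_fst).mul h3).add
      ((Real.contDiff_sin.comp contDiff_fst).mul h4))
  have := hasDerivAt_max (F := fun φ θ => heightIn φ (γ θ)) isOpen_univ hF (mem_univ φ)
    isCompact_circleDomain (M := supp γ)
    (fun s _ => supp_isMax h.contDiff.continuous h.periodic s) hθ₀ (fun t _ => htop t)
    (fun t _ ht => by rw [h.eq_of_isTop htop ht])
  rwa [(hd (γ θ₀)).deriv] at this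

end Supp

/-! ### Central sections, to first order -/

/-- A tube with central sections whose horizontal sections at height `z` have the center `c z`. -/
structure SymTube (c : ℝ → E2) (γ : ℝ → ℝ → E2) : Prop extends CPOTube c γ where
  symm : ∀ z ∈ Ioo (-1 : ℝ) 1, ∀ θ, ∃ θ', γ z θ' = -γ z θ

/-- The horizontal sections of a tube with central sections are centered at their centroids. -/
theorem CPOTube.symTube {c : ℝ → E2} {γ : ℝ → ℝ → E2} (ht : CPOTube c γ)
    (h0 : ∀ z ∈ Ioo (-1 : ℝ) 1,
      ∫ p in range (γ z), p ∂(MeasureTheory.Measure.hausdorffMeasure 1) = 0) :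
    SymTube c γ := by
  refine ⟨ht, fun z hz θ => ?_⟩
  obtain ⟨δ, hδ, ρ, hρ, ζ, -, -, hζ, hcen⟩ := ht.exists_central_section hz 0 0 0 0
  have h0δ : (0 : ℝ) ∈ Ioo (-δ) δ := ⟨by linarith, hδ⟩
  have hζ0 : ∀ θ, ζ 0 θ = z := fun θ => by simpa using (hζ 0 h0δ θ).2.1
  obtain ⟨m, h, hm⟩ := hcen 0 h0δ
  simp only [hζ0] at hm
  have hm' : ∀ s, ∃ t, γ z t = 2 • (m - c z) - γ z s := by
    intro s
    obtain ⟨t, ht, -⟩ := hm s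
    refine ⟨t, ?_⟩
    have : γ z t = (2 : ℝ) • m - (c z + γ z s) - c z := by rw [← ht]; abel
    rw [this, two_smul, two_smul]
    abel
  have hc := (ht.oval z hz).center_eq_zero (h0 z hz) hm'
  obtain ⟨t, ht⟩ := hm' θ
  exact ⟨t, by rw [ht, hc]; simp⟩

namespace SymTube
variable {c : ℝ → E2} {γ : ℝ → ℝ → E2}

/-- The variation `∂γ/∂z` depends only on the point of the curve, not on its parameter. -/
theorem periodic_deriv_fst (ht : SymTube c γ) {z : ℝ} (hz : z ∈ Ioo (-1 : ℝ) 1) {a b : ℝ}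
    (hab : γ z a = γ z b) : deriv (fun z => γ z a) z = deriv (fun z => γ z b) z := by
  obtain ⟨n, rfl⟩ := (ht.oval z hz).exists_int hab
  refine Filter.EventuallyEq.deriv_eq ?_
  filter_upwards [isOpen_Ioo.mem_nhds hz] with x hx
  have := (ht.oval x hx).periodic.zsmul n a
  rw [zsmul_eq_mul] at this
  exact this.symm

/-- The antipode of the highest point is the highest point in the opposite direction. -/
theorem isTop_antipode (ht : SymTube c γ) {z : ℝ} (hz : z ∈ Ioo (-1 : ℝ) 1) {φ θ θ' : ℝ}
    (hθ : IsTop (γ z) φ θ) (hθ' : γ z θ' = -γ z θ) : IsTop (γ z) (φ + Real.pi) θ' := by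
  intro t
  obtain ⟨t', ht'⟩ := ht.symm z hz t
  have := hθ t'
  rw [heightIn_add_pi, heightIn_add_pi, hθ', map_neg, neg_neg]
  rw [ht', map_neg] at this
  exact this

theorem supp_add_pi (ht : SymTube c γ) {z : ℝ} (hz : z ∈ Ioo (-1 : ℝ) 1) (φ : ℝ) :
    supp (γ z) (φ + Real.pi) = supp (γ z) φ := by
  have := supp_sub_supp_of_symm (ht.oval z hz).contDiff.continuous (ht.oval z hz).periodic
    (m := 0) (fun θ => by simpa using ht.symm z hz θ) φ
  rw [map_zero, mul_zero] at this
  linarith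

theorem supp_pos (ht : SymTube c γ) {z : ℝ} (hz : z ∈ Ioo (-1 : ℝ) 1) (φ : ℝ) :
    0 < supp (γ z) φ := by
  have hov := ht.oval z hz
  obtain ⟨θ, -, hθ⟩ := exists_isTop hov.contDiff.continuous hov.periodic φ
  obtain ⟨θ', hθ'⟩ := ht.symm z hz θ
  have h1 := hθ θ'
  rw [hθ', map_neg] at h1
  rw [hθ.supp_eq hov.periodic]
  refine lt_of_le_of_ne (by linarith) fun h0 => ?_
  -- otherwise the curve lies in a line, and all of its points are highest points
  have hall : ∀ t, γ z t = γ z θ := by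
    intro t
    refine hov.eq_of_isTop hθ (le_antisymm (hθ t) ?_)
    obtain ⟨t', ht'⟩ := ht.symm z hz t
    have := hθ t'
    rw [ht', map_neg] at this
    linarith
  have hpi := Real.pi_pos
  exact hov.add_ne 0 Real.pi hpi (by linarith) (by rw [hall, hall 0])

/-- The variation of the support function is the normal component of the variation of the contact
point. -/
theorem hasDerivAt_supp_height (ht : SymTube c γ) {z : ℝ} (hz : z ∈ Ioo (-1 : ℝ) 1) {φ θ : ℝ}
    (hθ : IsTop (γ z) φ θ) :
    HasDerivAt (fun z => supp (γ z) φ) (heightIn φ (deriv (fun z => γ z θ) z)) z := by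
  have hov := ht.oval z hz
  obtain ⟨θ₀, hθ₀, he, htop⟩ := hθ.exists_mem hov.periodic
  rw [← ht.periodic_deriv_fst hz he]
  have hd : ∀ t, HasDerivAt (fun z => heightIn φ (γ z t))
      (heightIn φ (deriv (fun z => γ z t) z)) z := fun t =>
    (heightIn φ).hasFDerivAt.comp_hasDerivAt z
      (hasDerivAt_fst two_ne_zero isOpen_Ioo ht.contDiffOn hz t)
  have hF : ContDiffOn ℝ 1 (fun q : ℝ × ℝ => heightIn φ (γ q.1 q.2)) (Ioo (-1) 1 ×ˢ univ) :=
    (heightIn φ).contDiff.comp_contDiffOn (ht.contDiffOn.of_le (by norm_num))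
  have := hasDerivAt_max (F := fun z θ => heightIn φ (γ z θ)) isOpen_Ioo hF hz
    isCompact_circleDomain (M := fun z => supp (γ z) φ)
    (fun s hs => supp_isMax (ht.oval s hs).contDiff.continuous (ht.oval s hs).periodic φ) hθ₀
    (fun t _ => htop t) (fun t _ heq => by
      rw [(hd t).deriv, (hd θ₀).deriv, ht.periodic_deriv_fst hz (hov.eq_of_isTop htop heq)])
  rwa [(hd θ₀).deriv] at this

theorem height_deriv_antipode (ht : SymTube c γ) {z : ℝ} (hz : z ∈ Ioo (-1 : ℝ) 1) {φ θ θ' : ℝ}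
    (hθ : IsTop (γ z) φ θ) (hθ' : γ z θ' = -γ z θ) :
    heightIn φ (deriv (fun z => γ z θ') z) = -heightIn φ (deriv (fun z => γ z θ) z) := by
  have h1 := ht.hasDerivAt_supp_height hz hθ
  have h2 := ht.hasDerivAt_supp_height hz (ht.isTop_antipode hz hθ hθ')
  have h3 : (fun z => supp (γ z) (φ + Real.pi)) =ᶠ[𝓝 z] fun z => supp (γ z) φ := by
    filter_upwards [isOpen_Ioo.mem_nhds hz] with x hx using ht.supp_add_pi hx φ
  have h4 := (h2.congr_of_eventuallyEq h3.symm).unique h1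
  rw [heightIn_add_pi] at h4
  linarith

/-- The sections by the planes `z = z₀ + ε ℓ(x - c z₀)`, with the first order change of the
height `ζ` and with their centers `(m ε, h ε)`. -/
theorem exists_section_through_center (ht : SymTube c γ) {z₀ : ℝ} (hz₀ : z₀ ∈ Ioo (-1 : ℝ) 1)
    (ℓ : E2 →L[ℝ] ℝ) :
    ∃ δ > 0, ∃ ζ : ℝ → ℝ → ℝ, ∃ m : ℝ → E2, ∃ h : ℝ → ℝ,
      ContDiffOn ℝ 2 (fun q : ℝ × ℝ => ζ q.1 q.2) (Ioo (-δ) δ ×ˢ univ) ∧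
      (∀ ε ∈ Ioo (-δ) δ, ∀ θ, ζ ε θ ∈ Ioo (-1 : ℝ) 1) ∧
      (∀ ε ∈ Ioo (-δ) δ, Function.Periodic (ζ ε) (2 * Real.pi)) ∧
      (∀ θ, ζ 0 θ = z₀) ∧ (∀ θ, HasDerivAt (fun ε => ζ ε θ) (ℓ (γ z₀ θ)) 0) ∧
      ∀ ε ∈ Ioo (-δ) δ, ∀ θ, ∃ θ',
        c (ζ ε θ') + γ (ζ ε θ') θ' = (2 : ℝ) • m ε - (c (ζ ε θ) + γ (ζ ε θ) θ) ∧
        ζ ε θ' = 2 * h ε - ζ ε θ := by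
  obtain ⟨δ, hδ, ρ, hρ, ζ, hsub, hζc, hζ, hcen⟩ :=
    ht.exists_central_section hz₀ ℓ 0 (-ℓ (c z₀)) 0
  choose! m h hm using hcen
  set J : Set ℝ := Ioo (-δ) δ with hJ
  have hJo : IsOpen J := isOpen_Ioo
  have h0J : (0 : ℝ) ∈ J := ⟨by linarith, hδ⟩
  have hζ0 : ∀ θ, ζ 0 θ = z₀ := fun θ => by simpa using (hζ 0 h0J θ).2.1
  refine ⟨δ, hδ, ζ, m, h, hζc, fun ε hε θ => hsub (hζ ε hε θ).1, fun ε hε θ => ?_, hζ0,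
    fun θ => ?_, hm⟩
  · obtain ⟨h1, h2, -⟩ := hζ ε hε (θ + 2 * Real.pi)
    refine (hζ ε hε θ).2.2 _ h1 ?_
    rwa [(ht.oval _ (hsub h1)).periodic θ] at h2
  · have hYc : ContDiffOn ℝ 2 (fun q : ℝ × ℝ => c (ζ q.1 q.2) + γ (ζ q.1 q.2) q.2)
        (J ×ˢ univ) :=
      ht.contDiffOn_point.comp (hζc.prodMk contDiffOn_snd)
        fun q hq => ⟨hsub (hζ q.1 hq.1 q.2).1, mem_univ _⟩
    have h2 := hasDerivAt_fst (F := fun ε θ => c (ζ ε θ) + γ (ζ ε θ) θ) two_ne_zero hJo hYc h0J θ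
    have h3 := ((hasDerivAt_id (0 : ℝ)).mul
        ((ℓ.hasFDerivAt.comp_hasDerivAt (0 : ℝ) h2).sub_const (ℓ (c z₀)))).const_add z₀
    have h4 : (fun ε => ζ ε θ) =ᶠ[𝓝 0]
        fun ε => z₀ + ε * (ℓ (c (ζ ε θ) + γ (ζ ε θ) θ) - ℓ (c z₀)) := by
      filter_upwards [hJo.mem_nhds h0J] with ε hε
      have := (hζ ε hε θ).2.1
      linear_combination this
    refine (h3.congr_of_eventuallyEq h4).congr_deriv ?_
    simp [hζ0]

/-- The centrality of the sections by planes `z = z₀ + ε ℓ(x - c z₀)`, to first order in `ε`: the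
derivative of the center, projected to the horizontal plane, is `(a, b)`. -/
theorem first_order (ht : SymTube c γ) {z₀ : ℝ} (hz₀ : z₀ ∈ Ioo (-1 : ℝ) 1) (ℓ : E2 →L[ℝ] ℝ) :
    ∃ a b : ℝ, ∀ φ θ, IsTop (γ z₀) φ θ →
      ℓ (γ z₀ θ) * heightIn φ (deriv (fun z => γ z θ) z₀) =
        Real.cos φ * a + Real.sin φ * b := by
  have hov := ht.oval z₀ hz₀
  obtain ⟨δ, hδ, ζ, m, h, hζc, hζI, hζper, hζ0, hζd, hm⟩ :=
    ht.exists_section_through_center hz₀ ℓ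
  set J : Set ℝ := Ioo (-δ) δ with hJ
  have hJo : IsOpen J := isOpen_Ioo
  have h0J : (0 : ℝ) ∈ J := ⟨by linarith, hδ⟩
  set Y : ℝ → ℝ → E2 := fun ε θ => c (ζ ε θ) + γ (ζ ε θ) θ with hY
  have hYc : ContDiffOn ℝ 2 (fun q : ℝ × ℝ => Y q.1 q.2) (J ×ˢ univ) :=
    ht.contDiffOn_point.comp (hζc.prodMk contDiffOn_snd)
      fun q hq => ⟨hζI q.1 hq.1 q.2, mem_univ _⟩
  have hYper : ∀ ε ∈ J, Function.Periodic (Y ε) (2 * Real.pi) := by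
    intro ε hε θ
    simp only [hY, hζper ε hε θ]
    rw [(ht.oval _ (hζI ε hε θ)).periodic θ]
  have hYcont : ∀ ε ∈ J, Continuous (Y ε) := fun ε hε =>
    (contDiff_snd_of_contDiffOn hYc hε).continuous
  set c' := deriv c z₀ with hc'
  have hcd : HasDerivAt c c' z₀ :=
    ((ht.contDiffOn_center.contDiffAt (isOpen_Ioo.mem_nhds hz₀)).differentiableAt
      two_ne_zero).hasDerivAt
  have hYd : ∀ θ, HasDerivAt (fun ε => Y ε θ)
      (ℓ (γ z₀ θ) • (c' + deriv (fun z => γ z θ) z₀)) 0 := by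
    intro θ
    have h1 : HasDerivAt (fun z => c z + γ z θ) (c' + deriv (fun z => γ z θ) z₀) (ζ 0 θ) := by
      rw [hζ0]
      exact hcd.add (hasDerivAt_fst two_ne_zero isOpen_Ioo ht.contDiffOn hz₀ θ)
    exact HasDerivAt.scomp (0 : ℝ) h1 (hζd θ)
  have hY0 : ∀ θ, Y 0 θ = c z₀ + γ z₀ θ := fun θ => by simp only [hY, hζ0]
  -- the derivatives of the support functions of the sections
  have hsupp : ∀ φ θ, IsTop (γ z₀) φ θ → HasDerivAt (fun ε => supp (Y ε) φ)
      (ℓ (γ z₀ θ) * (heightIn φ c' + heightIn φ (deriv (fun z => γ z θ) z₀))) 0 := by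
    intro φ θ hθ
    obtain ⟨θ₀, hθ₀, he, htop⟩ := hθ.exists_mem hov.periodic
    rw [← he, ← ht.periodic_deriv_fst hz₀ he]
    have hd : ∀ t, HasDerivAt (fun ε => heightIn φ (Y ε t))
        (ℓ (γ z₀ t) * (heightIn φ c' + heightIn φ (deriv (fun z => γ z t) z₀))) 0 := by
      intro t
      have := (heightIn φ).hasFDerivAt.comp_hasDerivAt (0 : ℝ) (hYd t)
      rwa [map_smul, map_add, smul_eq_mul] at this
    have hF : ContDiffOn ℝ 1 (fun q : ℝ × ℝ => heightIn φ (Y q.1 q.2)) (J ×ˢ univ) :=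
      (heightIn φ).contDiff.comp_contDiffOn (hYc.of_le (by norm_num))
    have := hasDerivAt_max (F := fun ε θ => heightIn φ (Y ε θ)) hJo hF h0J
      isCompact_circleDomain (M := fun ε => supp (Y ε) φ)
      (fun s hs => supp_isMax (hYcont s hs) (hYper s hs) φ) hθ₀
      (fun t _ => by simp only [hY0, map_add]; linarith [htop t]) (fun t _ heq => by
        simp only [hY0, map_add, add_right_inj] at heq
        have := hov.eq_of_isTop htop heq
        rw [(hd t).deriv, (hd θ₀).deriv, ht.periodic_deriv_fst hz₀ this, this])
    rwa [(hd θ₀).deriv] at this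
  -- the contribution of `deriv c z₀` is the same at antipodal contact points and cancels
  have hcenter : ∀ φ θ, IsTop (γ z₀) φ θ → HasDerivAt (fun ε => heightIn φ (m ε))
      (ℓ (γ z₀ θ) * heightIn φ (deriv (fun z => γ z θ) z₀)) 0 := by
    intro φ θ hθ
    obtain ⟨θ', hθ'⟩ := ht.symm z₀ hz₀ θ
    have h1 := hsupp φ θ hθ
    have h2 := hsupp (φ + Real.pi) θ' (ht.isTop_antipode hz₀ hθ hθ')
    have h3 : HasDerivAt (fun ε => (supp (Y ε) φ - supp (Y ε) (φ + Real.pi)) / 2) _ 0 :=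
      (h1.sub h2).div_const 2
    refine (h3.congr_of_eventuallyEq ?_).congr_deriv ?_
    · filter_upwards [hJo.mem_nhds h0J] with ε hε
      have := supp_sub_supp_of_symm (hYcont ε hε) (hYper ε hε) (m := m ε)
        (fun θ => (hm ε hε θ).imp fun _ h1 => h1.1) φ
      rw [this]
      ring
    · rw [hθ', map_neg, heightIn_add_pi, heightIn_add_pi, ht.height_deriv_antipode hz₀ hθ hθ']
      ring
  have hex := fun φ => exists_isTop hov.contDiff.continuous hov.periodic φ
  obtain ⟨θ₁, -, h₁⟩ := hex 0
  obtain ⟨θ₂, -, h₂⟩ := hex (Real.pi / 2)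
  have e₁ := hcenter _ _ h₁
  have e₂ := hcenter _ _ h₂
  refine ⟨_, _, fun φ θ hθ => (hcenter φ θ hθ).unique
    (((e₁.const_mul (Real.cos φ)).add (e₂.const_mul (Real.sin φ))).congr_of_eventuallyEq
      (Filter.Eventually.of_forall fun ε => ?_))⟩
  simp [heightIn_apply]

end SymTube

/-! ### The support functions of the horizontal sections -/

/-- The contact points `(x φ, y φ)` of a bounded curve with positive support function `h` do not
all lie, up to the two directions `±φ₀`, on a line through the origin. -/
theorem contact_points_not_collinear {h x y : ℝ → ℝ} {A B R φ₀ : ℝ} (hcont : Continuous h)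
    (hpos : ∀ φ, 0 < h φ) (hh : ∀ φ, h φ = Real.cos φ * x φ + Real.sin φ * y φ)
    (hxR : ∀ φ, |x φ| ≤ R) (hyR : ∀ φ, |y φ| ≤ R) (hAB : ¬(A = 0 ∧ B = 0))
    (hline : ∀ φ, Real.sin (φ - φ₀) ≠ 0 → B * x φ - A * y φ = 0) : False := by
  have hAB' : 0 < A ^ 2 + B ^ 2 := by
    rcases not_and_or.1 hAB with h1 | h1 <;> positivity
  have hbound : ∀ φ, Real.sin (φ - φ₀) ≠ 0 →
      (A ^ 2 + B ^ 2) * h φ ≤ |A * Real.cos φ + B * Real.sin φ| * ((|A| + |B|) * R) := by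
    intro φ hs
    have hline := hline φ hs
    have h1 : (A ^ 2 + B ^ 2) * h φ =
        (A * Real.cos φ + B * Real.sin φ) * (A * x φ + B * y φ) := by
      rw [hh]
      linear_combination (B * Real.cos φ - A * Real.sin φ) * hline
    have h2 : |A * x φ + B * y φ| ≤ (|A| + |B|) * R := by
      refine (abs_add_le _ _).trans ?_
      rw [abs_mul, abs_mul]
      nlinarith [abs_nonneg A, abs_nonneg B, hxR φ, hyR φ,
        mul_le_mul_of_nonneg_left (hxR φ) (abs_nonneg A),
        mul_le_mul_of_nonneg_left (hyR φ) (abs_nonneg B)]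
    rw [h1]
    refine (le_abs_self _).trans ?_
    rw [abs_mul]
    gcongr
  obtain ⟨φ₁, hφ₁⟩ : ∃ φ₁, A * Real.cos φ₁ + B * Real.sin φ₁ = 0 := by
    set z : ℂ := ⟨-B, A⟩ with hz
    have h2 : z.re = ‖z‖ * Real.cos z.arg := (Complex.norm_mul_cos_arg z).symm
    have h3 : z.im = ‖z‖ * Real.sin z.arg := (Complex.norm_mul_sin_arg z).symm
    have hz0 : ‖z‖ ≠ 0 := by
      rw [norm_ne_zero_iff]
      intro h0
      have h4 := congrArg Complex.re h0
      have h5 := congrArg Complex.im h0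
      simp [hz] at h4 h5
      exact hAB ⟨h5, h4⟩
    refine ⟨z.arg, mul_left_cancel₀ hz0 ?_⟩
    simp only [hz] at h2 h3 ⊢
    linear_combination -A * h2 - B * h3
  have hle : (A ^ 2 + B ^ 2) * h φ₁ ≤
      |A * Real.cos φ₁ + B * Real.sin φ₁| * ((|A| + |B|) * R) := by
    by_cases hs : Real.sin (φ₁ - φ₀) = 0
    · have hder : HasDerivAt (fun φ => Real.sin (φ - φ₀)) (Real.cos (φ₁ - φ₀)) φ₁ := by
        simpa using ((hasDerivAt_id φ₁).sub_const φ₀).sin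
      have hne : Real.cos (φ₁ - φ₀) ≠ 0 := by
        intro h0
        have := Real.sin_sq_add_cos_sq (φ₁ - φ₀)
        rw [hs, h0] at this
        norm_num at this
      have hev := hder.eventually_ne (c := 0) hne
      have hl : Tendsto (fun φ => (A ^ 2 + B ^ 2) * h φ) (𝓝[≠] φ₁)
          (𝓝 ((A ^ 2 + B ^ 2) * h φ₁)) :=
        (Continuous.tendsto (by fun_prop) φ₁).mono_left nhdsWithin_le_nhds
      have hr : Tendsto (fun φ => |A * Real.cos φ + B * Real.sin φ| * ((|A| + |B|) * R))
          (𝓝[≠] φ₁) (𝓝 (|A * Real.cos φ₁ + B * Real.sin φ₁| * ((|A| + |B|) * R))) :=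
        (Continuous.tendsto (by fun_prop) φ₁).mono_left nhdsWithin_le_nhds
      exact le_of_tendsto_of_tendsto hl hr (hev.mono fun φ hφ => hbound φ hφ)
    · exact hbound φ₁ hs
  rw [hφ₁, abs_zero, zero_mul] at hle
  have := mul_pos hAB' (hpos φ₁)
  linarith

/-- The first order condition in one section. Here `h` is the support function of a bounded
curve with contact points `(x φ, y φ)`, and `k` is the normal speed of the curve; the condition says
that `k • (x, y)` depends linearly on the normal vector `(cos φ, sin φ)`. Then `k` is a multiple
of `h`, and it vanishes unless `h²` is a quadratic form. -/
theorem normal_speed_eq {h k x y : ℝ → ℝ} {a₀ a₁ b₀ b₁ R : ℝ}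
    (hper : ∀ φ, h (φ + 2 * Real.pi) = h φ) (hpos : ∀ φ, 0 < h φ)
    (hh : ∀ φ, h φ = Real.cos φ * x φ + Real.sin φ * y φ)
    (hd : ∀ φ, HasDerivAt h (-Real.sin φ * x φ + Real.cos φ * y φ) φ)
    (hx : ∀ φ, x φ * k φ = Real.cos φ * a₀ + Real.sin φ * a₁)
    (hy : ∀ φ, y φ * k φ = Real.cos φ * b₀ + Real.sin φ * b₁)
    (hxR : ∀ φ, |x φ| ≤ R) (hyR : ∀ φ, |y φ| ≤ R) :
    ∃ κ : ℝ, (∀ φ, k φ = κ * h φ) ∧ (κ ≠ 0 → ∃ α β δ : ℝ, ∀ φ,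
      h φ ^ 2 = α * Real.cos φ ^ 2 + 2 * β * (Real.cos φ * Real.sin φ) + δ * Real.sin φ ^ 2) := by
  have hcont : Continuous h := continuous_iff_continuousAt.2 fun φ => (hd φ).continuousAt
  set q : ℝ → ℝ := fun φ => a₀ * Real.cos φ ^ 2 + (a₁ + b₀) * (Real.cos φ * Real.sin φ) +
    b₁ * Real.sin φ ^ 2 with hq
  have hqk : ∀ φ, q φ = k φ * h φ := by
    intro φ
    rw [hh]
    simp only [hq]
    linear_combination -Real.cos φ * hx φ - Real.sin φ * hy φ
  by_cases hzero : ∃ φ₀, q φ₀ = 0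
  · obtain ⟨φ₀, hφ₀⟩ := hzero
    have hk0 : k φ₀ = 0 := by
      rw [hqk] at hφ₀
      exact (mul_eq_zero.1 hφ₀).resolve_right (hpos φ₀).ne'
    have ha := hx φ₀
    have hb := hy φ₀
    rw [hk0, mul_zero] at ha hb
    have hone := Real.sin_sq_add_cos_sq φ₀
    set A := Real.cos φ₀ * a₁ - Real.sin φ₀ * a₀ with hA
    set B := Real.cos φ₀ * b₁ - Real.sin φ₀ * b₀ with hB
    have hxA : ∀ φ, x φ * k φ = A * Real.sin (φ - φ₀) := by
      intro φ
      rw [hx, hA, Real.sin_sub]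
      linear_combination (-Real.cos φ * a₀ - Real.sin φ * a₁) * hone +
        (Real.cos φ * Real.cos φ₀ + Real.sin φ * Real.sin φ₀) * -ha
    have hyB : ∀ φ, y φ * k φ = B * Real.sin (φ - φ₀) := by
      intro φ
      rw [hy, hB, Real.sin_sub]
      linear_combination (-Real.cos φ * b₀ - Real.sin φ * b₁) * hone +
        (Real.cos φ * Real.cos φ₀ + Real.sin φ * Real.sin φ₀) * -hb
    by_cases hAB : A = 0 ∧ B = 0
    · refine ⟨0, fun φ => ?_, fun h0 => absurd rfl h0⟩
      have h1 : k φ * h φ = 0 := by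
        have h2 := hxA φ
        have h3 := hyB φ
        rw [hAB.1, zero_mul] at h2
        rw [hAB.2, zero_mul] at h3
        rw [hh]
        linear_combination Real.cos φ * h2 + Real.sin φ * h3
      rw [zero_mul]
      exact (mul_eq_zero.1 h1).resolve_right (hpos φ).ne'
    · -- otherwise all contact points but two lie on the line spanned by `(A, B)`
      exfalso
      refine contact_points_not_collinear hcont hpos hh hxR hyR hAB (φ₀ := φ₀) fun φ hs => ?_
      have hxA' := hxA φ
      have hyB' := hyB φ
      have hk : k φ ≠ 0 := by
        intro hk
        rw [hk, mul_zero] at hxA' hyB'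
        exact hAB ⟨(mul_eq_zero.1 hxA'.symm).resolve_right hs,
          (mul_eq_zero.1 hyB'.symm).resolve_right hs⟩
      apply (mul_eq_zero.1 (_ : k φ * (B * x φ - A * y φ) = 0)).resolve_left hk
      linear_combination B * hxA' - A * hyB'
  · -- the quadratic form `q = k h` has no zero: compare the logarithmic derivatives of `h²` and `q`
    push Not at hzero
    have hqd : ∀ φ, HasDerivAt q (-2 * a₀ * (Real.cos φ * Real.sin φ) +
        (a₁ + b₀) * (Real.cos φ ^ 2 - Real.sin φ ^ 2) +
        2 * b₁ * (Real.cos φ * Real.sin φ)) φ := by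
      intro φ
      have hc := Real.hasDerivAt_cos φ
      have hs := Real.hasDerivAt_sin φ
      have := (((hc.pow 2).const_mul a₀).add ((hc.mul hs).const_mul (a₁ + b₀))).add
        ((hs.pow 2).const_mul b₁)
      refine this.congr_deriv ?_
      simp
      ring
    have hWd : ∀ φ, HasDerivAt (fun φ => h φ ^ 2 / q φ)
        ((b₀ - a₁) * (h φ ^ 2 / q φ ^ 2)) φ := by
      intro φ
      have := ((hd φ).pow 2).div (hqd φ) (hzero φ)
      refine this.congr_deriv ?_
      have h1 : (-Real.sin φ * x φ + Real.cos φ * y φ) * q φ =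
          h φ * (-Real.sin φ * (Real.cos φ * a₀ + Real.sin φ * a₁) +
            Real.cos φ * (Real.cos φ * b₀ + Real.sin φ * b₁)) := by
        rw [hqk, ← hx, ← hy]
        ring
      have hone := Real.sin_sq_add_cos_sq φ
      rw [← mul_div_assoc]
      congr 1
      simp only [Nat.cast_ofNat, Nat.add_one_sub_one, pow_one, Pi.pow_apply]
      linear_combination 2 * h φ * h1 + h φ ^ 2 * (b₀ - a₁) * hone
    have hWper : h (0 + 2 * Real.pi) ^ 2 / q (0 + 2 * Real.pi) = h 0 ^ 2 / q 0 := by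
      rw [hper]
      simp [hq]
    have hpos' : ∀ φ, 0 < h φ ^ 2 / q φ ^ 2 := fun φ => by
      have := hpos φ
      have := hzero φ
      positivity
    -- a periodic function cannot be strictly monotone
    have hsymm : b₀ - a₁ = 0 := by
      have hlt : (0 : ℝ) < 0 + 2 * Real.pi := by positivity
      rcases lt_trichotomy (b₀ - a₁) 0 with hneg | h0 | hpos0
      · have hanti : StrictAnti fun φ => h φ ^ 2 / q φ := strictAnti_of_deriv_neg fun φ => by
          rw [(hWd φ).deriv]
          exact mul_neg_of_neg_of_pos hneg (hpos' φ)
        exact absurd hWper (hanti hlt).ne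
      · exact h0
      · have hmono : StrictMono fun φ => h φ ^ 2 / q φ := strictMono_of_deriv_pos fun φ => by
          rw [(hWd φ).deriv]
          exact mul_pos hpos0 (hpos' φ)
        exact absurd hWper (hmono hlt).ne'
    set C := h 0 ^ 2 / q 0 with hC
    have hconst : ∀ φ, h φ ^ 2 / q φ = C := fun φ =>
      is_const_of_deriv_eq_zero (fun φ => (hWd φ).differentiableAt)
        (fun φ => by rw [(hWd φ).deriv, hsymm, zero_mul]) φ 0
    have hC0 : C ≠ 0 := div_ne_zero (pow_ne_zero 2 (hpos 0).ne') (hzero 0)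
    have hsq : ∀ φ, h φ ^ 2 = C * q φ := fun φ => by
      rw [← hconst φ, div_mul_cancel₀ _ (hzero φ)]
    refine ⟨C⁻¹, fun φ => ?_, fun _ => ⟨C * a₀, C * (a₁ + b₀) / 2, C * b₁, fun φ => ?_⟩⟩
    · have h1 := hsq φ
      rw [hqk] at h1
      apply mul_left_cancel₀ (hpos φ).ne'
      field_simp
      linear_combination -h1
    · rw [hsq]
      simp only [hq]
      ring

namespace SymTube
variable {c : ℝ → E2} {γ : ℝ → ℝ → E2}

/-- The logarithmic derivative of the support function with respect to the height is the same in all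
directions. -/
theorem exists_log_deriv (ht : SymTube c γ) {z : ℝ} (hz : z ∈ Ioo (-1 : ℝ) 1) :
    ∃ κ : ℝ, (∀ φ, HasDerivAt (fun z => supp (γ z) φ) (κ * supp (γ z) φ) z) ∧
      (κ ≠ 0 → ∃ α β δ : ℝ, ∀ φ, supp (γ z) φ ^ 2 =
        α * Real.cos φ ^ 2 + 2 * β * (Real.cos φ * Real.sin φ) + δ * Real.sin φ ^ 2) := by
  have hov := ht.oval z hz
  choose θ _ hθ using fun φ => exists_isTop hov.contDiff.continuous hov.periodic φ
  obtain ⟨a₀, a₁, ha⟩ := ht.first_order hz (EuclideanSpace.proj 0)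
  obtain ⟨b₀, b₁, hb⟩ := ht.first_order hz (EuclideanSpace.proj 1)
  obtain ⟨R, hR⟩ := hov.isCompact_range.isBounded.exists_norm_le
  have hcoord : ∀ (i : Fin 2) φ, |γ z (θ φ) i| ≤ R := fun i φ =>
    (PiLp.norm_apply_le (γ z (θ φ)) i).trans (hR _ ⟨_, rfl⟩)
  have hd : ∀ φ, HasDerivAt (fun z => supp (γ z) φ)
      (heightIn φ (deriv (fun z => γ z (θ φ)) z)) z := fun φ =>
    ht.hasDerivAt_supp_height hz (hθ φ)
  obtain ⟨κ, hκ, hκ'⟩ := normal_speed_eq (h := supp (γ z))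
    (k := fun φ => heightIn φ (deriv (fun z => γ z (θ φ)) z))
    (x := fun φ => γ z (θ φ) 0) (y := fun φ => γ z (θ φ) 1)
    (fun φ => by rw [two_mul, ← add_assoc, ht.supp_add_pi hz, ht.supp_add_pi hz])
    (ht.supp_pos hz) (fun φ => by rw [(hθ φ).supp_eq hov.periodic, heightIn_apply])
    (fun φ => by
      have := hov.hasDerivAt_supp (hθ φ)
      rwa [heightIn_apply, Real.cos_add_pi_div_two, Real.sin_add_pi_div_two] at this)
    (fun φ => ha φ _ (hθ φ)) (fun φ => hb φ _ (hθ φ)) (hcoord 0) (hcoord 1)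
  exact ⟨κ, fun φ => hκ φ ▸ hd φ, hκ'⟩

/-- All horizontal sections are homothetic. -/
theorem supp_mul_supp (ht : SymTube c γ) {z w : ℝ} (hz : z ∈ Ioo (-1 : ℝ) 1)
    (hw : w ∈ Ioo (-1 : ℝ) 1) (φ ψ : ℝ) :
    supp (γ z) φ * supp (γ w) ψ = supp (γ w) φ * supp (γ z) ψ := by
  have hd : ∀ x ∈ Ioo (-1 : ℝ) 1,
      HasDerivAt (fun x => supp (γ x) φ / supp (γ x) ψ) 0 x := by
    intro x hx
    obtain ⟨κ, hκ, -⟩ := ht.exists_log_deriv hx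
    refine ((hκ φ).div (hκ ψ) (ht.supp_pos hx ψ).ne').congr_deriv ?_
    rw [div_eq_zero_iff]
    left
    ring
  have := (convex_Ioo (-1 : ℝ) 1).is_const_of_fderivWithin_eq_zero (𝕜 := ℝ)
    (f := fun x => supp (γ x) φ / supp (γ x) ψ)
    (fun x hx => (hd x hx).differentiableAt.differentiableWithinAt)
    (fun x hx => by
      rw [(hd x hx).hasFDerivAt.hasFDerivWithinAt.fderivWithin
        (isOpen_Ioo.uniqueDiffWithinAt hx)]
      ext; simp) hz hw
  rw [div_eq_div_iff (ht.supp_pos hz ψ).ne' (ht.supp_pos hw ψ).ne'] at this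
  exact this

/-- Either all horizontal sections are translates of each other, or their squared support
functions are proportional quadratic forms. -/
theorem supp_dichotomy (ht : SymTube c γ) :
    (∀ z ∈ Ioo (-1 : ℝ) 1, ∀ φ, supp (γ z) φ = supp (γ 0) φ) ∨
      ∃ α β δ : ℝ, ∀ z ∈ Ioo (-1 : ℝ) 1, ∃ G > 0, ∀ φ, supp (γ z) φ ^ 2 =
        G * (α * Real.cos φ ^ 2 + 2 * β * (Real.cos φ * Real.sin φ) + δ * Real.sin φ ^ 2) := by
  by_cases hall : ∀ z ∈ Ioo (-1 : ℝ) 1, ∀ φ, HasDerivAt (fun z => supp (γ z) φ) 0 z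
  · left
    intro z hz φ
    refine (convex_Ioo (-1 : ℝ) 1).is_const_of_fderivWithin_eq_zero (𝕜 := ℝ)
      (f := fun x => supp (γ x) φ)
      (fun x hx => (hall x hx φ).differentiableAt.differentiableWithinAt)
      (fun x hx => by
        rw [(hall x hx φ).hasFDerivAt.hasFDerivWithinAt.fderivWithin
          (isOpen_Ioo.uniqueDiffWithinAt hx)]
        ext; simp) hz (by simp)
  · right
    push Not at hall
    obtain ⟨w, hw, φ, hφ⟩ := hall
    obtain ⟨κ, hκ, hκ'⟩ := ht.exists_log_deriv hw
    have hκ0 : κ ≠ 0 := by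
      rintro rfl
      exact hφ (by simpa using hκ φ)
    obtain ⟨α, β, δ, hq⟩ := hκ' hκ0
    refine ⟨α, β, δ, fun z hz => ⟨(supp (γ z) 0 / supp (γ w) 0) ^ 2, ?_, fun φ => ?_⟩⟩
    · have := ht.supp_pos hz 0
      have := ht.supp_pos hw 0
      positivity
    · rw [← hq, ← mul_pow]
      congr 1
      have := ht.supp_mul_supp hz hw φ 0
      have := (ht.supp_pos hw 0).ne'
      field_simp
      linarith

end SymTube

/-! ### Horizontal sections that are translates of each other -/

theorem eq_of_heightIn_eq {φ : ℝ} {x y : E2} (h1 : heightIn φ x = heightIn φ y)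
    (h2 : heightIn (φ + Real.pi / 2) x = heightIn (φ + Real.pi / 2) y) : x = y := by
  rw [heightIn_apply, heightIn_apply] at h1 h2
  rw [Real.cos_add_pi_div_two, Real.sin_add_pi_div_two] at h2
  have hone := Real.sin_sq_add_cos_sq φ
  ext i
  fin_cases i
  · show x 0 = y 0
    linear_combination Real.cos φ * h1 - Real.sin φ * h2 - (x 0 - y 0) * hone
  · show x 1 = y 1
    linear_combination Real.sin φ * h1 + Real.cos φ * h2 - (x 1 - y 1) * hone

/-- An oval is determined by its support function. -/
theorem IsOvalParam.range_subset_of_supp_eq {γ₁ γ₂ : ℝ → E2} (h₁ : IsOvalParam γ₁)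
    (h₂ : IsOvalParam γ₂) (h : ∀ φ, supp γ₁ φ = supp γ₂ φ) : range γ₁ ⊆ range γ₂ := by
  rintro _ ⟨t, rfl⟩
  obtain ⟨φ, hφ⟩ := h₁.exists_heightIn_lt t
  have htop : IsTop γ₁ φ t := fun s => by
    by_cases hs : γ₁ s = γ₁ t
    · rw [hs]
    · exact (hφ s hs).le
  obtain ⟨θ, -, hθ⟩ := exists_isTop h₂.contDiff.continuous h₂.periodic φ
  refine ⟨θ, eq_of_heightIn_eq (φ := φ) ?_ ?_⟩
  · rw [← hθ.supp_eq h₂.periodic, ← htop.supp_eq h₁.periodic, h]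
  · have h3 := h₁.hasDerivAt_supp htop
    rw [funext h] at h3
    exact (h₂.hasDerivAt_supp hθ).unique h3

/-- Second order Taylor expansion. -/
theorem eventually_taylor_two {f f' : ℝ → ℝ} {z₀ k : ℝ}
    (hf : ∀ᶠ z in 𝓝 z₀, HasDerivAt f (f' z) z) (hf' : HasDerivAt f' k z₀) {η : ℝ} (hη : 0 < η) :
    ∀ᶠ z in 𝓝 z₀,
      |f z - f z₀ - f' z₀ * (z - z₀) - k / 2 * (z - z₀) ^ 2| ≤ η * (z - z₀) ^ 2 := by
  rw [hasDerivAt_iff_isLittleO, Asymptotics.isLittleO_iff] at hf'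
  obtain ⟨r, hr, hball⟩ := Metric.eventually_nhds_iff_ball.1 (hf.and (hf' hη))
  filter_upwards [Metric.ball_mem_nhds z₀ hr] with z hz
  have hz' : |z - z₀| < r := by rwa [Metric.mem_ball, Real.dist_eq] at hz
  have hsub : Metric.closedBall z₀ |z - z₀| ⊆ Metric.ball z₀ r :=
    Metric.closedBall_subset_ball hz'
  have hd : ∀ x ∈ Metric.closedBall z₀ |z - z₀|, HasDerivWithinAt
      (fun x => f x - f' z₀ * (x - z₀) - k / 2 * (x - z₀) ^ 2)
      (f' x - f' z₀ - (x - z₀) * k) (Metric.closedBall z₀ |z - z₀|) x := by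
    intro x hx
    have h1 := (hball x (hsub hx)).1
    have h2 := (hasDerivAt_id x).sub_const z₀
    have h3 := (h1.sub (h2.const_mul (f' z₀))).sub ((h2.pow 2).const_mul (k / 2))
    refine (h3.congr_deriv ?_).hasDerivWithinAt
    simp
    ring
  have := (convex_closedBall z₀ |z - z₀|).norm_image_sub_le_of_norm_hasDerivWithin_le hd
    (C := η * |z - z₀|) (fun x hx => by
      refine ((hball x (hsub hx)).2).trans ?_
      rw [Metric.mem_closedBall, Real.dist_eq] at hx
      exact mul_le_mul_of_nonneg_left hx hη.le)
    (Metric.mem_closedBall_self (abs_nonneg _)) (by rw [Metric.mem_closedBall, Real.dist_eq])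
  rw [Real.norm_eq_abs, Real.norm_eq_abs] at this
  calc _ = _ := by congr 1; ring
    _ ≤ _ := this
    _ = η * (z - z₀) ^ 2 := by rw [mul_assoc, abs_mul_abs_self, sq]

theorem affine_of_deriv_deriv_eq_zero {V : Type*} [NormedAddCommGroup V] [NormedSpace ℝ V]
    {f : ℝ → V} (hf : ContDiffOn ℝ 2 f (Ioo (-1) 1))
    (h : ∀ z ∈ Ioo (-1 : ℝ) 1, deriv (deriv f) z = 0) :
    ∃ v : V, ∀ z ∈ Ioo (-1 : ℝ) 1, f z = f 0 + z • v := by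
  have h0 : (0 : ℝ) ∈ Ioo (-1 : ℝ) 1 := by simp
  have hf1 : ContDiffOn ℝ 1 (deriv f) (Ioo (-1) 1) :=
    hf.deriv_of_isOpen isOpen_Ioo (by norm_num [one_add_one_eq_two])
  have hconst : ∀ z ∈ Ioo (-1 : ℝ) 1, deriv f z = deriv f 0 := fun z hz =>
    isOpen_Ioo.is_const_of_deriv_eq_zero isPreconnected_Ioo
      (hf1.differentiableOn one_ne_zero) h hz h0
  refine ⟨deriv f 0, fun z hz => ?_⟩
  have hd : ∀ x ∈ Ioo (-1 : ℝ) 1, HasDerivAt (fun x => f x - x • deriv f 0) 0 x := by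
    intro x hx
    have h1 : HasDerivAt f (deriv f x) x :=
      ((hf.contDiffAt (isOpen_Ioo.mem_nhds hx)).differentiableAt two_ne_zero).hasDerivAt
    have := h1.sub ((hasDerivAt_id x).smul_const (deriv f 0))
    rwa [hconst x hx, one_smul, sub_self] at this
  have := isOpen_Ioo.is_const_of_deriv_eq_zero isPreconnected_Ioo
    (fun x hx => (hd x hx).differentiableAt.differentiableWithinAt)
    (fun x hx => (hd x hx).deriv) hz h0
  simp only [zero_smul, sub_zero] at this
  rw [← this]
  abel

namespace SymTube
variable {c : ℝ → E2}

/-- The centrality of the sections by planes `z = z₀ + ε ℓ(x - c z₀)`, to second order in `ε`,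
if all horizontal sections are translates of each other. -/
theorem second_order {γ₀ : ℝ → E2} (ht : SymTube c fun _ => γ₀) {z₀ : ℝ}
    (hz₀ : z₀ ∈ Ioo (-1 : ℝ) 1) (ℓ : E2 →L[ℝ] ℝ) :
    ∃ a b : ℝ, ∀ φ θ, IsTop γ₀ φ θ →
      heightIn φ (deriv (deriv c) z₀) * ℓ (γ₀ θ) ^ 2 =
        Real.cos φ * a + Real.sin φ * b := by
  have hov : IsOvalParam γ₀ := ht.oval z₀ hz₀
  obtain ⟨δ, hδ, ζ, m, h, hζc, hζI, hζper, hζ0, hζd, hm⟩ :=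
    ht.exists_section_through_center hz₀ ℓ
  set J : Set ℝ := Ioo (-δ) δ with hJ
  have hJo : IsOpen J := isOpen_Ioo
  have h0J : (0 : ℝ) ∈ J := ⟨by linarith, hδ⟩
  have hCd : ∀ z ∈ Ioo (-1 : ℝ) 1, HasDerivAt c (deriv c z) z := fun z hz =>
    ((ht.contDiffOn_center.contDiffAt (isOpen_Ioo.mem_nhds hz)).differentiableAt
      two_ne_zero).hasDerivAt
  have hc1 : ContDiffOn ℝ 1 (deriv c) (Ioo (-1) 1) :=
    ht.contDiffOn_center.deriv_of_isOpen isOpen_Ioo (by norm_num [one_add_one_eq_two])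
  have hCd2 : HasDerivAt (deriv c) (deriv (deriv c) z₀) z₀ :=
    ((hc1.contDiffAt (isOpen_Ioo.mem_nhds hz₀)).differentiableAt one_ne_zero).hasDerivAt
  -- the sections, sheared along the tangent of the curve of centers
  set W : ℝ → ℝ → E2 := fun ε θ =>
    γ₀ θ + (c (ζ ε θ) - c z₀ - (ζ ε θ - z₀) • deriv c z₀) with hW
  have hζcont : ∀ ε ∈ J, Continuous (ζ ε) := fun ε hε =>
    (contDiff_snd_of_contDiffOn hζc hε).continuous
  have hWcont : ∀ ε ∈ J, Continuous (W ε) := by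
    intro ε hε
    have h1 := hζcont ε hε
    have h2 : Continuous fun θ => c (ζ ε θ) :=
      ht.contDiffOn_center.continuousOn.comp_continuous h1 (hζI ε hε)
    have h3 := hov.contDiff.continuous
    exact h3.add ((h2.sub continuous_const).sub
      ((h1.sub continuous_const).smul continuous_const))
  have hWper : ∀ ε ∈ J, Function.Periodic (W ε) (2 * Real.pi) := by
    intro ε hε θ
    simp only [hW, hζper ε hε θ, hov.periodic θ]
  set m' : ℝ → E2 := fun ε => m ε - c z₀ - (h ε - z₀) • deriv c z₀ with hm'
  have hWm : ∀ ε ∈ J, ∀ θ, ∃ θ', W ε θ' = (2 : ℝ) • m' ε - W ε θ := by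
    intro ε hε θ
    obtain ⟨θ', h1, h2⟩ := hm ε hε θ
    refine ⟨θ', ?_⟩
    have h3 : γ₀ θ' = (2 : ℝ) • m ε - (c (ζ ε θ) + γ₀ θ) - c (ζ ε θ') := by rw [← h1]; abel
    simp only [hW, hm', h3, h2]
    module
  obtain ⟨B, hB⟩ := isCompact_circleDomain.exists_bound_of_continuousOn
    ((ℓ.continuous.comp hov.contDiff.continuous).continuousOn)
  have hB0 : 0 ≤ B := (norm_nonneg _).trans (hB 0 (left_mem_Icc.2 (by positivity)))
  have hsmall : ∀ η > 0, ∀ᶠ ε in 𝓝 (0 : ℝ), ∀ θ ∈ circleDomain,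
      |ζ ε θ - z₀ - ε * ℓ (γ₀ θ)| ≤ η * |ε| := by
    intro η hη
    filter_upwards [eventually_uniform_expansion hJo (hζc.of_le (by norm_num)) h0J
      isCompact_circleDomain hη] with ε hε θ hθ
    have := hε θ hθ
    rwa [hζ0, (hζd θ).deriv, sub_zero] at this
  have hexp : ∀ φ, ∀ η > 0, ∀ᶠ ε in 𝓝 (0 : ℝ), ∀ θ ∈ circleDomain,
      |heightIn φ (W ε θ) - heightIn φ (γ₀ θ) -
        ε ^ 2 * (heightIn φ (deriv (deriv c) z₀) / 2 * ℓ (γ₀ θ) ^ 2)| ≤ η * |ε ^ 2| := by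
    intro φ η hη
    set k := heightIn φ (deriv (deriv c) z₀) with hk
    have htay := eventually_taylor_two (f := fun z => heightIn φ (c z))
      (f' := fun z => heightIn φ (deriv c z)) (z₀ := z₀) (k := k)
      (by filter_upwards [isOpen_Ioo.mem_nhds hz₀] with z hz using
        (heightIn φ).hasFDerivAt.comp_hasDerivAt z (hCd z hz))
      ((heightIn φ).hasFDerivAt.comp_hasDerivAt z₀ hCd2)
      (η := η / (2 * (B + 1) ^ 2)) (by positivity)
    obtain ⟨r, hr, hball⟩ := Metric.eventually_nhds_iff_ball.1 htay
    have hη' : 0 < min 1 (η / ((|k| + 1) * (2 * B + 1))) := lt_min one_pos (by positivity)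
    have hεr : ∀ᶠ ε in 𝓝 (0 : ℝ), |ε| < r / (B + 1) := by
      have : Tendsto (fun ε : ℝ => |ε|) (𝓝 0) (𝓝 |0|) := continuous_abs.tendsto 0
      rw [abs_zero] at this
      exact this.eventually_lt_const (by positivity)
    filter_upwards [hsmall _ hη', hεr] with ε hε hεr θ hθ
    have h1 := hε θ hθ
    have h1' : |ζ ε θ - z₀ - ε * ℓ (γ₀ θ)| ≤ |ε| := h1.trans (by
      have := min_le_left 1 (η / ((|k| + 1) * (2 * B + 1)))
      nlinarith [abs_nonneg ε])
    have hL : |ℓ (γ₀ θ)| ≤ B := hB θ hθ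
    set t := ζ ε θ - z₀ with ht'
    set L := ℓ (γ₀ θ) with hL'
    have hεL : |ε * L| ≤ |ε| * B := by rw [abs_mul]; gcongr
    have htB : |t| ≤ |ε| * (B + 1) := by
      have : |t| ≤ |t - ε * L| + |ε * L| := by
        simpa using abs_add_le (t - ε * L) (ε * L)
      linarith
    have htr : ζ ε θ ∈ Metric.ball z₀ r := by
      rw [Metric.mem_ball, Real.dist_eq, ← ht']
      rw [lt_div_iff₀ (by positivity)] at hεr
      linarith
    have h2 := hball _ htr
    rw [← ht'] at h2
    have h3 : heightIn φ (W ε θ) - heightIn φ (γ₀ θ) - ε ^ 2 * (k / 2 * L ^ 2) =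
        (heightIn φ (c (ζ ε θ)) - heightIn φ (c z₀) - heightIn φ (deriv c z₀) * t -
          k / 2 * t ^ 2) + k / 2 * ((t - ε * L) * (t + ε * L)) := by
      simp only [hW, map_add, map_sub, map_smul, smul_eq_mul]
      rw [← ht']
      ring
    have h4 : |t + ε * L| ≤ |ε| * (2 * B + 1) := by
      have := abs_add_le t (ε * L)
      linarith
    have h5 : |k / 2 * ((t - ε * L) * (t + ε * L))| ≤ η / 2 * ε ^ 2 := by
      have h6 : |t - ε * L| ≤ η / ((|k| + 1) * (2 * B + 1)) * |ε| :=
        h1.trans (mul_le_mul_of_nonneg_right (min_le_right _ _) (abs_nonneg ε))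
      have h7 : |t - ε * L| * |t + ε * L| ≤
          (η / ((|k| + 1) * (2 * B + 1)) * |ε|) * (|ε| * (2 * B + 1)) :=
        mul_le_mul h6 h4 (abs_nonneg _) (by positivity)
      have h8 : (η / ((|k| + 1) * (2 * B + 1)) * |ε|) * (|ε| * (2 * B + 1)) =
          η / (|k| + 1) * ε ^ 2 := by
        rw [← sq_abs ε]
        field_simp
      rw [h8] at h7
      rw [abs_mul, abs_mul, abs_div, abs_two]
      calc |k| / 2 * (|t - ε * L| * |t + ε * L|)
          ≤ (|k| + 1) / 2 * (η / (|k| + 1) * ε ^ 2) := by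
            gcongr
            linarith
        _ = η / 2 * ε ^ 2 := by field_simp
    have h6 : η / (2 * (B + 1) ^ 2) * t ^ 2 ≤ η / 2 * ε ^ 2 := by
      have : t ^ 2 ≤ (|ε| * (B + 1)) ^ 2 := by
        rw [← sq_abs t]
        exact pow_le_pow_left₀ (abs_nonneg t) htB 2
      calc η / (2 * (B + 1) ^ 2) * t ^ 2 ≤ η / (2 * (B + 1) ^ 2) * (|ε| * (B + 1)) ^ 2 := by
            gcongr
        _ = η / 2 * ε ^ 2 := by
            rw [mul_pow, sq_abs]
            field_simp
    rw [h3, abs_of_nonneg (sq_nonneg ε)]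
    refine (abs_add_le _ _).trans ?_
    linarith
  have hsupp : ∀ φ θ, IsTop γ₀ φ θ → Tendsto
      (fun ε => (supp (W ε) φ - supp γ₀ φ) / ε ^ 2) (𝓝[≠] 0)
      (𝓝 (heightIn φ (deriv (deriv c) z₀) / 2 * ℓ (γ₀ θ) ^ 2)) := by
    intro φ θ hθ
    obtain ⟨θ₀, hθ₀, he, htop⟩ := hθ.exists_mem hov.periodic
    rw [← he, htop.supp_eq hov.periodic, Metric.tendsto_nhds]
    intro η hη
    have hcγ := hov.contDiff.continuous
    have hev := max_expansion isCompact_circleDomain (l := 𝓝 (0 : ℝ))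
      (f := fun θ => heightIn φ (γ₀ θ))
      (D := fun θ => heightIn φ (deriv (deriv c) z₀) / 2 * ℓ (γ₀ θ) ^ 2)
      (F := fun ε θ => heightIn φ (W ε θ)) (M := fun ε => supp (W ε) φ) (δ := fun ε => ε ^ 2)
      (by fun_prop) (by fun_prop)
      (by simpa using (continuous_pow 2).tendsto (0 : ℝ)) (hexp φ)
      (by filter_upwards [hJo.mem_nhds h0J] with ε hε using
        supp_isMax (hWcont ε hε) (hWper ε hε) φ) hθ₀ (fun t _ => htop t)
      (fun t _ heq => by rw [hov.eq_of_isTop htop heq]) (half_pos hη)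
    filter_upwards [nhdsWithin_le_nhds hev, self_mem_nhdsWithin] with ε hε hne
    have hpos : 0 < ε ^ 2 := by
      have : ε ≠ 0 := hne
      positivity
    rw [abs_of_pos hpos] at hε
    rw [Real.dist_eq]
    have h1 : (supp (W ε) φ - heightIn φ (γ₀ θ₀)) / ε ^ 2 -
        heightIn φ (deriv (deriv c) z₀) / 2 * ℓ (γ₀ θ₀) ^ 2 =
        (supp (W ε) φ - heightIn φ (γ₀ θ₀) -
          ε ^ 2 * (heightIn φ (deriv (deriv c) z₀) / 2 * ℓ (γ₀ θ₀) ^ 2)) / ε ^ 2 := by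
      rw [sub_div _ (ε ^ 2 * _), mul_div_cancel_left₀ _ hpos.ne']
    rw [h1, abs_div, abs_of_pos hpos, div_lt_iff₀ hpos]
    nlinarith
  have hcenter : ∀ φ θ, IsTop γ₀ φ θ → Tendsto (fun ε => 2 * heightIn φ (m' ε) / ε ^ 2)
      (𝓝[≠] 0) (𝓝 (heightIn φ (deriv (deriv c) z₀) * ℓ (γ₀ θ) ^ 2)) := by
    intro φ θ hθ
    obtain ⟨θ', hθ'⟩ := ht.symm z₀ hz₀ θ
    have h1 := hsupp φ θ hθ
    have h2 := hsupp (φ + Real.pi) θ' (ht.isTop_antipode hz₀ hθ hθ')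
    have h3 := h1.sub h2
    have h4 : heightIn φ (deriv (deriv c) z₀) / 2 * ℓ (γ₀ θ) ^ 2 -
        heightIn (φ + Real.pi) (deriv (deriv c) z₀) / 2 * ℓ (γ₀ θ') ^ 2 =
        heightIn φ (deriv (deriv c) z₀) * ℓ (γ₀ θ) ^ 2 := by
      rw [hθ', map_neg, heightIn_add_pi]
      ring
    rw [h4] at h3
    refine h3.congr' ?_
    filter_upwards [nhdsWithin_le_nhds (hJo.mem_nhds h0J)] with ε hε
    rw [← supp_sub_supp_of_symm (hWcont ε hε) (hWper ε hε) (hWm ε hε) φ, ht.supp_add_pi hz₀]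
    ring
  have hex := fun φ => exists_isTop hov.contDiff.continuous hov.periodic φ
  obtain ⟨θ₁, -, h₁⟩ := hex 0
  obtain ⟨θ₂, -, h₂⟩ := hex (Real.pi / 2)
  refine ⟨_, _, fun φ θ hθ => tendsto_nhds_unique (hcenter φ θ hθ)
    ((((hcenter _ _ h₁).const_mul (Real.cos φ)).add
      ((hcenter _ _ h₂).const_mul (Real.sin φ))).congr fun ε => ?_)⟩
  simp [heightIn_apply]
  ring

/-- If `c''` did not vanish, then by `second_order` with a functional `ℓ` that vanishes at the
contact point in the direction of `c''`, `ℓ` would vanish at all contact points, except possibly in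
the two directions orthogonal to `c''`. -/
theorem center_deriv_deriv_eq_zero {γ₀ : ℝ → E2} (ht : SymTube c fun _ => γ₀) {z₀ : ℝ}
    (hz₀ : z₀ ∈ Ioo (-1 : ℝ) 1) : deriv (deriv c) z₀ = 0 := by
  have hov : IsOvalParam γ₀ := ht.oval z₀ hz₀
  set v := deriv (deriv c) z₀ with hv
  by_contra hne
  choose θ _ hθ using fun φ => exists_isTop hov.contDiff.continuous hov.periodic φ
  have hpos : ∀ φ, 0 < supp γ₀ φ := ht.supp_pos hz₀
  have hh : ∀ φ, supp γ₀ φ = Real.cos φ * γ₀ (θ φ) 0 + Real.sin φ * γ₀ (θ φ) 1 := fun φ => by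
    rw [(hθ φ).supp_eq hov.periodic, heightIn_apply]
  obtain ⟨R, hR⟩ := hov.isCompact_range.isBounded.exists_norm_le
  have hcoord : ∀ (i : Fin 2) φ, |γ₀ (θ φ) i| ≤ R := fun i φ =>
    (PiLp.norm_apply_le (γ₀ (θ φ)) i).trans (hR _ ⟨_, rfl⟩)
  have hcont : Continuous (supp γ₀) := continuous_iff_continuousAt.2 fun φ =>
    (hov.hasDerivAt_supp (hθ φ)).continuousAt
  set z : ℂ := ⟨v 0, v 1⟩ with hz
  have h2 : v 0 = ‖z‖ * Real.cos z.arg := (Complex.norm_mul_cos_arg z).symm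
  have h3 : v 1 = ‖z‖ * Real.sin z.arg := (Complex.norm_mul_sin_arg z).symm
  have hz0 : 0 < ‖z‖ := by
    rw [norm_pos_iff]
    intro h0
    have h4 := congrArg Complex.re h0
    have h5 := congrArg Complex.im h0
    simp [hz] at h4 h5
    apply hne
    ext i
    fin_cases i <;> simp [h4, h5]
  have hvφ : ∀ φ, heightIn φ v = ‖z‖ * Real.cos (φ - z.arg) := fun φ => by
    rw [heightIn_apply, h2, h3, Real.cos_sub]
    ring
  -- a functional that vanishes at the contact point `p` in direction `z.arg`
  set p := γ₀ (θ z.arg) with hp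
  set ℓ : E2 →L[ℝ] ℝ := p 1 • EuclideanSpace.proj 0 - p 0 • EuclideanSpace.proj 1 with hℓ
  have hℓx : ∀ x, ℓ x = p 1 * x 0 - p 0 * x 1 := fun x => by simp [hℓ]
  obtain ⟨a, b, hab⟩ := ht.second_order hz₀ ℓ
  have hk : ∀ φ, Real.cos φ * a + Real.sin φ * b = 0 := by
    have e1 := hab z.arg _ (hθ _)
    rw [hℓx, ← hp] at e1
    have e2 := hab (z.arg + Real.pi / 2) _ (hθ _)
    rw [← hv, hvφ, add_sub_cancel_left, Real.cos_pi_div_two, Real.cos_add_pi_div_two,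
      Real.sin_add_pi_div_two] at e2
    have hone := Real.sin_sq_add_cos_sq z.arg
    have ha : a = 0 := by
      linear_combination Real.sin z.arg * e2 - Real.cos z.arg * e1 - a * hone
    have hb : b = 0 := by
      linear_combination -Real.cos z.arg * e2 - Real.sin z.arg * e1 - b * hone
    intro φ
    rw [ha, hb]; ring
  refine contact_points_not_collinear hcont hpos hh (hcoord 0) (hcoord 1) (A := p 0) (B := p 1)
    (φ₀ := z.arg - Real.pi / 2) ?_ fun φ hφ => ?_
  · rintro ⟨h4, h5⟩
    have := hpos z.arg
    rw [hh, ← hp, h4, h5] at this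
    simp at this
  · have h6 := hab φ _ (hθ φ)
    rw [hk, ← hv, hvφ, mul_eq_zero, mul_eq_zero] at h6
    rw [← hℓx]
    rcases h6 with (h6 | h6) | h6
    · exact absurd h6 hz0.ne'
    · rw [show φ - (z.arg - Real.pi / 2) = φ - z.arg + Real.pi / 2 by ring,
        Real.sin_add_pi_div_two] at hφ
      exact absurd h6 hφ
    · exact pow_eq_zero_iff two_ne_zero |>.1 h6

/-- If all horizontal sections are translates of each other, the tube lies in a cylinder. -/
theorem subset_cylinder {γ₀ : ℝ → E2} (ht : SymTube c fun _ => γ₀) :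
    ∃ C, IsCentralCylinder C ∧ tubeSet c (fun _ => γ₀) ⊆ C := by
  have h0 : (0 : ℝ) ∈ Ioo (-1 : ℝ) 1 := by simp
  have hov : IsOvalParam γ₀ := ht.oval 0 h0
  obtain ⟨v, hv⟩ := affine_of_deriv_deriv_eq_zero ht.contDiffOn_center
    fun z hz => ht.center_deriv_deriv_eq_zero hz
  let N : E3 →ₗ[ℝ] ℝ := (EuclideanSpace.proj (2 : Fin 3) : E3 →L[ℝ] ℝ).toLinearMap
  have hN : ∀ p z, N (atHeight p z) = z := fun p z => atHeight_two p z
  have hNv : N (atHeight v 1) ≠ 0 := by rw [hN]; exact one_ne_zero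
  set L : E2 →L[ℝ] E3 := liftL.comp (ContinuousLinearMap.inl ℝ E2 ℝ) with hL
  have hLx : ∀ x, L x = atHeight x 0 := fun x => rfl
  have hadd : ∀ p q : E2, ∀ z w : ℝ, atHeight p z + atHeight q w = atHeight (p + q) (z + w) :=
    fun p q z w => (map_add liftL (p, z) (q, w)).symm
  have hsmul : ∀ (a : ℝ) (p : E2) (z : ℝ), a • atHeight p z = atHeight (a • p) (a * z) :=
    fun a p z => (map_smul liftL a (p, z)).symm
  have hneg : ∀ p : E2, ∀ z : ℝ, -atHeight p z = atHeight (-p) (-z) :=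
    fun p z => (map_neg liftL (p, z)).symm
  set P : AffineSubspace ℝ E3 := (LinearMap.ker N).toAffineSubspace with hP
  have hPdir : P.direction = LinearMap.ker N := Submodule.toAffineSubspace_direction _
  refine ⟨_, ⟨P, range fun θ => L (γ₀ θ) + atHeight (c 0) 0, atHeight v 1, ?_, ⟨?_, _,
    hov.comp_affine L (fun x y hxy => (atHeight_injective hxy).1) _, rfl⟩, ?_, ?_, rfl⟩, ?_⟩
  · unfold IsPlane
    rw [hPdir]
    exact finrank_ker_eq_two hNv
  · rintro _ ⟨θ, rfl⟩
    show N (L (γ₀ θ) + atHeight (c 0) 0) = 0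
    rw [hLx, hadd, hN, add_zero]
  · refine ⟨atHeight (c 0) 0, ?_⟩
    rintro _ ⟨θ, rfl⟩
    obtain ⟨θ', hθ'⟩ := ht.symm 0 h0 θ
    refine ⟨θ', ?_⟩
    simp only [hLx, hθ', Equiv.pointReflection_apply, vsub_eq_sub, vadd_eq_add]
    rw [← neg_zero (G := ℝ), ← hneg, neg_zero]
    abel
  · rwa [hPdir, LinearMap.mem_ker]
  · rintro _ ⟨z, hz, θ, rfl⟩
    refine ⟨_, ⟨θ, rfl⟩, z, ?_⟩
    show atHeight (c z + γ₀ θ) z = L (γ₀ θ) + atHeight (c 0) 0 + z • atHeight v 1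
    rw [hLx, hadd, hsmul, hadd, hv z hz]
    congr 1
    · abel
    · ring

/-- Tubes whose horizontal sections have the same support function. -/
theorem subset_cylinder_of_supp_eq {γ : ℝ → ℝ → E2} (ht : SymTube c γ)
    (h : ∀ z ∈ Ioo (-1 : ℝ) 1, ∀ φ, supp (γ z) φ = supp (γ 0) φ) :
    ∃ C, IsCentralCylinder C ∧ tubeSet c γ ⊆ C := by
  have h0 : (0 : ℝ) ∈ Ioo (-1 : ℝ) 1 := by simp
  have hr : ∀ z ∈ Ioo (-1 : ℝ) 1, range (γ z) = range (γ 0) := fun z hz =>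
    Subset.antisymm ((ht.oval z hz).range_subset_of_supp_eq (ht.oval 0 h0) (h z hz))
      ((ht.oval 0 h0).range_subset_of_supp_eq (ht.oval z hz) fun φ => (h z hz φ).symm)
  have hset : tubeSet c γ = tubeSet c fun _ => γ 0 := by
    ext x
    constructor
    · rintro ⟨z, hz, θ, rfl⟩
      obtain ⟨θ', hθ'⟩ : γ z θ ∈ range (γ 0) := hr z hz ▸ ⟨θ, rfl⟩
      exact ⟨z, hz, θ', by simp only [hθ']⟩
    · rintro ⟨z, hz, θ, rfl⟩
      obtain ⟨θ', hθ'⟩ : γ 0 θ ∈ range (γ z) := hr z hz ▸ ⟨θ, rfl⟩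
      exact ⟨z, hz, θ', by simp only [hθ']⟩
  have ht' : SymTube c fun _ => γ 0 := by
    refine ⟨⟨ht.contDiffOn_center, ?_, fun _ _ => ht.oval 0 h0, fun P O hPO => ?_⟩,
      fun _ _ => ht.symm 0 h0⟩
    · exact ((ht.oval 0 h0).contDiff.comp contDiff_snd).contDiffOn
    · rw [← hset] at hPO
      exact ht.central P O hPO
  rw [hset]
  exact ht'.subset_cylinder

end SymTube

/-! ### Elliptic horizontal sections -/

/-- An oval whose squared support function is a quadratic form `A cos² + 2 B cos sin + D sin²` is
the ellipse of the dual form. -/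
theorem IsOvalParam.mem_range_iff_of_supp_sq {γ : ℝ → E2} (h : IsOvalParam γ) {A B D : ℝ}
    (hpos : ∀ φ, 0 < supp γ φ)
    (hs : ∀ φ, supp γ φ ^ 2 =
      A * Real.cos φ ^ 2 + 2 * B * (Real.cos φ * Real.sin φ) + D * Real.sin φ ^ 2) (y : E2) :
    y ∈ range γ ↔ D * y 0 ^ 2 - 2 * B * (y 0 * y 1) + A * y 1 ^ 2 = A * D - B ^ 2 := by
  -- the contact point `p` in the direction `u` satisfies `supp * p = [A, B; B, D] u`
  have hcontact : ∀ φ θ, IsTop γ φ θ →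
      supp γ φ * γ θ 0 = A * Real.cos φ + B * Real.sin φ ∧
      supp γ φ * γ θ 1 = B * Real.cos φ + D * Real.sin φ := by
    intro φ θ hθ
    have h1 := (h.hasDerivAt_supp hθ).pow 2
    have hc := Real.hasDerivAt_cos φ
    have hsin := Real.hasDerivAt_sin φ
    have h2 := (((hc.pow 2).const_mul A).add ((hc.mul hsin).const_mul (2 * B))).add
      ((hsin.pow 2).const_mul D)
    have h3 := h1.unique (h2.congr_of_eventuallyEq (Eventually.of_forall hs))
    have h4 := hs φ
    have h5 := hθ.supp_eq h.periodic
    rw [heightIn_apply] at h5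
    simp only [heightIn_apply, Real.cos_add_pi_div_two, Real.sin_add_pi_div_two] at h3
    norm_num at h3
    have hone := Real.sin_sq_add_cos_sq φ
    set H := supp γ φ
    set C := Real.cos φ
    set S := Real.sin φ
    constructor
    · linear_combination C * h4 - S / 2 * h3 - H * C * h5 - H * γ θ 0 * hone +
        (A * C + B * S) * hone
    · linear_combination S * h4 + C / 2 * h3 - H * S * h5 - H * γ θ 1 * hone +
        (B * C + D * S) * hone
  have hA : 0 < A := by
    have := pow_pos (hpos 0) 2
    rw [hs] at this
    simpa using this
  have hpolar : ∀ u v : ℝ, (u ≠ 0 ∨ v ≠ 0) →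
      ∃ n > 0, ∃ φ, n * Real.cos φ = u ∧ n * Real.sin φ = v := by
    intro u v huv
    refine ⟨‖(⟨u, v⟩ : ℂ)‖, ?_, Complex.arg ⟨u, v⟩, Complex.norm_mul_cos_arg _,
      Complex.norm_mul_sin_arg _⟩
    refine norm_pos_iff.2 fun h0 => ?_
    have h1 := congrArg Complex.re h0
    have h2 := congrArg Complex.im h0
    simp at h1 h2
    tauto
  have hdet : 0 < A * D - B ^ 2 := by
    obtain ⟨n, hn, φ, hc, hsn⟩ := hpolar (-B) A (Or.inr hA.ne')
    have h1 : n ^ 2 * supp γ φ ^ 2 = A * (A * D - B ^ 2) := by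
      rw [hs]
      calc _ = A * (n * Real.cos φ) ^ 2 + 2 * B * ((n * Real.cos φ) * (n * Real.sin φ)) +
            D * (n * Real.sin φ) ^ 2 := by ring
        _ = _ := by rw [hc, hsn]; ring
    have h2 : 0 < A * (A * D - B ^ 2) := by
      rw [← h1]
      have := hpos φ
      positivity
    exact (pos_iff_pos_of_mul_pos h2).1 hA
  have hon : ∀ φ θ, IsTop γ φ θ →
      D * γ θ 0 ^ 2 - 2 * B * (γ θ 0 * γ θ 1) + A * γ θ 1 ^ 2 = A * D - B ^ 2 := by
    intro φ θ hθ
    obtain ⟨h1, h2⟩ := hcontact φ θ hθ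
    have h3 := hs φ
    have hp := hpos φ
    refine mul_left_cancel₀ (pow_ne_zero 2 hp.ne') ?_
    calc _ = D * (supp γ φ * γ θ 0) ^ 2 - 2 * B * ((supp γ φ * γ θ 0) * (supp γ φ * γ θ 1)) +
          A * (supp γ φ * γ θ 1) ^ 2 := by ring
      _ = _ := by rw [h1, h2, h3]; ring
  constructor
  · rintro ⟨t, rfl⟩
    obtain ⟨φ, hφ⟩ := h.exists_heightIn_lt t
    refine hon φ t fun s => ?_
    by_cases hs : γ s = γ t
    · rw [hs]
    · exact (hφ s hs).le
  · intro hy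
    obtain ⟨n, hn, φ, hc, hsn⟩ := hpolar (D * y 0 - B * y 1) (-B * y 0 + A * y 1) (by
      by_contra! h0
      obtain ⟨h1, h2⟩ := h0
      have : D * y 0 ^ 2 - 2 * B * (y 0 * y 1) + A * y 1 ^ 2 = 0 := by
        linear_combination y 0 * h1 + y 1 * h2
      linarith)
    obtain ⟨θ, -, hθ⟩ := exists_isTop h.contDiff.continuous h.periodic φ
    obtain ⟨h1, h2⟩ := hcontact φ θ hθ
    have h3 := hon φ θ hθ
    have hp := hpos φ
    set H := supp γ φ
    have h4 : n * H * γ θ 0 = (A * D - B ^ 2) * y 0 := by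
      linear_combination n * h1 + A * hc + B * hsn
    have h5 : n * H * γ θ 1 = (A * D - B ^ 2) * y 1 := by
      linear_combination n * h2 + B * hc + D * hsn
    have h6 : n * H = A * D - B ^ 2 := by
      have : (n * H) ^ 2 * (A * D - B ^ 2) = (A * D - B ^ 2) ^ 2 * (A * D - B ^ 2) := by
        calc _ = (n * H) ^ 2 *
              (D * γ θ 0 ^ 2 - 2 * B * (γ θ 0 * γ θ 1) + A * γ θ 1 ^ 2) := by rw [h3]
          _ = D * (n * H * γ θ 0) ^ 2 - 2 * B * ((n * H * γ θ 0) * (n * H * γ θ 1)) +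
              A * (n * H * γ θ 1) ^ 2 := by ring
          _ = (A * D - B ^ 2) ^ 2 *
              (D * y 0 ^ 2 - 2 * B * (y 0 * y 1) + A * y 1 ^ 2) := by rw [h4, h5]; ring
          _ = _ := by rw [hy]
      exact (pow_left_inj₀ (by positivity) hdet.le two_ne_zero).1
        (mul_right_cancel₀ hdet.ne' this)
    rw [h6] at h4 h5
    refine ⟨θ, ?_⟩
    ext i
    fin_cases i
    · exact mul_left_cancel₀ hdet.ne' h4
    · exact mul_left_cancel₀ hdet.ne' h5

/-- A tube with central sections whose horizontal sections are the circles of squared radius `R`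
in the linear coordinates `ℓ₁`, `ℓ₂`. -/
structure RoundTube (c : ℝ → E2) (γ : ℝ → ℝ → E2) (ℓ₁ ℓ₂ : E2 →L[ℝ] ℝ) (R : ℝ → ℝ) : Prop
    extends CPOTube c γ where
  surjective : ∀ a b, ∃ y, ℓ₁ y = a ∧ ℓ₂ y = b
  contDiffOn_sqRadius : ContDiffOn ℝ 2 R (Ioo (-1) 1)
  sqRadius_pos : ∀ z ∈ Ioo (-1 : ℝ) 1, 0 < R z
  mem_range_iff : ∀ z ∈ Ioo (-1 : ℝ) 1, ∀ y, y ∈ range (γ z) ↔ ℓ₁ y ^ 2 + ℓ₂ y ^ 2 = R z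

/-- Tubes whose squared support functions are proportional quadratic forms have circular sections in
the coordinates `ℓ₁`, `ℓ₂` that diagonalize the dual form, by completion of the square. -/
theorem SymTube.exists_roundTube {c : ℝ → E2} {γ : ℝ → ℝ → E2} (ht : SymTube c γ) {α β δ : ℝ}
    (h : ∀ z ∈ Ioo (-1 : ℝ) 1, ∃ G > 0, ∀ φ, supp (γ z) φ ^ 2 =
      G * (α * Real.cos φ ^ 2 + 2 * β * (Real.cos φ * Real.sin φ) + δ * Real.sin φ ^ 2)) :
    ∃ ℓ₁ ℓ₂ R, RoundTube c γ ℓ₁ ℓ₂ R := by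
  have hmem : ∀ z ∈ Ioo (-1 : ℝ) 1, ∃ G > 0, 0 < G * α ∧ ∀ y, y ∈ range (γ z) ↔
      G * (δ * y 0 ^ 2 - 2 * β * (y 0 * y 1) + α * y 1 ^ 2) = G ^ 2 * (α * δ - β ^ 2) := by
    intro z hz
    obtain ⟨G, hG, hsq⟩ := h z hz
    refine ⟨G, hG, ?_, fun y => ?_⟩
    · have := pow_pos (ht.supp_pos hz 0) 2
      rw [hsq] at this
      simpa using this
    · rw [(ht.oval z hz).mem_range_iff_of_supp_sq (A := G * α) (B := G * β) (D := G * δ)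
        (ht.supp_pos hz) (fun φ => by rw [hsq]; ring)]
      constructor <;> intro h <;> linear_combination h
  have h0 : (0 : ℝ) ∈ Ioo (-1 : ℝ) 1 := by simp
  have hα : 0 < α := by
    obtain ⟨G, hG, hGα, -⟩ := hmem 0 h0
    exact (pos_iff_pos_of_mul_pos hGα).1 hG
  have hdet : 0 < α * δ - β ^ 2 := by
    obtain ⟨G, hG, -, -⟩ := hmem 0 h0
    obtain ⟨G, hG, hsq⟩ := h 0 h0
    set w : ℂ := ⟨-β, α⟩ with hw
    have h1 := Complex.norm_mul_cos_arg w
    have h2 := Complex.norm_mul_sin_arg w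
    have h3 := pow_pos (ht.supp_pos h0 w.arg) 2
    have hn : 0 < ‖w‖ := by
      rw [norm_pos_iff]
      intro h4
      have := congrArg Complex.im h4
      simp [hw] at this
      exact hα.ne' this
    have h4 : 0 < ‖w‖ ^ 2 * supp (γ 0) w.arg ^ 2 := by positivity
    have h5 : ‖w‖ ^ 2 * supp (γ 0) w.arg ^ 2 = G * α * (α * δ - β ^ 2) := by
      rw [hsq]
      calc _ = G * (α * (‖w‖ * Real.cos w.arg) ^ 2 + 2 * β * ((‖w‖ * Real.cos w.arg) *
            (‖w‖ * Real.sin w.arg)) + δ * (‖w‖ * Real.sin w.arg) ^ 2) := by ring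
        _ = _ := by rw [h1, h2]; simp only [hw]; ring
    rw [h5] at h4
    exact (pos_iff_pos_of_mul_pos h4).1 (by positivity)
  set r := Real.sqrt α with hr
  set s := Real.sqrt (α * (α * δ - β ^ 2)) with hs
  have hr0 : 0 < r := Real.sqrt_pos.2 hα
  have hs0 : 0 < s := Real.sqrt_pos.2 (by positivity)
  have hr2 : r ^ 2 = α := Real.sq_sqrt hα.le
  have hs2 : s ^ 2 = α * (α * δ - β ^ 2) := Real.sq_sqrt (by positivity)
  set ℓ₁ : E2 →L[ℝ] ℝ := r⁻¹ • EuclideanSpace.proj 0 with hℓ₁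
  set ℓ₂ : E2 →L[ℝ] ℝ := s⁻¹ • (α • EuclideanSpace.proj 1 - β • EuclideanSpace.proj 0) with hℓ₂
  have e1 : ∀ y, ℓ₁ y = r⁻¹ * y 0 := fun y => by simp [hℓ₁]
  have e2 : ∀ y, ℓ₂ y = s⁻¹ * (α * y 1 - β * y 0) := fun y => by simp [hℓ₂]
  have e3 : ∀ y, ℓ₁ y ^ 2 + ℓ₂ y ^ 2 =
      (δ * y 0 ^ 2 - 2 * β * (y 0 * y 1) + α * y 1 ^ 2) / (α * δ - β ^ 2) := by
    intro y
    rw [e1, e2, mul_pow, mul_pow, inv_pow, inv_pow, hr2, hs2]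
    field_simp
    ring
  have hmem' : ∀ z ∈ Ioo (-1 : ℝ) 1, ∃ G > 0, ∀ y, y ∈ range (γ z) ↔
      ℓ₁ y ^ 2 + ℓ₂ y ^ 2 = G := by
    intro z hz
    obtain ⟨G, hG, -, hy⟩ := hmem z hz
    refine ⟨G, hG, fun y => ?_⟩
    rw [hy, e3, div_eq_iff hdet.ne', pow_two G, mul_assoc G G]
    exact mul_right_inj' hG.ne'
  have hR : ∀ z ∈ Ioo (-1 : ℝ) 1, ∀ y, y ∈ range (γ z) ↔
      ℓ₁ y ^ 2 + ℓ₂ y ^ 2 = ℓ₁ (γ z 0) ^ 2 + ℓ₂ (γ z 0) ^ 2 := by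
    intro z hz y
    obtain ⟨G, -, hG⟩ := hmem' z hz
    rw [hG, (hG (γ z 0)).1 ⟨0, rfl⟩]
  have hγ0 : ContDiffOn ℝ 2 (fun z => γ z 0) (Ioo (-1) 1) :=
    ht.contDiffOn.comp (contDiff_id.prodMk contDiff_const).contDiffOn fun z hz => ⟨hz, mem_univ _⟩
  refine ⟨ℓ₁, ℓ₂, fun z => ℓ₁ (γ z 0) ^ 2 + ℓ₂ (γ z 0) ^ 2, ht.toCPOTube, fun a b => ?_, ?_, ?_, hR⟩
  · refine ⟨!₂[r * a, (s * b + β * (r * a)) / α], ?_, ?_⟩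
    · rw [e1]
      simp
      field_simp
    · rw [e2]
      simp
      field_simp
      ring
  · exact ((ℓ₁.contDiff.comp_contDiffOn hγ0).pow 2).add ((ℓ₂.contDiff.comp_contDiffOn hγ0).pow 2)
  · intro z hz
    obtain ⟨G, hG0, hG⟩ := hmem' z hz
    rwa [← (hG (γ z 0)).1 ⟨0, rfl⟩] at hG0

/-! ### Centers and radii of elliptic sections -/

/-- A continuous function that is locally even about each point of an interval cannot increase: at
the first point where it exceeds a level, it stays below the level on the left, hence, by
reflection, also on the right. -/
theorem le_of_forall_eventually_reflect {g : ℝ → ℝ} {I : Set ℝ} (hI : IsOpen I)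
    (hg : ContinuousOn g I) (h : ∀ z ∈ I, ∀ᶠ t in 𝓝 z, g t = g (2 * z - t)) {a b : ℝ}
    (hab : a ≤ b) (hsub : Icc a b ⊆ I) : g b ≤ g a := by
  by_contra! hlt
  obtain ⟨y, hay, hyb⟩ := exists_between hlt
  have hgat : ∀ z ∈ Icc a b, ContinuousAt g z := fun z hz => hg.continuousAt (hI.mem_nhds (hsub hz))
  set S : Set ℝ := {x | x ∈ Icc a b ∧ y < g x} with hS
  have hbS : b ∈ S := ⟨right_mem_Icc.2 hab, hyb⟩
  have hbdd : BddBelow S := ⟨a, fun x hx => hx.1.1⟩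
  set c := sInf S with hc
  have hcb : c ≤ b := csInf_le hbdd hbS
  have hleft : ∀ x, a ≤ x → x < c → g x ≤ y := fun x hax hxc => by
    by_contra! hx
    exact notMem_of_lt_csInf hxc hbdd ⟨⟨hax, hxc.le.trans hcb⟩, hx⟩
  have hac : a < c := by
    obtain ⟨r, hr, hball⟩ := Metric.eventually_nhds_iff.1
      ((hgat a (left_mem_Icc.2 hab)).eventually_lt_const hay)
    have : a + r ≤ c := by
      refine le_csInf ⟨b, hbS⟩ fun x hx => ?_
      by_contra! hxr
      refine lt_asymm hx.2 (hball ?_)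
      rw [Real.dist_eq, abs_of_nonneg (sub_nonneg.2 hx.1.1)]
      linarith
    linarith
  have hcI : c ∈ Icc a b := ⟨hac.le, hcb⟩
  have hgc : g c ≤ y := by
    by_contra! hyc
    obtain ⟨r, hr, hball⟩ := Metric.eventually_nhds_iff.1
      ((hgat c hcI).eventually_const_lt hyc)
    have hx : max a (c - r / 2) < c := max_lt hac (by linarith)
    refine (hleft _ (le_max_left _ _) hx).not_gt (hball ?_)
    rw [Real.dist_eq, abs_sub_comm, abs_of_pos (sub_pos.2 hx)]
    have := le_max_right a (c - r / 2)
    linarith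
  obtain ⟨r, hr, hball⟩ := Metric.eventually_nhds_iff.1 (h c (hsub hcI))
  obtain ⟨x, hxS, hx⟩ := exists_lt_of_csInf_lt ⟨b, hbS⟩
    (show sInf S < c + min r (c - a) from lt_add_of_pos_right _ (lt_min hr (sub_pos.2 hac)))
  have hcx : c ≤ x := csInf_le hbdd hxS
  have hne : c ≠ x := fun he => (he ▸ hgc).not_gt hxS.2
  have hcx' : c < x := lt_of_le_of_ne hcx hne
  have h1 := min_le_left r (c - a)
  have h2 := min_le_right r (c - a)
  have h3 := hball (y := x) (by rw [Real.dist_eq, abs_of_pos (sub_pos.2 hcx')]; linarith)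
  have h4 := hleft (2 * c - x) (by linarith) (by linarith)
  rw [← h3] at h4
  exact h4.not_gt hxS.2

/-- A continuous function that is locally even about each point of an interval is constant. -/
theorem eq_of_forall_eventually_reflect {g : ℝ → ℝ} {I : Set ℝ} (hI : IsOpen I)
    (hIc : I.OrdConnected) (hg : ContinuousOn g I)
    (h : ∀ z ∈ I, ∀ᶠ t in 𝓝 z, g t = g (2 * z - t)) {a b : ℝ} (ha : a ∈ I) (hb : b ∈ I) :
    g a = g b := by
  wlog hab : a ≤ b generalizing a b
  · exact (this hb ha (le_of_not_ge hab)).symm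
  refine le_antisymm ?_ (le_of_forall_eventually_reflect hI hg h hab (hIc.out ha hb))
  have := le_of_forall_eventually_reflect hI hg.neg (g := -g) (fun z hz => by
    filter_upwards [h z hz] with t ht
    simp only [Pi.neg_apply, ht]) hab (hIc.out ha hb)
  simpa using this

theorem deriv_deriv_comp_const_sub (f : ℝ → ℝ) (a : ℝ) :
    deriv (deriv fun t => f (a - t)) = fun t => deriv (deriv f) (a - t) := by
  have h : ∀ f : ℝ → ℝ, (deriv fun t => f (a - t)) = fun t => -deriv f (a - t) :=
    fun f => funext fun t => deriv_comp_const_sub _ _ _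
  rw [h]
  funext t
  rw [deriv.fun_neg, deriv_comp_const_sub, neg_neg]

/-- A `C²` function that differs, locally around each point, from an even function by a linear
one is quadratic. -/
theorem quadratic_of_forall_eventually_reflect {R : ℝ → ℝ} (hR : ContDiffOn ℝ 2 R (Ioo (-1) 1))
    (h : ∀ z ∈ Ioo (-1 : ℝ) 1, ∀ᶠ t in 𝓝 z, R t - R (2 * z - t) = 2 * (t - z) * deriv R z) :
    ∃ a b d : ℝ, ∀ z ∈ Ioo (-1 : ℝ) 1, R z = a * z ^ 2 + b * z + d := by
  have hR1 : ContDiffOn ℝ 1 (deriv R) (Ioo (-1) 1) :=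
    hR.deriv_of_isOpen isOpen_Ioo (by norm_num [one_add_one_eq_two])
  have hR2 : ContinuousOn (deriv (deriv R)) (Ioo (-1) 1) :=
    (hR1.deriv_of_isOpen (m := 0) isOpen_Ioo (by norm_num)).continuousOn
  have hd : ∀ z ∈ Ioo (-1 : ℝ) 1, DifferentiableAt ℝ R z := fun z hz =>
    (hR.contDiffAt (isOpen_Ioo.mem_nhds hz)).differentiableAt two_ne_zero
  have hd1 : ∀ z ∈ Ioo (-1 : ℝ) 1, DifferentiableAt ℝ (deriv R) z := fun z hz =>
    (hR1.contDiffAt (isOpen_Ioo.mem_nhds hz)).differentiableAt one_ne_zero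
  have hrefl : ∀ z ∈ Ioo (-1 : ℝ) 1, ∀ᶠ t in 𝓝 z,
      deriv (deriv R) t = deriv (deriv R) (2 * z - t) := by
    intro z hz
    set k := deriv R z
    have h1 : (fun t => R t - k * t) =ᶠ[𝓝 z] fun t => (fun t => R t - k * t) (2 * z - t) := by
      filter_upwards [h z hz] with t ht
      linear_combination ht
    have h2 := h1.deriv.deriv
    rw [deriv_deriv_comp_const_sub (fun t => R t - k * t)] at h2
    have h5 : ∀ w ∈ Ioo (-1 : ℝ) 1, deriv (deriv fun t => R t - k * t) w =
        deriv (deriv R) w := by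
      intro w hw
      have h6 : (deriv fun t => R t - k * t) =ᶠ[𝓝 w] fun t => deriv R t - k := by
        filter_upwards [isOpen_Ioo.mem_nhds hw] with t ht
        have := ((hd t ht).hasDerivAt.sub ((hasDerivAt_id t).const_mul k)).deriv
        rw [mul_one] at this
        exact this
      rw [h6.deriv_eq, deriv_sub_const]
    have h7 : ∀ᶠ t in 𝓝 z, 2 * z - t ∈ Ioo (-1 : ℝ) 1 := by
      have hc : ContinuousAt (fun t : ℝ => 2 * z - t) z := by fun_prop
      exact hc.eventually_mem (isOpen_Ioo.mem_nhds (by convert hz using 1; ring))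
    filter_upwards [h2, h7, isOpen_Ioo.mem_nhds hz] with t h8 h9 h10
    rw [← h5 t h10, h8, h5 _ h9]
  set k := deriv (deriv R) 0 with hk
  have h0 : (0 : ℝ) ∈ Ioo (-1 : ℝ) 1 := by simp
  have hconst : ∀ z ∈ Ioo (-1 : ℝ) 1, deriv (deriv R) z = k := fun z hz =>
    eq_of_forall_eventually_reflect isOpen_Ioo ordConnected_Ioo hR2 hrefl hz h0
  obtain ⟨v, hv⟩ := affine_of_deriv_deriv_eq_zero (f := fun z => R z - k / 2 * z ^ 2)
    (hR.sub (by fun_prop)) fun z hz => by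
      have h6 : (deriv fun t => R t - k / 2 * t ^ 2) =ᶠ[𝓝 z] fun t => deriv R t - k * t := by
        filter_upwards [isOpen_Ioo.mem_nhds hz] with t ht
        have := ((hd t ht).hasDerivAt.sub (((hasDerivAt_id t).pow 2).const_mul (k / 2))).deriv
        simp only [id] at this
        refine Eq.trans this ?_
        push_cast
        ring
      rw [h6.deriv_eq]
      have := ((hd1 z hz).hasDerivAt.sub ((hasDerivAt_id z).const_mul k)).deriv
      refine Eq.trans this ?_
      rw [hconst z hz]
      ring
  refine ⟨k / 2, v, R 0, fun z hz => ?_⟩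
  have := hv z hz
  simp only [smul_eq_mul] at this
  linear_combination this

namespace RoundTube
variable {c : ℝ → E2} {γ : ℝ → ℝ → E2} {ℓ₁ ℓ₂ : E2 →L[ℝ] ℝ} {R : ℝ → ℝ}

theorem swap (ht : RoundTube c γ ℓ₁ ℓ₂ R) : RoundTube c γ ℓ₂ ℓ₁ R :=
  ⟨ht.toCPOTube, fun a b => (ht.surjective b a).imp fun _ h => h.symm, ht.contDiffOn_sqRadius,
    ht.sqRadius_pos, fun z hz y => by rw [ht.mem_range_iff z hz, add_comm]⟩

/-- The plane `z = z₀ + ε (ℓ₁ x + κ z + d) + ε² b` meets the disk at height `z` in a chord, on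
which `ℓ₁` relative to the center is `σ z = (z - z₀ - ε² b) / ε - (ℓ₁ (c z) + κ z + d)`. The
half-length of the chord squared is `R - σ²`, and `c z` is the midpoint of the chord with respect
to `ℓ₂`. A section that is symmetric about a point at height `h` has chords of equal length at
heights `z` and `2 h - z`, and the sum of their midpoints is constant. -/
theorem exists_reflection (ht : RoundTube c γ ℓ₁ ℓ₂ R) {z₀ : ℝ} (hz₀ : z₀ ∈ Ioo (-1 : ℝ) 1)
    (κ d b : ℝ) (hd : ℓ₁ (c z₀) + κ * z₀ + d = 0) {r : ℝ} (hr : 0 < r) :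
    ∀ᶠ ε in 𝓝[≠] (0 : ℝ), ∃ h k, |2 * h - z₀ - z₀| < r ∧ ∀ᶠ z in 𝓝 z₀,
      R (2 * h - z) - ((2 * h - z - z₀ - ε ^ 2 * b) / ε -
          (ℓ₁ (c (2 * h - z)) + κ * (2 * h - z) + d)) ^ 2 =
        R z - ((z - z₀ - ε ^ 2 * b) / ε - (ℓ₁ (c z) + κ * z + d)) ^ 2 ∧
      ℓ₂ (c z) + ℓ₂ (c (2 * h - z)) = k := by
  obtain ⟨δ, hδ, ρ, hρ, ζ, hsub, hζc, hζ, hcen⟩ := ht.exists_central_section hz₀ ℓ₁ κ d b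
  set J : Set ℝ := Ioo (-δ) δ with hJ
  have hJo : IsOpen J := isOpen_Ioo
  have h0J : (0 : ℝ) ∈ J := ⟨by linarith, hδ⟩
  have hRz := ht.sqRadius_pos z₀ hz₀
  have hnear : ∀ᶠ ε in 𝓝 (0 : ℝ), ∀ θ ∈ circleDomain, |ζ ε θ - z₀| < r := by
    refine isCompact_circleDomain.eventually_forall_of_forall_eventually fun θ _ => ?_
    have hc : ContinuousAt (fun q : ℝ × ℝ => |ζ q.1 q.2 - z₀|) (0, θ) :=
      ((hζc.continuousOn.continuousAt
        ((hJo.prod isOpen_univ).mem_nhds ⟨h0J, mem_univ θ⟩)).sub continuousAt_const).abs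
    refine hc.eventually_lt_const ?_
    have : ζ 0 θ = z₀ := by simpa using (hζ 0 h0J θ).2.1
    simpa [this] using hr
  have hbsmall : ∀ᶠ ε in 𝓝 (0 : ℝ), (ε * b) ^ 2 < R z₀ := by
    have hc : ContinuousAt (fun ε : ℝ => (ε * b) ^ 2) 0 := by fun_prop
    exact hc.eventually_lt_const (by simpa using hRz)
  filter_upwards [nhdsWithin_le_nhds hnear, nhdsWithin_le_nhds hbsmall,
    nhdsWithin_le_nhds (hJo.mem_nhds h0J), self_mem_nhdsWithin] with ε hnear hbsmall hεJ hε
  replace hε : ε ≠ 0 := hε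
  set σ : ℝ → ℝ := fun z => (z - z₀ - ε ^ 2 * b) / ε - (ℓ₁ (c z) + κ * z + d) with hσ
  obtain ⟨m, h, hm⟩ := hcen ε hεJ
  have hplane : ∀ z y, ℓ₁ y = σ z ↔ z = z₀ + ε * (ℓ₁ (c z + y) + κ * z + d) + ε ^ 2 * b := by
    intro z y
    rw [map_add]
    simp only [hσ]
    constructor
    · intro h1
      rw [h1]
      field_simp
      ring
    · intro h1
      rw [eq_sub_iff_add_eq, eq_div_iff hε]
      linear_combination -h1
  -- the reflection maps the point `y` of the section at height `z` to the height `2 h - z`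
  have hpoint : ∀ z ∈ Ioo (z₀ - ρ) (z₀ + ρ), ∀ y, ℓ₁ y = σ z → ℓ₁ y ^ 2 + ℓ₂ y ^ 2 = R z →
      |2 * h - z - z₀| < r ∧
      (2 * ℓ₂ m - ℓ₂ (c z) - ℓ₂ (c (2 * h - z)) - ℓ₂ y) ^ 2 =
        R (2 * h - z) - σ (2 * h - z) ^ 2 := by
    intro z hz y hy1 hy2
    obtain ⟨θ, rfl⟩ := (ht.mem_range_iff z (hsub hz) y).2 hy2
    have hzθ := (hζ ε hεJ θ).2.2 z hz ((hplane _ _).1 hy1)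
    obtain ⟨θ', h1, h2⟩ := hm θ
    obtain ⟨hI', h3, -⟩ := hζ ε hεJ θ'
    rw [← hzθ] at h1 h2
    rw [h2] at h1 h3 hI'
    have h4 : γ (2 * h - z) θ' = (2 : ℝ) • m - (c z + γ z θ) - c (2 * h - z) := by
      rw [← h1]; abel
    have h5 := (ht.mem_range_iff _ (hsub hI') _).1 ⟨θ', rfl⟩
    have h6 := (hplane _ _).2 h3
    refine ⟨?_, ?_⟩
    · obtain ⟨θ'', hθ'', he⟩ := (ht.oval _ (hsub hI')).exists_mem_Icc θ'
      rw [← he] at h3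
      rw [(hζ ε hεJ θ'').2.2 _ hI' h3]
      exact hnear θ'' hθ''
    · rw [← h5, h6, h4]
      simp only [map_sub, map_add, map_smul, smul_eq_mul]
      ring
  have hchord : ∀ z ∈ Ioo (z₀ - ρ) (z₀ + ρ), 0 < R z - σ z ^ 2 → |2 * h - z - z₀| < r ∧
      R (2 * h - z) - σ (2 * h - z) ^ 2 = R z - σ z ^ 2 ∧
      ℓ₂ (c z) + ℓ₂ (c (2 * h - z)) = 2 * ℓ₂ m := by
    intro z hz hpos
    set q := Real.sqrt (R z - σ z ^ 2) with hq
    have hq0 : 0 < q := Real.sqrt_pos.2 hpos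
    have hq2 : q ^ 2 = R z - σ z ^ 2 := Real.sq_sqrt hpos.le
    obtain ⟨y, hy1, hy2⟩ := ht.surjective (σ z) q
    obtain ⟨y', hy1', hy2'⟩ := ht.surjective (σ z) (-q)
    obtain ⟨h1, h2⟩ := hpoint z hz y hy1 (by rw [hy1, hy2, hq2]; ring)
    obtain ⟨-, h3⟩ := hpoint z hz y' hy1' (by rw [hy1', hy2', neg_sq, hq2]; ring)
    rw [hy2] at h2
    rw [hy2'] at h3
    have h4 : 2 * ℓ₂ m - ℓ₂ (c z) - ℓ₂ (c (2 * h - z)) = 0 := by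
      refine mul_left_cancel₀ hq0.ne' ?_
      linear_combination (h3 - h2) / 4
    refine ⟨h1, ?_, by linarith⟩
    rw [← h2, h4, zero_sub, neg_sq, hq2]
  have hz₀ρ : z₀ ∈ Ioo (z₀ - ρ) (z₀ + ρ) := ⟨by linarith, by linarith⟩
  have hσ0 : σ z₀ = -(ε * b) := by
    simp only [hσ, hd]
    field_simp
    ring
  have hpos0 : 0 < R z₀ - σ z₀ ^ 2 := by
    rw [hσ0, neg_sq]
    linarith
  refine ⟨h, 2 * ℓ₂ m, (hchord z₀ hz₀ρ hpos0).1, ?_⟩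
  have hcont : ContinuousAt (fun z => R z - σ z ^ 2) z₀ := by
    have h1 := ht.contDiffOn_sqRadius.continuousOn.continuousAt (isOpen_Ioo.mem_nhds hz₀)
    have h2 := ht.contDiffOn_center.continuousOn.continuousAt (isOpen_Ioo.mem_nhds hz₀)
    simp only [hσ]
    fun_prop (disch := assumption)
  filter_upwards [hcont.eventually_const_lt hpos0, isOpen_Ioo.mem_nhds hz₀ρ] with z h1 h2
  exact (hchord z h2 h1).2

/-- The center `c z` of a circular section is affine in the coordinate `ℓ₂`: let `ε → 0` in the
relation between the midpoints of the chords, differentiated twice at `z₀`. -/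
theorem deriv_deriv_center_eq_zero (ht : RoundTube c γ ℓ₁ ℓ₂ R) {z₀ : ℝ}
    (hz₀ : z₀ ∈ Ioo (-1 : ℝ) 1) : deriv (deriv fun z => ℓ₂ (c z)) z₀ = 0 := by
  have hf : ContDiffOn ℝ 2 (fun z => ℓ₂ (c z)) (Ioo (-1) 1) :=
    ℓ₂.contDiff.comp_contDiffOn ht.contDiffOn_center
  have hg : ContinuousAt (deriv (deriv fun z => ℓ₂ (c z))) z₀ :=
    ((hf.deriv_of_isOpen (m := 1) isOpen_Ioo (by norm_num [one_add_one_eq_two])).deriv_of_isOpen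
      (m := 0) isOpen_Ioo (by norm_num)).continuousOn.continuousAt (isOpen_Ioo.mem_nhds hz₀)
  by_contra hne
  obtain ⟨r, hr, hball⟩ := Metric.continuousAt_iff.1 hg _ (abs_pos.2 hne)
  obtain ⟨ε, h, k, hh, hev⟩ := (ht.exists_reflection hz₀ 0 (-ℓ₁ (c z₀)) 0 (by ring) hr).exists
  have h1 : (fun z => ℓ₂ (c z)) =ᶠ[𝓝 z₀] fun z => k - (fun z => ℓ₂ (c z)) (2 * h - z) := by
    filter_upwards [hev] with z hz
    linarith [hz.2]
  have h2 := h1.deriv.deriv_eq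
  have h4 : (deriv fun z => k - ℓ₂ (c (2 * h - z))) =
      fun z => -(deriv fun z => ℓ₂ (c (2 * h - z))) z := funext fun z => deriv_const_sub k
  rw [h4, deriv.fun_neg, deriv_deriv_comp_const_sub (fun z => ℓ₂ (c z))] at h2
  have h3 := hball (x := 2 * h - z₀) (by rwa [Real.dist_eq])
  rw [h2, Real.dist_eq, abs_neg] at h3
  set g := deriv (deriv fun z => ℓ₂ (c z)) (2 * h - z₀)
  rw [sub_neg_eq_add, ← two_mul, abs_mul, abs_two] at h3
  linarith [abs_nonneg g]

/-- If the centers lie on a line, planes with `h = z₀` exist close to every horizontal plane, and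
yield a symmetry of the squared radius, up to a linear term. -/
theorem eventually_sqRadius_reflect (ht : RoundTube c γ ℓ₁ ℓ₂ R) {v : ℝ}
    (hv : ∀ z ∈ Ioo (-1 : ℝ) 1, ℓ₁ (c z) = ℓ₁ (c 0) + z * v) {z₀ : ℝ}
    (hz₀ : z₀ ∈ Ioo (-1 : ℝ) 1) :
    ∀ᶠ z in 𝓝 z₀, R z - R (2 * z₀ - z) = 2 * (z - z₀) * deriv R z₀ := by
  have hR1 : ContDiffAt ℝ 1 (deriv R) z₀ :=
    (ht.contDiffOn_sqRadius.deriv_of_isOpen isOpen_Ioo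
      (by norm_num [one_add_one_eq_two])).contDiffAt (isOpen_Ioo.mem_nhds hz₀)
  obtain ⟨K, U, hU, hK⟩ := hR1.exists_lipschitzOnWith
  obtain ⟨r₁, hr₁, hball₁⟩ := Metric.mem_nhds_iff.1 hU
  obtain ⟨r₂, hr₂, hball₂⟩ := Metric.mem_nhds_iff.1 (isOpen_Ioo.mem_nhds hz₀)
  -- with this `b`, the squared half-length `F` of the chords has a critical point at `z₀`
  set b := -deriv R z₀ / 2 with hb
  have hKε : ∀ᶠ ε in 𝓝[≠] (0 : ℝ), (K : ℝ) * ε ^ 2 < 2 := by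
    have hc : ContinuousAt (fun ε : ℝ => (K : ℝ) * ε ^ 2) 0 := by fun_prop
    exact nhdsWithin_le_nhds (hc.eventually_lt_const (by simp))
  obtain ⟨ε, ⟨⟨h, k, hh, hev⟩, hKε⟩, hε⟩ :=
    (((ht.exists_reflection hz₀ (-v) (-ℓ₁ (c 0)) b (by rw [hv z₀ hz₀]; ring)
      (lt_min hr₁ hr₂)).and hKε).and self_mem_nhdsWithin).exists
  replace hε : ε ≠ 0 := hε
  set w := 2 * h - z₀ with hw
  have hw1 : w ∈ U := hball₁ (by
    rw [Metric.mem_ball, Real.dist_eq]; exact hh.trans_le (min_le_left _ _))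
  have hw2 : w ∈ Ioo (-1 : ℝ) 1 := hball₂ (by
    rw [Metric.mem_ball, Real.dist_eq]; exact hh.trans_le (min_le_right _ _))
  set F : ℝ → ℝ := fun z => R z - ((z - z₀ - ε ^ 2 * b) / ε) ^ 2 with hF
  have hFd : ∀ z ∈ Ioo (-1 : ℝ) 1,
      HasDerivAt F (deriv R z - 2 * ((z - z₀ - ε ^ 2 * b) / ε ^ 2)) z := by
    intro z hz
    have h1 := ((ht.contDiffOn_sqRadius.contDiffAt
      (isOpen_Ioo.mem_nhds hz)).differentiableAt two_ne_zero).hasDerivAt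
    have h2 := ((((hasDerivAt_id z).sub_const z₀).sub_const (ε ^ 2 * b)).div_const ε).pow 2
    refine (h1.sub h2).congr_deriv ?_
    simp only [id]
    push_cast
    field_simp
  have hrefl : ∀ᶠ z in 𝓝 z₀, F (2 * h - z) = F z := by
    have h7 : ∀ᶠ z in 𝓝 z₀, 2 * h - z ∈ Ioo (-1 : ℝ) 1 := by
      have hc : ContinuousAt (fun t : ℝ => 2 * h - t) z₀ := by fun_prop
      exact hc.eventually_mem (isOpen_Ioo.mem_nhds hw2)
    filter_upwards [hev, h7, isOpen_Ioo.mem_nhds hz₀] with z h1 h2 h3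
    have h4 := h1.1
    rw [hv z h3, hv _ h2] at h4
    simp only [hF]
    convert h4 using 3 <;> ring
  -- the reflected point `w` is critical, too, but near `z₀` the term `-(z - z₀)² / ε²` of `F`
  -- dominates, so that there is only one critical point
  have hwz : w = z₀ := by
    have h1 : HasDerivAt (fun z => F (2 * h - z))
        (-(deriv R w - 2 * ((w - z₀ - ε ^ 2 * b) / ε ^ 2))) z₀ := by
      have := (hFd w hw2).comp_const_sub (2 * h) z₀
      exact this
    have h2 := (h1.congr_of_eventuallyEq (by
      filter_upwards [hrefl] with z hz using hz.symm)).unique (hFd z₀ hz₀)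
    have h3 : (deriv R w - deriv R z₀) * ε ^ 2 = 2 * (w - z₀) := by
      field_simp at h2
      rw [hb] at h2
      linear_combination -h2
    have h4 := hK.dist_le_mul w hw1 z₀ (mem_of_mem_nhds hU)
    rw [Real.dist_eq, Real.dist_eq] at h4
    have h5 := congrArg abs h3
    rw [abs_mul, abs_mul, abs_two, abs_of_nonneg (sq_nonneg ε)] at h5
    by_contra hne
    have h6 : 0 < |w - z₀| := abs_pos.2 (sub_ne_zero.2 hne)
    have h7 : 2 * |w - z₀| ≤ K * ε ^ 2 * |w - z₀| := by
      rw [← h5]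
      calc _ ≤ K * |w - z₀| * ε ^ 2 := by gcongr
        _ = _ := by ring
    have := le_of_mul_le_mul_right h7 h6
    linarith
  have hhz : h = z₀ := by linarith
  filter_upwards [hrefl] with z hz
  rw [hhz] at hz
  simp only [hF] at hz
  have h8 : ((2 * z₀ - z - z₀ - ε ^ 2 * b) / ε) ^ 2 - ((z - z₀ - ε ^ 2 * b) / ε) ^ 2 =
      4 * (z - z₀) * b := by
    field_simp
    ring
  linear_combination -hz - h8 - 4 * (z - z₀) * hb

end RoundTube

/-! ### Quadrics -/

theorem exists_mvPolynomial_eval_eq_affineMap (f : E3 →ᵃ[ℝ] ℝ) :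
    ∃ p : MvPolynomial (Fin 3) ℝ, p.totalDegree ≤ 1 ∧
      ∀ x : E3, MvPolynomial.eval (fun i => x i) p = f x := by
  refine ⟨∑ j, MvPolynomial.C (f.linear (EuclideanSpace.single j 1)) * MvPolynomial.X j +
    MvPolynomial.C (f 0), ?_, fun x => ?_⟩
  · refine (MvPolynomial.totalDegree_add _ _).trans (max_le ?_ ?_)
    · refine MvPolynomial.totalDegree_finsetSum_le fun j _ => ?_
      refine (MvPolynomial.totalDegree_mul _ _).trans ?_
      rw [MvPolynomial.totalDegree_C, MvPolynomial.totalDegree_X]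
    · rw [MvPolynomial.totalDegree_C]
      exact Nat.zero_le _
  · have h1 : f x = f.linear x + f 0 := by
      have := f.map_vadd 0 x
      simpa using this
    have h2 : x = ∑ j, x j • EuclideanSpace.single j (1 : ℝ) := by
      ext i
      fin_cases i <;> simp [Fin.sum_univ_three]
    rw [h1]
    nth_rewrite 2 [h2]
    simp [mul_comm]

/-- Polynomials of degree at most one have vanishing second differences. -/
theorem eval_add_eval_sub_of_totalDegree_le_one {q : MvPolynomial (Fin 3) ℝ}
    (hq : q.totalDegree ≤ 1) (v : E3) :
    MvPolynomial.eval (fun i => v i) q + MvPolynomial.eval (fun i => (-v) i) q =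
      2 * MvPolynomial.eval (fun _ => 0) q := by
  set p : Polynomial ℝ :=
    MvPolynomial.aeval (fun i => Polynomial.C (v i) * Polynomial.X) q with hp
  have hdeg : p.natDegree ≤ 1 := by
    have := MvPolynomial.aeval_natDegree_le q hq
      (fun i => Polynomial.C (v i) * Polynomial.X) (n := 1) fun i =>
      (Polynomial.natDegree_C_mul_le _ _).trans Polynomial.natDegree_X_le
    simpa using this
  have heval : ∀ t : ℝ, p.eval t = MvPolynomial.eval (fun i => v i * t) q := by
    intro t
    rw [hp, ← Polynomial.coe_evalRingHom, MvPolynomial.aeval_def, MvPolynomial.hom_eval₂,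
      MvPolynomial.eval, MvPolynomial.coe_eval₂Hom]
    congr 1
    · ext x
      simp
    · ext i
      simp
  obtain ⟨a, b, hab⟩ := Polynomial.exists_eq_X_add_C_of_natDegree_le_one hdeg
  have h1 := heval 1
  have h2 := heval (-1)
  have h3 := heval 0
  rw [hab] at h1 h2 h3
  simp only [Polynomial.eval_add, Polynomial.eval_mul, Polynomial.eval_C, Polynomial.eval_X,
    mul_one, mul_neg, mul_zero, zero_add] at h1 h2 h3
  rw [← h1, show (fun i => (-v) i) = fun i => -v i from rfl, ← h2]
  rw [← h3]
  ring

/-- The equation has degree exactly two: `f₁² + f₂²` is not affine in the direction `v`, along which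
`f₃` is constant. -/
theorem isQuadric_setOf (f₁ f₂ f₃ : E3 →ᵃ[ℝ] ℝ) (a b d : ℝ) {v : E3} (h₁ : f₁.linear v ≠ 0)
    (h₃ : f₃.linear v = 0) :
    IsQuadric {x | f₁ x ^ 2 + f₂ x ^ 2 = a * f₃ x ^ 2 + b * f₃ x + d} := by
  obtain ⟨p₁, hp₁, e₁⟩ := exists_mvPolynomial_eval_eq_affineMap f₁
  obtain ⟨p₂, hp₂, e₂⟩ := exists_mvPolynomial_eval_eq_affineMap f₂
  obtain ⟨p₃, hp₃, e₃⟩ := exists_mvPolynomial_eval_eq_affineMap f₃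
  set q := p₁ ^ 2 + p₂ ^ 2 - MvPolynomial.C a * p₃ ^ 2 - MvPolynomial.C b * p₃ with hq
  have heval : ∀ x : E3, MvPolynomial.eval (fun i => x i) q =
      f₁ x ^ 2 + f₂ x ^ 2 - a * f₃ x ^ 2 - b * f₃ x := by
    intro x
    simp [hq, e₁, e₂, e₃]
  have hsq : ∀ p : MvPolynomial (Fin 3) ℝ, p.totalDegree ≤ 1 → (p ^ 2).totalDegree ≤ 2 :=
    fun p hp => (MvPolynomial.totalDegree_pow p 2).trans (by omega)
  have hC : ∀ (r : ℝ) (p : MvPolynomial (Fin 3) ℝ),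
      (MvPolynomial.C r * p).totalDegree ≤ p.totalDegree := fun r p => by
    have := MvPolynomial.totalDegree_mul (MvPolynomial.C r) p
    rwa [MvPolynomial.totalDegree_C, zero_add] at this
  have hle : q.totalDegree ≤ 2 := by
    refine (MvPolynomial.totalDegree_sub _ _).trans (max_le ?_ ((hC b p₃).trans (by omega)))
    refine (MvPolynomial.totalDegree_sub _ _).trans (max_le ?_ ((hC a _).trans (hsq _ hp₃)))
    exact (MvPolynomial.totalDegree_add _ _).trans (max_le (hsq _ hp₁) (hsq _ hp₂))
  refine ⟨q, d, le_antisymm hle ?_, ?_⟩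
  · by_contra! hlt
    have h := eval_add_eval_sub_of_totalDegree_le_one (q := q) (by omega) v
    have h0 := heval 0
    rw [heval, heval, show (fun _ => (0 : ℝ)) = fun i => (0 : E3) i from rfl, h0] at h
    have hf : ∀ f : E3 →ᵃ[ℝ] ℝ, ∀ x, f x = f.linear x + f 0 := fun f x => by
      simpa using f.map_vadd 0 x
    rw [hf f₁ v, hf f₁ (-v), hf f₂ v, hf f₂ (-v), hf f₃ v, hf f₃ (-v), map_neg, map_neg, map_neg,
      h₃] at h
    have h4 : f₁.linear v ^ 2 + f₂.linear v ^ 2 = 0 := by linear_combination h / 2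
    have : 0 < f₁.linear v ^ 2 := by positivity
    nlinarith [sq_nonneg (f₂.linear v)]
  · ext x
    rw [mem_ofPred_eq, mem_ofPred_eq, heval]
    constructor <;> intro h <;> linear_combination h

/-- The quadric is `(ℓ₁ (x - c z))² + (ℓ₂ (x - c z))² = R z`, where `c` is affine and `R` is
quadratic. -/
theorem RoundTube.exists_quadric {c : ℝ → E2} {γ : ℝ → ℝ → E2} {ℓ₁ ℓ₂ : E2 →L[ℝ] ℝ} {R : ℝ → ℝ}
    (ht : RoundTube c γ ℓ₁ ℓ₂ R) (A : E3 ≃ᵃ[ℝ] E3) :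
    ∃ Q, IsQuadric Q ∧ A ⁻¹' tubeSet c γ ⊆ Q := by
  obtain ⟨v₂, hv₂⟩ := affine_of_deriv_deriv_eq_zero
    (ℓ₂.contDiff.comp_contDiffOn ht.contDiffOn_center)
    fun z hz => ht.deriv_deriv_center_eq_zero hz
  obtain ⟨v₁, hv₁⟩ := affine_of_deriv_deriv_eq_zero
    (ℓ₁.contDiff.comp_contDiffOn ht.contDiffOn_center)
    fun z hz => ht.swap.deriv_deriv_center_eq_zero hz
  obtain ⟨a, b, d, hR⟩ := quadratic_of_forall_eventually_reflect ht.contDiffOn_sqRadius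
    fun z hz => ht.eventually_sqRadius_reflect hv₁ hz
  let h : E3 →ₗ[ℝ] ℝ := (EuclideanSpace.proj (2 : Fin 3) : E3 →L[ℝ] ℝ).toLinearMap
  let f : (E2 →L[ℝ] ℝ) → ℝ → E3 →ᵃ[ℝ] ℝ := fun ℓ v =>
    (ℓ.toLinearMap ∘ₗ projL.toLinearMap - v • h).toAffineMap.comp A.toAffineMap -
      AffineMap.const ℝ E3 (ℓ (c 0))
  have hf : ∀ ℓ v x, f ℓ v x = ℓ (projL (A x)) - v * A x 2 - ℓ (c 0) := fun ℓ v x => rfl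
  have hflin : ∀ ℓ v w, (f ℓ v).linear w =
      ℓ (projL (A.linear w)) - v * A.linear w 2 - 0 := fun ℓ v w => rfl
  obtain ⟨y, hy, -⟩ := ht.surjective 1 0
  have hlin : ∀ w, A.linear (A.linear.symm w) = w := fun w => A.linear.apply_symm_apply w
  refine ⟨_, isQuadric_setOf (f ℓ₁ v₁) (f ℓ₂ v₂) (h.toAffineMap.comp A.toAffineMap) a b d
    (v := A.linear.symm (atHeight y 0)) ?_ ?_, ?_⟩
  · rw [hflin, hlin, projL_atHeight, hy, atHeight_two]
    norm_num
  · show A.linear (A.linear.symm (atHeight y 0)) 2 = 0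
    rw [hlin, atHeight_two]
  · rintro x ⟨z, hz, θ, hx⟩
    show f ℓ₁ v₁ x ^ 2 + f ℓ₂ v₂ x ^ 2 = a * A x 2 ^ 2 + b * A x 2 + d
    have h1 := hv₁ z hz
    have h2 := hv₂ z hz
    simp only [Function.comp_apply, smul_eq_mul] at h1 h2
    rw [hf, hf, hx, projL_atHeight, atHeight_two, ← hR z hz,
      ← (ht.mem_range_iff z hz _).1 ⟨θ, rfl⟩, map_add, map_add, h1, h2]
    ring

end CollarTheorem

end

theorem proposition5p1 (T : Set CollarTheorem.E3)
    (hT : CollarTheorem.IsTransverselyConvexTube T) (hcpo : CollarTheorem.HasCPO T) :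
    (∃ C : Set CollarTheorem.E3, CollarTheorem.IsCentralCylinder C ∧ T ⊆ C) ∨
      (∃ Q : Set CollarTheorem.E3, CollarTheorem.IsQuadric Q ∧ T ⊆ Q) := by
  obtain ⟨A, c, γ, hc, hγ, hov, hset⟩ := hT
  have hset' : A '' T = CollarTheorem.tubeSet c γ := hset
  have ht : CollarTheorem.SymTube c γ :=
    CollarTheorem.CPOTube.symTube ⟨hc, hγ, fun z hz => (hov z hz).1,
      fun P O hPO => hcpo.isCentral_of_image A (hset' ▸ hPO)⟩ fun z hz => (hov z hz).2
  rcases ht.supp_dichotomy with h | ⟨α, β, δ, h⟩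
  · left
    obtain ⟨C, hC, hsub⟩ := ht.subset_cylinder_of_supp_eq h
    refine ⟨A.symm '' C, hC.map A.symm, fun x hx => ?_⟩
    exact ⟨A x, hsub (hset' ▸ Set.mem_image_of_mem A hx), A.symm_apply_apply x⟩
  · right
    obtain ⟨ℓ₁, ℓ₂, R, hround⟩ := ht.exists_roundTube h
    obtain ⟨Q, hQ, hsub⟩ := hround.exists_quadric A
    exact ⟨Q, hQ, fun x hx => hsub (show A x ∈ _ from hset' ▸ Set.mem_image_of_mem A hx)⟩
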